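/- Let $N\ge 2$ and let $X=\{X(t):t\in\mathbb R^N\}$ be a centered isotropic Gaussian random field with $\operatorname{Cov}[X(s),X(t)]=\rho(\|t-s\|^2)$, $\rho:[0,\infty)\to\mathbb R$, $\rho(0)=1$. Assume that $X$ is \emph{qualified}: almost surely all partial derivatives of $X$ of first and second order exist; the sixth derivative of $\rho$ at $0$ exists (derivatives at $0$ being one-sided); for every $t\neq 0$ the Gaussian vector $(\nabla^2X(t),\nabla X(t),X(t),\nabla X(0),X(0))$ is non-degenerate, where the symmetric matrix $\nabla^2X(t)=(X_{ij}(t))$ is identified with the vector of its entries with $i\le j$; and $(X_{111}(0),\nabla X(0))$ is non-degenerate, where $X_{111}(0)$ is the third mean square derivative of $X$ at $0$ along the first coordinate axis. Let $L=N(N+1)/2+2$, and for $t\ne0$ let $\Sigma(t)\in\mathbb R^{L\times L}$ be the covariance matrix of $(\nabla^2X(t),X(t),X(0))$ conditional on $\nabla X(t)=\nabla X(0)=0$. Assume that $X$ is \emph{qualified under perturbation}: for $t\ne 0$ there are an orthogonal matrix $P(t)$ and a diagonal matrix $\Lambda(t)$, with the eigenvalues of $\Sigma(t)$ in decreasing order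 on its diagonal, such that $\Sigma(t)=P(t)\Lambda(t)P(t)^T$ and, for every unit vector $v\in\mathbb R^N$, the limits $P_{v,0}$ of $P(rv)$ and $\Lambda_{v,0}$ of $\Lambda(rv)$ as $r\downarrow0$ exist, the functions $r\mapsto P(rv)$ and $r\mapsto\Lambda(rv)$, extended by these limits at $r=0$, are continuous on $[0,\delta']$ for some $\delta'>0$ (which may depend on $v$), and as $r\downarrow 0$ $$P(rv)=P_{v,0}+P_{v,1}r+o(r),\qquad \Lambda(rv)=\Lambda_{v,0}+\Lambda_{v,1}r+\Lambda_{v,2}r^2+o(r^2)$$ for some $L\times L$ matrix $P_{v,1}$ and some diagonal $L\times L$ matrices $\Lambda_{v,1},\Lambda_{v,2}$. Assume finally that for some $\delta>0$ and all $x\in(0,\delta^2]$, $$\rho'(x)<0\quad\text{and}\quad \rho'(x)^2+2\rho'(x)\rho''(x)x+4\rho''(x)^2x^2<\rho'(0)^2 .$$ For $0\le k\le N$ let $D_k\subset\mathbb R^{N(N+1)/2}$ be the set of (vectorized) non-degenerate symmetric $N\times N$ matrices with exactly $k$ negative eigenvalues, counted with multiplicity. For $u\in\mathbb R$ and $t\ne0$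 let $$f_{u,k}(t)=\frac{p_t(0,0)}{\mathbb P(X(0)>u)\,p(0)}\int_{x,z>u}\int_{D_k}|\det x''|\;p_t(x'',x,z\mid 0,0)\,dx''\,dx\,dz ,$$ where $p$ is the density of $\nabla X(0)$, $p_t(\cdot,\cdot)$ that of $(\nabla X(t),\nabla X(0))$, and $p_t(\cdot\mid0,0)$ the centered Gaussian density with covariance matrix $\Sigma(t)$, i.e. the density of $(\nabla^2X(t),X(t),X(0))$ conditional on $\nabla X(t)=\nabla X(0)=0$. (By Rice's formula, $f_{u,k}$ is the density of the mean measure of the critical points of $X$ above $u$ with index $k$, conditional on $\nabla X(0)=0$ and $X(0)>u$.) Then for every $u>0$ the limit of $\dfrac{f_{u,N}(t)}{f_{u,N-1}(t)+f_{u,N}(t)}$ as $\|t\|\to0$, $t\ne0$, exists, and $$\lim_{u\to\infty}\ \lim_{\|t\|\to0}\ \frac{f_{u,N}(t)}{f_{u,N-1}(t)+f_{u,N}(t)}=\frac12 .$$ -/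

import Mathlib

open MeasureTheory ProbabilityTheory Filter Topology Asymptotics
open scoped Matrix

noncomputable section

namespace GaussField

/-- The parameter space `ℝ^N` with the Euclidean norm. -/
abbrev E (N : ℕ) : Type := EuclideanSpace ℝ (Fin N)

/-- Indices `(i, j)` with `i ≤ j`: the `N (N + 1) / 2` coordinates of the usual vectorization of a
symmetric `N × N` matrix. -/
abbrev UpperIdx (N : ℕ) : Type := {p : Fin N × Fin N // p.1 ≤ p.2}

/-- The symmetric matrix whose usual vectorization is `a`. -/
def matri {N : ℕ} (a : UpperIdx N → ℝ) : Matrix (Fin N) (Fin N) ℝ :=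
  Matrix.of fun i j => a ⟨(min i j, max i j), min_le_max⟩

lemma matri_isHermitian {N : ℕ} (a : UpperIdx N → ℝ) : (matri a).IsHermitian := by
  ext i j
  simp [matri, min_comm, max_comm]

/-- The number of negative eigenvalues, counted with multiplicity, of the symmetric matrix with
vectorization `a`. -/
def negIndex {N : ℕ} (a : UpperIdx N → ℝ) : ℕ :=
  (Finset.univ.filter fun i => (matri_isHermitian a).eigenvalues i < 0).card

/-- `D k`: the (vectorized) non-degenerate symmetric matrices with exactly `k` negative
eigenvalues. -/
def D (N k : ℕ) : Set (UpperIdx N → ℝ) :=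
  {a | (matri a).det ≠ 0 ∧ negIndex a = k}

/-- The density at `y` of the centered Gaussian distribution with covariance matrix `V`. -/
def gaussDensity {ι : Type*} [Fintype ι] [DecidableEq ι] (V : Matrix ι ι ℝ) (y : ι → ℝ) : ℝ :=
  (√((2 * Real.pi) ^ Fintype.card ι * V.det))⁻¹ * Real.exp (-(1 / 2) * (y ⬝ᵥ (V⁻¹ *ᵥ y)))

section Field

variable {Ω : Type*} [MeasurableSpace Ω] {N : ℕ}

/-- The (cross-)covariance matrix of two finite families of random variables. -/
def covMat {ι κ : Type*} (P : Measure Ω) (Y : ι → Ω → ℝ) (Z : κ → Ω → ℝ) : Matrix ι κ ℝ :=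
  Matrix.of fun i j => cov[Y i, Z j; P]

/-- The first partial derivative `X_i(t)` of the sample paths. -/
def grad (X : E N → Ω → ℝ) (t : E N) (i : Fin N) (ω : Ω) : ℝ :=
  lineDeriv ℝ (fun s => X s ω) t (EuclideanSpace.single i 1)

/-- The second partial derivative `X_ij(t)` of the sample paths. -/
def secondDeriv (X : E N → Ω → ℝ) (t : E N) (i j : Fin N) (ω : Ω) : ℝ :=
  lineDeriv ℝ (fun s => grad X s i ω) t (EuclideanSpace.single j 1)

/-- The random vector `(∇²X(t), X(t), X(0))`, the Hessian being vectorized. -/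
def valueVec (X : E N → Ω → ℝ) (t : E N) : UpperIdx N ⊕ Fin 2 → Ω → ℝ :=
  Sum.elim (fun p => secondDeriv X t p.1.1 p.1.2) ![X t, X 0]

/-- The random vector `(∇X(t), ∇X(0))`. -/
def gradVec (X : E N → Ω → ℝ) (t : E N) : Fin N ⊕ Fin N → Ω → ℝ :=
  Sum.elim (grad X t) (grad X 0)

/-- The matrix `Σ(t)`: the covariance matrix of the Gaussian vector `(∇²X(t), X(t), X(0))`
conditional on `∇X(t) = ∇X(0) = 0`. -/
def condCov (P : Measure Ω) (X : E N → Ω → ℝ) (t : E N) :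
    Matrix (UpperIdx N ⊕ Fin 2) (UpperIdx N ⊕ Fin 2) ℝ :=
  covMat P (valueVec X t) (valueVec X t) -
    covMat P (valueVec X t) (gradVec X t) * (covMat P (gradVec X t) (gradVec X t))⁻¹ *
      (covMat P (valueVec X t) (gradVec X t))ᵀ

/-- `Z` is the mean square derivative of the random field `Y` at `t` in the direction `v`. -/
def IsMeanSquareDeriv (P : Measure Ω) (Y : E N → Ω → ℝ) (t v : E N) (Z : Ω → ℝ) : Prop :=
  MemLp Z 2 P ∧
    Tendsto (fun h : ℝ => eLpNorm (fun ω => h⁻¹ * (Y (t + h • v) ω - Y t ω) - Z ω) 2 P)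
      (𝓝[≠] 0) (𝓝 0)

/-- The `k`-th derivative of `ρ : [0, ∞) → ℝ` (one-sided at the end point `0`). -/
def rhoDeriv (ρ : ℝ → ℝ) (k : ℕ) : ℝ → ℝ := iteratedDerivWithin k ρ (Set.Ici 0)

/-- `X` is a qualified isotropic Gaussian random field on `ℝ^N` with covariance
`Cov[X(s), X(t)] = ρ(‖t - s‖²)`. -/
structure IsQualified (P : Measure Ω) (X : E N → Ω → ℝ) (ρ : ℝ → ℝ) : Prop where
  two_le : 2 ≤ N
  gaussian : IsGaussianProcess X P
  isotropic : ∀ s t, cov[X s, X t; P] = ρ (‖t - s‖ ^ 2)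
  centered : ∀ t, ∫ ω, X t ω ∂P = 0
  unit_variance : ρ 0 = 1
  /-- Almost surely, all partial derivatives of first and second order exist. -/
  partials : ∀ᵐ ω ∂P, ∀ (t : E N) (i j : Fin N),
    LineDifferentiableAt ℝ (fun s => X s ω) t (EuclideanSpace.single i 1) ∧
    LineDifferentiableAt ℝ (fun s => grad X s i ω) t (EuclideanSpace.single j 1)
  /-- The sixth derivative of `ρ` at `0` exists: `ρ` is five times differentiable near `0` and its
  fifth derivative is differentiable at `0`. -/
  sixth_deriv :
    (∃ δ > 0, ∀ k < 5, ∀ x ∈ Set.Ico (0 : ℝ) δ,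
      DifferentiableWithinAt ℝ (rhoDeriv ρ k) (Set.Ici 0) x) ∧
    DifferentiableWithinAt ℝ (rhoDeriv ρ 5) (Set.Ici 0) 0
  /-- The Gaussian vector `(∇²X(t), X(t), X(0), ∇X(t), ∇X(0))` is non-degenerate for `t ≠ 0`. -/
  nondegenerate : ∀ t : E N, t ≠ 0 →
    (covMat P (Sum.elim (valueVec X t) (gradVec X t))
      (Sum.elim (valueVec X t) (gradVec X t))).PosDef
  /-- `(X_111(0), ∇X(0))` is non-degenerate, where `X_111(0)` is the third mean square derivative
  of `X` at `0` along the first coordinate axis. -/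
  nondegenerate_third : ∃ Z : Ω → ℝ,
    IsMeanSquareDeriv P (fun t => secondDeriv X t ⟨0, by omega⟩ ⟨0, by omega⟩) 0
      (EuclideanSpace.single ⟨0, by omega⟩ 1) Z ∧
    (covMat P (Sum.elim (fun _ : Fin 1 => Z) (grad X 0))
      (Sum.elim (fun _ : Fin 1 => Z) (grad X 0))).PosDef

/-- The number `L = N (N + 1) / 2 + 2` of coordinates of `(∇²X(t), X(t), X(0))`. -/
abbrev L (N : ℕ) : ℕ := Fintype.card (UpperIdx N ⊕ Fin 2)

/-- `t ↦ Q t * diag (lam t) * (Q t)ᵀ`, for `t ≠ 0`, is an orthogonal eigen-decomposition of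
`Σ(t)` with the eigenvalues in decreasing order. -/
def IsEigenVersion (P : Measure Ω) (X : E N → Ω → ℝ)
    (Q : E N → Matrix (UpperIdx N ⊕ Fin 2) (Fin (L N)) ℝ) (lam : E N → Fin (L N) → ℝ) : Prop :=
  ∀ t : E N, t ≠ 0 →
    (Q t)ᵀ * Q t = 1 ∧ Q t * (Q t)ᵀ = 1 ∧ Antitone (lam t) ∧
    condCov P X t = Q t * Matrix.diagonal (lam t) * (Q t)ᵀ

/-- `X` is qualified under perturbation. -/
def IsQualifiedUnderPerturbation (P : Measure Ω) (X : E N → Ω → ℝ) (ρ : ℝ → ℝ) : Prop :=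
  IsQualified P X ρ ∧
  ∃ (Q : E N → Matrix (UpperIdx N ⊕ Fin 2) (Fin (L N)) ℝ) (lam : E N → Fin (L N) → ℝ),
    IsEigenVersion P X Q lam ∧
    ∀ v : E N, ‖v‖ = 1 →
      ∃ (Q₀ Q₁ : Matrix (UpperIdx N ⊕ Fin 2) (Fin (L N)) ℝ) (lam₀ lam₁ lam₂ : Fin (L N) → ℝ),
        Tendsto (fun r : ℝ => Q (r • v)) (𝓝[>] 0) (𝓝 Q₀) ∧
        Tendsto (fun r : ℝ => lam (r • v)) (𝓝[>] 0) (𝓝 lam₀) ∧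
        (∃ δ > 0, ContinuousOn (fun r : ℝ => Q (r • v)) (Set.Ioc 0 δ) ∧
          ContinuousOn (fun r : ℝ => lam (r • v)) (Set.Ioc 0 δ)) ∧
        (∀ a b, (fun r : ℝ => Q (r • v) a b - (Q₀ a b + Q₁ a b * r)) =o[𝓝[>] 0] fun r => r) ∧
        (∀ b, (fun r : ℝ => lam (r • v) b - (lam₀ b + lam₁ b * r + lam₂ b * r ^ 2))
          =o[𝓝[>] 0] fun r => r ^ 2)

/-- `f_{u,k}(t)`: the (Kac-Rice) density at `t` of the mean measure of the critical points of `X`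
above `u` with index `k`, conditional on `∇X(0) = 0` and `X(0) > u`. The last factor integrates
over the values `(x'', x, z)` of `(∇²X(t), X(t), X(0))` with `x'' ∈ D k` and `x, z > u`, against
the conditional density of this vector given `∇X(t) = ∇X(0) = 0`. -/
def critDensity (P : Measure Ω) (X : E N → Ω → ℝ) (u : ℝ) (k : ℕ) (t : E N) : ℝ :=
  (P.real {ω | u < X 0 ω})⁻¹ *
  (gaussDensity (covMat P (grad X 0) (grad X 0)) 0)⁻¹ *
  gaussDensity (covMat P (gradVec X t) (gradVec X t)) 0 *
  ∫ y in {y : UpperIdx N ⊕ Fin 2 → ℝ |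
      (fun p => y (Sum.inl p)) ∈ D N k ∧ u < y (Sum.inr 0) ∧ u < y (Sum.inr 1)},
    |(matri fun p => y (Sum.inl p)).det| * gaussDensity (condCov P X t) y

end Field

end GaussField

end

/-! Put r = ‖t‖ and use an orthonormal frame whose vector `o` points along t. On the event ∇X(t) =
∇X(0) = 0, Taylor expansion of the gradient along t gives X_oo(t) ≈ (r/2) X_ooo; the mixed entries
X_ob(t) are also of order r, and the remaining block of the Hessian stays of order one. Lengthening
the frame vector `o` by the factor r^(-1/2) multiplies X_oo by 1/r and X_ob by r^(-1/2). The
covariance matrix of the rescaled Hessian together with (X(t), X(0)) then converges to `limitCov`,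
whatever the direction of t (`SmoothNear.tendsto_scaled_condEntry`). In the limit X(t) = X(0) = x,
the Hessian M splits into the scalar M_oo and a block M', and M_oo is nondegenerate, centered and
independent of (M', x).

A congruence M ↦ S M Sᵀ preserves the index and multiplies |det M| by (det S)², so rotation and
rescaling cancel in the ratio (`idxDet_congr`, `kacRice_congrMap`). Gaussian integrals of the
Kac-Rice integrand are continuous in the covariance matrix, even at a singular limit, which gives
the limit in t for fixed u.

For the limit in u, the sign change M_oo ↦ -M_oo preserves the law. It carries index N into index N
- 1, so the limiting ratio is at most 1/2 (`integral_kacRice_le`). It also carries index N - 1 into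
index N whenever M' is negative definite. Regression on x gives M' = (part independent of x) - a x I
with a > 0, so on x > u the block can fail to be negative definite only if the independent part has
size at least a u. The error is at most G(u) P(x > u) with G(u) → 0 (`integral_kacRice_pred_le`),
while the index-N integral is at least p P(x > u) with a fixed p > 0 (`le_integral_kacRice`). Hence
the ratio tends to 1/2 (`IsDegenerateCov.tendsto_ratio`).

The covariances come from differentiating ρ(‖t - s‖²): almost sure limits of centered Gaussian
variables are Gaussian with convergent variances (`IsCenteredGaussian.of_tendsto`). Conditioning is
explicit because the sums and differences of the two gradients, taken in the frame, are pairwise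
uncorrelated (`cov_rotGradVec_rotGradVec`). -/

noncomputable section

namespace GaussField

/-! ### Index of a symmetric matrix -/

section Index

variable {n : Type*} [Fintype n] [DecidableEq n]

/-- The negative index of inertia of the quadratic form of a square matrix. -/
def negInertia (M : Matrix n n ℝ) : ℕ := sigNeg M.toQuadraticForm'

lemma toQuadraticForm'_apply_eq (M : Matrix n n ℝ) (w : n → ℝ) :
    M.toQuadraticForm' w = w ⬝ᵥ M *ᵥ w := by
  simp [Matrix.toQuadraticForm', LinearMap.BilinMap.toQuadraticMap_apply,
    Matrix.toLinearMap₂'_apply']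

lemma toQuadraticForm'_congr_equivalent (M S : Matrix n n ℝ) (hS : S.det ≠ 0) :
    QuadraticMap.Equivalent (S * M * Sᵀ).toQuadraticForm' M.toQuadraticForm' := by
  have hu : IsUnit Sᵀ.det := by simpa using hS
  refine ⟨⟨Matrix.toLinearEquiv' Sᵀ (Matrix.invertibleOfIsUnitDet _ hu), fun w => ?_⟩⟩
  change M.toQuadraticForm' (Sᵀ *ᵥ w) = _
  rw [toQuadraticForm'_apply_eq, toQuadraticForm'_apply_eq, ← Matrix.mulVec_mulVec,
    ← Matrix.mulVec_mulVec, Matrix.dotProduct_mulVec w, Matrix.mulVec_transpose]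

/-- Sylvester's law of inertia; S need not be orthogonal, which is what allows the frame to be
stretched. -/
lemma negInertia_congr (M S : Matrix n n ℝ) (hS : S.det ≠ 0) :
    negInertia (S * M * Sᵀ) = negInertia M :=
  (toQuadraticForm'_congr_equivalent M S hS).sigNeg_eq

lemma IsHermitian.equivalent_weightedSumSquares {A : Matrix n n ℝ} (hA : A.IsHermitian) :
    QuadraticMap.Equivalent A.toQuadraticForm'
      (QuadraticMap.weightedSumSquares ℝ hA.eigenvalues) := by
  set U : Matrix n n ℝ := hA.eigenvectorUnitary.1 with hU
  have hUU : U * Uᵀ = 1 := by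
    have := Unitary.mul_star_self_of_mem hA.eigenvectorUnitary.2
    simpa [Matrix.star_eq_conjTranspose] using this
  have hdet : U.det ≠ 0 := by
    intro h
    have := congrArg Matrix.det hUU
    simp [h] at this
  have hspec : A = U * Matrix.diagonal hA.eigenvalues * Uᵀ := by
    conv_lhs => rw [hA.spectral_theorem]
    simp [Unitary.conjStarAlgAut_apply, Matrix.star_eq_conjTranspose, hU]
  have h := toQuadraticForm'_congr_equivalent (Matrix.diagonal hA.eigenvalues) U hdet
  rw [← hspec] at h
  convert h using 1
  ext w
  simp only [toQuadraticForm'_apply_eq, QuadraticMap.weightedSumSquares_apply, dotProduct,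
    Matrix.mulVec_diagonal, smul_eq_mul]
  exact Finset.sum_congr rfl fun i _ => by ring

lemma IsHermitian.negInertia_eq {A : Matrix n n ℝ} (hA : A.IsHermitian) :
    negInertia A = (Finset.univ.filter fun i => hA.eigenvalues i < 0).card := by
  rw [negInertia, QuadraticForm.sigNeg_of_equiv_weightedSumSquares
    (IsHermitian.equivalent_weightedSumSquares hA), Set.ncard_eq_toFinset_card']
  congr 1
  ext i
  simp

lemma IsHermitian.sigPos_add_sigNeg {A : Matrix n n ℝ} (hA : A.IsHermitian) (hdet : A.det ≠ 0) :
    sigPos A.toQuadraticForm' + sigNeg A.toQuadraticForm' = Fintype.card n := by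
  have he := IsHermitian.equivalent_weightedSumSquares hA
  rw [QuadraticForm.sigNeg_of_equiv_weightedSumSquares he,
    QuadraticForm.sigPos_of_equiv_weightedSumSquares he, ← Set.ncard_union_eq]
  · rw [← Nat.card_eq_fintype_card, ← Set.ncard_univ]
    congr 1
    ext i
    have : hA.eigenvalues i ≠ 0 := by
      intro h0
      apply hdet
      rw [hA.det_eq_prod_eigenvalues]
      exact Finset.prod_eq_zero (Finset.mem_univ i) (by simpa using h0)
    simpa using this.symm.lt_or_gt
  · rw [Set.disjoint_left]
    intro i h1 h2
    exact lt_asymm (Set.mem_ofPred.1 h1) (Set.mem_ofPred.1 h2)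

/-- On the compact unit sphere of a maximal positive subspace the form is positive, and this
survives small perturbations of the matrix. -/
lemma eventually_sigPos_le (A : Matrix n n ℝ) :
    ∀ᶠ B in 𝓝 A, sigPos A.toQuadraticForm' ≤ sigPos B.toQuadraticForm' := by
  obtain ⟨V, hV, hpos⟩ := exists_finrank_eq_sigPos_and_posDef A.toQuadraticForm'
  set K : Set (n → ℝ) := Metric.sphere 0 1 ∩ V with hK
  have hKc : IsCompact K :=
    (isCompact_sphere _ _).inter_right (Submodule.closed_of_finiteDimensional V)
  have hev : ∀ᶠ B in 𝓝 A, ∀ w ∈ K, 0 < w ⬝ᵥ B *ᵥ w := by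
    refine hKc.eventually_forall_of_forall_eventually fun w hw => ?_
    have hc : Continuous fun z : Matrix n n ℝ × (n → ℝ) => z.2 ⬝ᵥ z.1 *ᵥ z.2 := by fun_prop
    refine hc.continuousAt.eventually_mem (lt_mem_nhds ?_)
    have := hpos ⟨w, hw.2⟩ (by
      intro h
      have h0 : w = 0 := congrArg Subtype.val h
      have := hw.1
      simp [h0] at this)
    simpa [QuadraticMap.restrict_apply, toQuadraticForm'_apply_eq] using this
  filter_upwards [hev] with B hB
  rw [← hV]
  refine le_sigPos_of_posDef _ fun w hw => ?_
  have hw0 : (w : n → ℝ) ≠ 0 := by simpa using hw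
  have hn : 0 < ‖(w : n → ℝ)‖ := norm_pos_iff.2 hw0
  have := hB (‖(w : n → ℝ)‖⁻¹ • (w : n → ℝ))
    ⟨by simp [norm_smul, hn.ne'], V.smul_mem _ w.2⟩
  rw [Matrix.mulVec_smul, smul_dotProduct, dotProduct_smul, smul_smul, smul_eq_mul] at this
  rw [QuadraticMap.restrict_apply, toQuadraticForm'_apply_eq]
  exact pos_of_mul_pos_right this (by positivity)

lemma toQuadraticForm'_neg (A : Matrix n n ℝ) : (-A).toQuadraticForm' = -A.toQuadraticForm' := by
  ext w
  simp [toQuadraticForm'_apply_eq, Matrix.neg_mulVec]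

/-- Both signatures are lower semicontinuous, and for a nondegenerate form they already add up to
the dimension, so neither can grow. -/
lemma eventually_negInertia_eq {A : Matrix n n ℝ} (hA : A.IsHermitian) (hdet : A.det ≠ 0) :
    ∀ᶠ B in 𝓝 A, negInertia B = negInertia A := by
  have h1 := eventually_sigPos_le A
  have h2 : ∀ᶠ B in 𝓝 A, sigNeg A.toQuadraticForm' ≤ sigNeg B.toQuadraticForm' := by
    have := (continuous_neg.tendsto A).eventually (eventually_sigPos_le (-A))
    simpa [toQuadraticForm'_neg] using this
  filter_upwards [h1, h2] with B hB1 hB2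
  have h3 := IsHermitian.sigPos_add_sigNeg hA hdet
  have h4 := QuadraticForm.sigPos_add_sigNeg_add_radical (Q := B.toQuadraticForm')
  simp only [Module.finrank_fintype_fun_eq_card] at h4
  rw [negInertia, negInertia]
  omega

lemma posDef_neg_of_negInertia_eq_card {A : Matrix n n ℝ} (hA : A.IsHermitian)
    (h : negInertia A = Fintype.card n) : (-A).PosDef := by
  obtain ⟨V, hV, hpos⟩ := exists_finrank_eq_sigNeg_and_negDef A.toQuadraticForm'
  have hVtop : V = ⊤ := by
    apply Submodule.eq_top_of_finrank_eq
    rw [hV, Module.finrank_fintype_fun_eq_card]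
    exact h
  refine Matrix.PosDef.of_dotProduct_mulVec_pos hA.neg fun x hx => ?_
  have := hpos ⟨x, by simp [hVtop]⟩ (by simpa using hx)
  simpa [QuadraticMap.restrict_apply, toQuadraticForm'_apply_eq, Matrix.neg_mulVec] using this

lemma finrank_le_negInertia {A : Matrix n n ℝ} (V : Submodule ℝ (n → ℝ))
    (h : ∀ w ∈ V, w ≠ 0 → w ⬝ᵥ A *ᵥ w < 0) : Module.finrank ℝ V ≤ negInertia A := by
  refine le_sigNeg_of_negDef _ fun w hw => ?_
  have := h w w.2 (by simpa using hw)
  simpa [QuadraticMap.restrict_apply, toQuadraticForm'_apply_eq] using this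

lemma negInertia_eq_card_of_posDef_neg {A : Matrix n n ℝ} (h : (-A).PosDef) :
    negInertia A = Fintype.card n := by
  apply le_antisymm
  · have := QuadraticForm.sigPos_add_sigNeg_add_radical (Q := A.toQuadraticForm')
    simp only [Module.finrank_fintype_fun_eq_card] at this
    rw [negInertia]
    omega
  · have := finrank_le_negInertia (A := A) ⊤ fun w _ hw => by
      have := h.dotProduct_mulVec_pos hw
      simpa [Matrix.neg_mulVec] using this
    simpa using this

/-- `|det M|` restricted to the matrices of negative index of inertia `k`. -/
def idxDet (k : ℕ) (M : Matrix n n ℝ) : ℝ :=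
  if negInertia M = k then |M.det| else 0

lemma idxDet_nonneg (k : ℕ) (M : Matrix n n ℝ) : 0 ≤ idxDet k M := by
  unfold idxDet; split_ifs <;> positivity

lemma idxDet_le (k : ℕ) (M : Matrix n n ℝ) : idxDet k M ≤ |M.det| := by
  unfold idxDet; split_ifs <;> simp

lemma idxDet_congr (k : ℕ) (M S : Matrix n n ℝ) (hS : S.det ≠ 0) :
    idxDet k (S * M * Sᵀ) = S.det ^ 2 * idxDet k M := by
  unfold idxDet
  rw [negInertia_congr M S hS]
  split_ifs
  · rw [Matrix.det_mul, Matrix.det_mul, Matrix.det_transpose,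
      show S.det * M.det * S.det = S.det ^ 2 * M.det by ring, abs_mul, abs_of_nonneg (sq_nonneg _)]
  · simp

/-- The index jumps only across singular matrices, and there the factor |det| vanishes. -/
lemma continuousAt_idxDet (k : ℕ) {A : Matrix n n ℝ} (hA : A.IsHermitian) :
    ContinuousAt (idxDet k) A := by
  have hc : Continuous fun M : Matrix n n ℝ => |M.det| := by fun_prop
  by_cases hdet : A.det = 0
  · have h0 : idxDet k A = 0 := by simp [idxDet, hdet]
    rw [ContinuousAt, h0]
    refine squeeze_zero (idxDet_nonneg k) (idxDet_le k) ?_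
    have := hc.tendsto A
    simpa [hdet] using this
  · have hev := eventually_negInertia_eq hA hdet
    by_cases hk : negInertia A = k
    · refine hc.continuousAt.congr ?_
      filter_upwards [hev] with B hB
      simp [idxDet, hB, hk]
    · refine continuousAt_const (y := (0 : ℝ)) |>.congr ?_
      filter_upwards [hev] with B hB
      simp [idxDet, hB, hk]

end Index

section Vectorized

variable {N : ℕ}

lemma continuous_matri : Continuous (matri : (UpperIdx N → ℝ) → Matrix (Fin N) (Fin N) ℝ) := by
  unfold matri
  fun_prop

lemma continuous_idxDet_matri (k : ℕ) :
    Continuous fun a : UpperIdx N → ℝ => idxDet k (matri a) :=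
  continuous_iff_continuousAt.2 fun a =>
    ContinuousAt.comp (f := matri) (continuousAt_idxDet k (matri_isHermitian a))
      continuous_matri.continuousAt

lemma negIndex_eq (a : UpperIdx N → ℝ) : negIndex a = negInertia (matri a) :=
  (IsHermitian.negInertia_eq (matri_isHermitian a)).symm

lemma indicator_D_abs_det (k : ℕ) (a : UpperIdx N → ℝ) :
    (D N k).indicator (fun a => |(matri a).det|) a = idxDet k (matri a) := by
  classical
  by_cases hdet : (matri a).det = 0
  · rw [Set.indicator_of_notMem (by simp [D, hdet])]
    simp [idxDet, hdet]
  · simp [Set.indicator_apply, D, hdet, idxDet, negIndex_eq]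

lemma measurableSet_D (k : ℕ) : MeasurableSet (D N k) := by
  -- `D N k` is the non-vanishing set of a continuous function, so no measurability of eigenvalues
  -- is needed.
  have : D N k = {a | idxDet k (matri a) ≠ 0} := by
    ext a
    by_cases hdet : (matri a).det = 0 <;> simp [D, hdet, idxDet, negIndex_eq]
  rw [this]
  exact (continuous_idxDet_matri k).measurable (measurableSet_singleton 0).compl

end Vectorized

/-! ### Gaussian integrals -/

section Gaussian

variable {ι κ κ' : Type*} [Fintype ι] [Fintype κ] [Fintype κ']

/-- The standard Gaussian measure on `κ → ℝ`. -/
def stdG (κ : Type*) [Fintype κ] : Measure (κ → ℝ) := Measure.pi fun _ : κ => gaussianReal 0 1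

instance : IsProbabilityMeasure (stdG κ) := by unfold stdG; infer_instance

instance : IsGaussian (stdG κ) := by
  have h : stdG κ = (stdGaussian (EuclideanSpace ℝ κ)).map
      (EuclideanSpace.equiv κ ℝ : EuclideanSpace ℝ κ →L[ℝ] κ → ℝ) := by
    rw [← map_pi_eq_stdGaussian, Measure.map_map (by fun_prop) (by fun_prop)]
    exact (Measure.map_id).symm
  rw [h]
  infer_instance

lemma charFun_map_mulVec_stdG (B : Matrix ι κ ℝ) (t : EuclideanSpace ℝ ι) :
    charFun (((stdG κ).map B.mulVec).map (WithLp.toLp 2)) t =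
      Complex.exp (-((t.ofLp ⬝ᵥ (B * Bᵀ) *ᵥ t.ofLp : ℝ) : ℂ) / 2) := by
  have h1 : charFun (((stdG κ).map B.mulVec).map (WithLp.toLp 2)) t =
      charFun ((stdG κ).map (WithLp.toLp 2)) (WithLp.toLp 2 (Bᵀ *ᵥ t.ofLp)) := by
    rw [charFun_apply, charFun_apply, Measure.map_map (by fun_prop) (by fun_prop),
      integral_map (by fun_prop) (by fun_prop), integral_map (by fun_prop) (by fun_prop)]
    refine integral_congr_ae (.of_forall fun z => ?_)
    simp only [EuclideanSpace.inner_eq_star_dotProduct, star_trivial, Function.comp_apply]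
    rw [Matrix.mulVec_transpose, Matrix.dotProduct_mulVec]
  rw [h1, stdG, charFun_pi]
  simp_rw [charFun_gaussianReal, ← Complex.exp_sum]
  congr 1
  have h2 : t.ofLp ⬝ᵥ (B * Bᵀ) *ᵥ t.ofLp = ∑ k, (Bᵀ *ᵥ t.ofLp) k ^ 2 := by
    rw [← Matrix.mulVec_mulVec, Matrix.dotProduct_mulVec, ← Matrix.mulVec_transpose]
    simp [dotProduct, sq]
  rw [h2]
  push_cast
  rw [neg_div, Finset.sum_div, ← Finset.sum_neg_distrib]
  exact Finset.sum_congr rfl fun k _ => by simp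

/-- The characteristic function involves B only through the covariance B Bᵀ. This lets one square
root of a covariance be exchanged for another. -/
lemma map_mulVec_stdG_eq {B : Matrix ι κ ℝ} {B' : Matrix ι κ' ℝ} (h : B * Bᵀ = B' * B'ᵀ) :
    (stdG κ).map B.mulVec = (stdG κ').map B'.mulVec := by
  have : IsProbabilityMeasure ((stdG κ).map B.mulVec) :=
    Measure.isProbabilityMeasure_map (by fun_prop)
  have : IsProbabilityMeasure ((stdG κ').map B'.mulVec) :=
    Measure.isProbabilityMeasure_map (by fun_prop)
  refine (MeasurableEquiv.toLp 2 (ι → ℝ)).map_measurableEquiv_injective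
      <| Measure.ext_of_charFun (E := EuclideanSpace ℝ ι) <| funext fun t => ?_
  rw [MeasurableEquiv.coe_toLp, charFun_map_mulVec_stdG, charFun_map_mulVec_stdG, h]

lemma integral_mulVec_stdG_eq {B : Matrix ι κ ℝ} {B' : Matrix ι κ' ℝ} (h : B * Bᵀ = B' * B'ᵀ)
    {f : (ι → ℝ) → ℝ} (hf : Measurable f) :
    ∫ z, f (B *ᵥ z) ∂stdG κ = ∫ z, f (B' *ᵥ z) ∂stdG κ' := by
  have h1 := congrArg (fun μ => ∫ y, f y ∂μ) (map_mulVec_stdG_eq h)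
  rwa [integral_map (by fun_prop) hf.aestronglyMeasurable,
    integral_map (by fun_prop) hf.aestronglyMeasurable] at h1

lemma stdG_eq_withDensity [DecidableEq κ] :
    stdG κ = volume.withDensity fun z => ENNReal.ofReal (gaussDensity (1 : Matrix κ κ ℝ) z) := by
  have hd : ∀ z : κ → ℝ, ENNReal.ofReal (gaussDensity (1 : Matrix κ κ ℝ) z) =
      ∏ k, gaussianPDF 0 1 (z k) := by
    intro z
    simp_rw [gaussianPDF, gaussDensity]
    rw [← ENNReal.ofReal_prod_of_nonneg fun i _ => gaussianPDFReal_nonneg _ _ _]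
    congr 1
    simp_rw [gaussianPDFReal, Finset.prod_mul_distrib, ← Real.exp_sum]
    congr 1
    · have hs : √((2 * Real.pi) ^ Fintype.card κ) = √(2 * Real.pi) ^ Fintype.card κ := by
        rw [← Real.sqrt_sq (by positivity : 0 ≤ √(2 * Real.pi) ^ Fintype.card κ), ← pow_mul,
          mul_comm _ 2, pow_mul, Real.sq_sqrt (by positivity)]
      rw [Matrix.det_one, mul_one, hs, Finset.prod_const, Finset.card_univ, inv_pow,
        NNReal.coe_one, mul_one]
    · congr 1
      simp only [dotProduct, inv_one, Matrix.one_mulVec, Finset.mul_sum]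
      exact Finset.sum_congr rfl fun i _ => by simp; ring
  simp_rw [hd]
  refine Measure.pi_eq fun s hs => ?_
  rw [withDensity_apply _ (MeasurableSet.univ_pi hs)]
  have h1 : ∀ i, gaussianReal 0 1 (s i) = ∫⁻ x in s i, gaussianPDF 0 1 x := fun i => by
    rw [gaussianReal_apply _ (by simp)]
  simp_rw [h1]
  rw [volume_pi, Measure.restrict_pi_pi]
  have hint : ∀ i, Integrable (fun x => gaussianPDFReal 0 1 x) (volume.restrict (s i)) :=
    fun i => (integrable_gaussianPDFReal 0 1).integrableOn
  have hpi : Integrable (fun z : κ → ℝ => ∏ i, gaussianPDFReal 0 1 (z i))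
      (Measure.pi fun i => volume.restrict (s i)) :=
    Integrable.fintype_prod (f := fun _ x => gaussianPDFReal 0 1 x) hint
  simp_rw [gaussianPDF, ← ENNReal.ofReal_prod_of_nonneg (fun i _ => gaussianPDFReal_nonneg 0 1 _)]
  rw [← ofReal_integral_eq_lintegral_ofReal hpi
    (.of_forall fun z => Finset.prod_nonneg fun i _ => gaussianPDFReal_nonneg _ _ _)]
  simp_rw [← ofReal_integral_eq_lintegral_ofReal (hint _)
    (.of_forall fun z => gaussianPDFReal_nonneg _ _ _)]
  rw [integral_fintype_prod_eq_prod (f := fun _ x => gaussianPDFReal 0 1 x),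
    ENNReal.ofReal_prod_of_nonneg fun i _ => integral_nonneg fun _ => gaussianPDFReal_nonneg _ _ _]

lemma gaussDensity_mul_transpose [DecidableEq ι] (B : Matrix ι ι ℝ) (hB : B.det ≠ 0) (z : ι → ℝ) :
    gaussDensity (B * Bᵀ) (B *ᵥ z) = |B.det|⁻¹ * gaussDensity 1 z := by
  have hu : IsUnit B.det := hB.isUnit
  have hut : IsUnit Bᵀ.det := by simpa using hu
  unfold gaussDensity
  have h1 : (B *ᵥ z) ⬝ᵥ ((B * Bᵀ)⁻¹ *ᵥ (B *ᵥ z)) = z ⬝ᵥ ((1 : Matrix ι ι ℝ)⁻¹ *ᵥ z) := by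
    rw [Matrix.mul_inv_rev, Matrix.mulVec_mulVec, Matrix.mul_assoc, Matrix.nonsing_inv_mul _ hu,
      Matrix.mul_one, Matrix.dotProduct_mulVec, ← Matrix.mulVec_transpose, Matrix.mulVec_mulVec,
      Matrix.transpose_nonsing_inv, Matrix.transpose_transpose, Matrix.nonsing_inv_mul _ hu]
    simp
  rw [h1, Matrix.det_mul, Matrix.det_transpose, Matrix.det_one, mul_one,
    Real.sqrt_mul (by positivity), Real.sqrt_mul_self_eq_abs, mul_inv]
  ring

/-- Change of variables y = B z. The invertible map is a measurable embedding, so f may be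
arbitrary. The right-hand side still makes sense for singular B, which the limit t → 0 requires. -/
lemma integral_mul_gaussDensity [DecidableEq ι] (B : Matrix ι ι ℝ) (hB : B.det ≠ 0)
    (f : (ι → ℝ) → ℝ) :
    ∫ y, f y * gaussDensity (B * Bᵀ) y = ∫ z, f (B *ᵥ z) ∂stdG ι := by
  have hnn : ∀ z : ι → ℝ, 0 ≤ gaussDensity (1 : Matrix ι ι ℝ) z := fun z => by
    unfold gaussDensity; positivity
  have hm : Measurable fun z : ι → ℝ => gaussDensity (1 : Matrix ι ι ℝ) z := by
    unfold gaussDensity; fun_prop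
  rw [stdG_eq_withDensity, integral_withDensity_eq_integral_toReal_smul (by fun_prop)
    (.of_forall fun _ => ENNReal.ofReal_lt_top)]
  have h1 := congrArg (fun μ => ∫ y, f y * gaussDensity (B * Bᵀ) y ∂μ)
    (Real.map_matrix_volume_pi_eq_smul_volume_pi hB)
  have hinj : MeasurableEmbedding (Matrix.toLin' B) := by
    have : Function.Injective (Matrix.toLin' B) :=
      LinearMap.ker_eq_bot.1 (by
        rw [LinearMap.ker_eq_bot]
        exact Matrix.mulVec_injective_of_isUnit ((Matrix.isUnit_iff_isUnit_det _).2 hB.isUnit))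
    exact (LinearMap.isClosedEmbedding_of_injective (LinearMap.ker_eq_bot.2 this)).measurableEmbedding
  simp only [hinj.integral_map, integral_smul_measure, Matrix.toLin'_apply,
    gaussDensity_mul_transpose B hB] at h1
  rw [ENNReal.toReal_ofReal (abs_nonneg _), smul_eq_mul] at h1
  have hd : |B.det| ≠ 0 := abs_ne_zero.2 hB
  have h2 : ∫ y, f y * gaussDensity (B * Bᵀ) y =
      |B.det| * ∫ z, f (B *ᵥ z) * (|B.det|⁻¹ * gaussDensity 1 z) := by
    rw [h1, abs_inv, mul_inv_cancel_left₀ hd]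
  rw [h2, ← integral_const_mul]
  refine integral_congr_ae (.of_forall fun z => ?_)
  simp only [ENNReal.toReal_ofReal (hnn z), smul_eq_mul]
  field_simp

lemma norm_mulVec_le {B : Matrix ι κ ℝ} {R : ℝ} (hB : ∀ i k, |B i k| ≤ R) (z : κ → ℝ) :
    ‖B *ᵥ z‖ ≤ (Fintype.card κ * max R 0) * ‖z‖ := by
  refine (pi_norm_le_iff_of_nonneg (by positivity)).2 fun i => ?_
  calc ‖(B *ᵥ z) i‖ ≤ ∑ k, ‖B i k * z k‖ := norm_sum_le _ _
    _ ≤ ∑ _k : κ, max R 0 * ‖z‖ := by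
        refine Finset.sum_le_sum fun k _ => ?_
        rw [norm_mul]
        gcongr
        · exact (hB i k).trans (le_max_left _ _)
        · exact norm_le_pi_norm z k
    _ = _ := by simp; ring

lemma integrable_pow_norm_stdG (m : ℕ) : Integrable (fun z : κ → ℝ => (1 + ‖z‖) ^ m) (stdG κ) := by
  have h1 : MemLp (fun z : κ → ℝ => 1 + ‖z‖) (m : ENNReal) (stdG κ) := by
    have h0 : MemLp (fun z : κ → ℝ => ‖z‖) (m : ENNReal) (stdG κ) :=
      (IsGaussian.memLp_id (stdG κ) (m : ENNReal) (ENNReal.natCast_ne_top m)).norm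
    exact MemLp.add (f := fun _ => (1 : ℝ)) (memLp_const 1) h0
  have := h1.integrable_norm_pow'
  refine this.congr (.of_forall fun z => ?_)
  simp only [Real.norm_eq_abs]
  rw [abs_of_nonneg (by positivity)]

lemma integrable_mulVec_stdG {f : (ι → ℝ) → ℝ} (hf : Measurable f) {C : ℝ} {m : ℕ}
    (hb : ∀ y, |f y| ≤ C * (1 + ‖y‖) ^ m) (B : Matrix ι κ ℝ) :
    Integrable (fun z => f (B *ᵥ z)) (stdG κ) := by
  have hC : 0 ≤ C := by
    have h0 := (abs_nonneg _).trans (hb 0)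
    simpa using h0
  set R := ∑ i, ∑ k, |B i k|
  have hR : ∀ i k, |B i k| ≤ R := fun i k =>
    (Finset.single_le_sum (f := fun k => |B i k|) (fun _ _ => abs_nonneg _) (Finset.mem_univ k)).trans
      (Finset.single_le_sum (f := fun i => ∑ k, |B i k|)
        (fun _ _ => Finset.sum_nonneg fun _ _ => abs_nonneg _) (Finset.mem_univ i))
  set T := Fintype.card κ * max R 0
  have hT : 0 ≤ T := by positivity
  refine ((integrable_pow_norm_stdG (κ := κ) m).const_mul (C * (1 + T) ^ m)).mono'
    (hf.comp (by fun_prop)).aestronglyMeasurable (.of_forall fun z => ?_)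
  refine (hb _).trans ?_
  rw [mul_assoc, ← mul_pow]
  gcongr
  have := norm_mulVec_le hR z
  nlinarith [norm_nonneg z]

/-- Dominated convergence: the matrices are eventually bounded entrywise, and the standard Gaussian
measure has all moments. -/
lemma tendsto_integral_mulVec_of_tendsto {B : ℕ → Matrix ι κ ℝ} {B₀ : Matrix ι κ ℝ}
    (hB : Tendsto B atTop (𝓝 B₀)) {f : (ι → ℝ) → ℝ} (hf : Measurable f) {C : ℝ} {m : ℕ}
    (hb : ∀ y, |f y| ≤ C * (1 + ‖y‖) ^ m) (hc : ∀ᵐ z ∂stdG κ, ContinuousAt f (B₀ *ᵥ z)) :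
    Tendsto (fun a => ∫ z, f (B a *ᵥ z) ∂stdG κ) atTop (𝓝 (∫ z, f (B₀ *ᵥ z) ∂stdG κ)) := by
  have hC : 0 ≤ C := by
    have h0 := (abs_nonneg _).trans (hb 0)
    simpa using h0
  set R := ∑ i, ∑ k, (|B₀ i k| + 1)
  have hR : ∀ i k, |B₀ i k| + 1 ≤ R := fun i k =>
    (Finset.single_le_sum (f := fun k => |B₀ i k| + 1) (fun _ _ => by positivity)
      (Finset.mem_univ k)).trans
      (Finset.single_le_sum (f := fun i => ∑ k, (|B₀ i k| + 1))
        (fun _ _ => Finset.sum_nonneg fun _ _ => by positivity) (Finset.mem_univ i))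
  have hev : ∀ᶠ a in atTop, ∀ i k, |B a i k| ≤ R := by
    refine eventually_all.2 fun i => eventually_all.2 fun k => ?_
    have h1 : Tendsto (fun a => |B a i k|) atTop (𝓝 |B₀ i k|) :=
      ((((continuous_id.matrix_elem i k : Continuous fun M : Matrix ι κ ℝ => M i k)).tendsto
        B₀).comp hB).abs
    filter_upwards [h1.eventually_le_const (lt_add_one _)] with a ha using ha.trans (hR i k)
  set T := Fintype.card κ * max R 0
  have hT : 0 ≤ T := by positivity
  refine tendsto_integral_filter_of_dominated_convergence
    (fun z => C * (1 + T) ^ m * (1 + ‖z‖) ^ m)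
    (.of_forall fun a => (hf.comp (by fun_prop)).aestronglyMeasurable) ?_
    ((integrable_pow_norm_stdG (κ := κ) m).const_mul _) ?_
  · filter_upwards [hev] with a ha
    refine .of_forall fun z => (hb _).trans ?_
    rw [mul_assoc, ← mul_pow]
    gcongr
    have := norm_mulVec_le ha z
    nlinarith [norm_nonneg z]
  · filter_upwards [hc] with z hz
    have h2 : Tendsto (fun a => B a *ᵥ z) atTop (𝓝 (B₀ *ᵥ z)) := by
      have h3 : Continuous fun M : Matrix ι κ ℝ => M *ᵥ z := by fun_prop
      exact (h3.tendsto B₀).comp hB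
    exact hz.tendsto.comp h2

lemma ae_iff_of_mul_transpose_eq {B : Matrix ι κ ℝ} {B' : Matrix ι κ' ℝ} (h : B * Bᵀ = B' * B'ᵀ)
    {p : (ι → ℝ) → Prop} (hp : MeasurableSet {y | p y}) :
    (∀ᵐ z ∂stdG κ, p (B *ᵥ z)) ↔ ∀ᵐ z ∂stdG κ', p (B' *ᵥ z) := by
  rw [← ae_map_iff (f := B.mulVec) (by fun_prop) hp, map_mulVec_stdG_eq h,
    ae_map_iff (by fun_prop) hp]

/-- Gaussian integrals depend continuously on the covariance matrix. -/
lemma tendsto_integral_mulVec_of_tendsto_mul_transpose {α : Type*} {l : Filter α}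
    [l.IsCountablyGenerated] {B : α → Matrix ι κ ℝ} {B₀ : Matrix ι κ ℝ}
    (hB : Tendsto (fun a => B a * (B a)ᵀ) l (𝓝 (B₀ * B₀ᵀ))) {f : (ι → ℝ) → ℝ} (hf : Measurable f)
    {C : ℝ} {m : ℕ} (hb : ∀ y, |f y| ≤ C * (1 + ‖y‖) ^ m) {p : (ι → ℝ) → Prop}
    (hp : MeasurableSet {y | p y}) (hpf : ∀ y, p y → ContinuousAt f y)
    (hc : ∀ᵐ z ∂stdG κ, p (B₀ *ᵥ z)) :
    Tendsto (fun a => ∫ z, f (B a *ᵥ z) ∂stdG κ) l (𝓝 (∫ z, f (B₀ *ᵥ z) ∂stdG κ)) := by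
  refine tendsto_of_subseq_tendsto fun ns hns => ?_
  have hV := hB.comp hns
  -- The factors B need not converge, but a diagonal entry of B Bᵀ is the squared length of a row of
  -- B, so they stay in a compact set.
  have hdiag : ∀ i, ∃ R : ℝ, ∀ n k, |B (ns n) i k| ≤ R := by
    intro i
    have h1 : Tendsto (fun n => (B (ns n) * (B (ns n))ᵀ) i i) atTop (𝓝 ((B₀ * B₀ᵀ) i i)) :=
      ((continuous_id.matrix_elem i i : Continuous fun M : Matrix ι ι ℝ => M i i).tendsto
        (B₀ * B₀ᵀ)).comp hV
    obtain ⟨R, hR⟩ := h1.bddAbove_range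
    refine ⟨√R, fun n k => Real.abs_le_sqrt ?_⟩
    refine le_trans ?_ (hR ⟨n, rfl⟩)
    simp only [Matrix.mul_apply, Matrix.transpose_apply, ← sq]
    exact Finset.single_le_sum (f := fun k => B (ns n) i k ^ 2) (fun _ _ => sq_nonneg _)
      (Finset.mem_univ k)
  choose R hR using hdiag
  have hK : IsCompact (Set.univ.pi fun i : ι => Set.univ.pi fun _ : κ => Set.Icc (-R i) (R i)) :=
    isCompact_univ_pi fun i => isCompact_univ_pi fun _ => isCompact_Icc
  obtain ⟨B', -, φ, hφ, hlim⟩ := hK.tendsto_subseq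
    (x := fun n => (show ι → κ → ℝ from B (ns n)))
    (fun n i _ k _ => abs_le.1 (hR i n k))
  change Matrix ι κ ℝ at B'
  -- The subsequential limit may differ from `B₀`, but it has the same covariance and hence the same
  -- Gaussian integrals and null sets.
  have hBB : B₀ * B₀ᵀ = B' * B'ᵀ := by
    have h3 : Continuous fun M : Matrix ι κ ℝ => M * Mᵀ := by fun_prop
    exact tendsto_nhds_unique (hV.comp hφ.tendsto_atTop) ((h3.tendsto B').comp hlim)
  refine ⟨φ, ?_⟩
  rw [integral_mulVec_stdG_eq hBB hf]
  refine tendsto_integral_mulVec_of_tendsto hlim hf hb ?_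
  exact ((ae_iff_of_mul_transpose_eq hBB hp).1 hc).mono fun z hz => hpf _ hz

end Gaussian

/-! ### Covariance, independence and positivity of linear forms under the standard Gaussian measure.
-/

section Gaussian

variable {ι κ : Type*} [Fintype κ]

lemma memLp_dotProduct_stdG (a : κ → ℝ) : MemLp (fun z => a ⬝ᵥ z) 2 (stdG κ) := by
  have := (IsGaussian.hasGaussianLaw_id (μ := stdG κ)).map_fun
    (LinearMap.toContinuousLinearMap (dotProductBilin ℝ ℝ a))
  exact this.memLp_two

lemma covariance_coord_stdG [DecidableEq κ] (i j : κ) :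
    cov[fun z => z i, fun z => z j; stdG κ] = if i = j then 1 else 0 := by
  split_ifs with h
  · subst h
    rw [covariance_self (measurable_pi_apply i).aemeasurable]
    have h1 := variance_sum_pi (ι := κ) (μ := fun _ => gaussianReal 0 1)
      (X := fun k (x : ℝ) => if k = i then x else 0) (fun k => by
        by_cases hk : k = i
        · simp only [hk, if_true]
          exact IsGaussian.memLp_two_id
        · simp [hk])
    have h2 : (∑ k, fun ω : κ → ℝ => if k = i then ω k else 0) = fun ω => ω i := by
      ext ω; simp
    rw [h2] at h1
    rw [stdG, h1, Finset.sum_eq_single i]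
    · simp
    · intro b _ hb
      simp only [hb, if_false]
      exact variance_zero _
    · simp
  · have h1 := (iIndepFun_pi (μ := fun _ : κ => gaussianReal 0 1) (X := fun _ (x : ℝ) => x)
      (fun _ => by fun_prop)).indepFun h
    exact h1.covariance_eq_zero
      (by simpa [stdG] using memLp_dotProduct_stdG (Pi.single i (1 : ℝ)))
      (by simpa [stdG] using memLp_dotProduct_stdG (Pi.single j (1 : ℝ)))

lemma covariance_dotProduct_stdG (a b : κ → ℝ) :
    cov[fun z => a ⬝ᵥ z, fun z => b ⬝ᵥ z; stdG κ] = a ⬝ᵥ b := by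
  classical
  have hm : ∀ (c : κ → ℝ) (i : κ), MemLp (fun z => c i * z i) 2 (stdG κ) := fun c i => by
    simpa using (memLp_dotProduct_stdG (Pi.single i (1 : ℝ))).const_mul (c i)
  simp only [dotProduct]
  rw [covariance_fun_sum_fun_sum (hm a) (hm b)]
  refine Finset.sum_congr rfl fun i _ => ?_
  simp_rw [covariance_const_mul_left, covariance_const_mul_right, covariance_coord_stdG]
  simp

instance : (stdG κ).IsOpenPosMeasure := by
  have : (gaussianReal 0 1).IsOpenPosMeasure :=
    (gaussianReal_absolutelyContinuous' 0 one_ne_zero).isOpenPosMeasure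
  unfold stdG
  infer_instance

/-- Jointly Gaussian and uncorrelated implies independent; the single form is viewed as a
`Unit`-indexed family to fit the vector statement. -/
lemma indepFun_dotProduct_stdG {τ : Type*} [Finite τ] (A : τ → κ → ℝ) (b : κ → ℝ)
    (h : ∀ i, A i ⬝ᵥ b = 0) :
    IndepFun (fun z i => A i ⬝ᵥ z) (fun z => b ⬝ᵥ z) (stdG κ) := by
  have := Fintype.ofFinite τ
  have hL : HasGaussianLaw (fun z : κ → ℝ => ((fun i => A i ⬝ᵥ z), fun _ : Unit => b ⬝ᵥ z))
      (stdG κ) := by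
    have := (IsGaussian.hasGaussianLaw_id (μ := stdG κ)).map_fun
      (LinearMap.toContinuousLinearMap
        ((LinearMap.pi fun i => dotProductBilin ℝ ℝ (A i)).prod
          (LinearMap.pi fun _ : Unit => dotProductBilin ℝ ℝ b)))
    exact this
  have h1 := hL.indepFun_of_covariance_eval (X := fun i z => A i ⬝ᵥ z) (Y := fun _ z => b ⬝ᵥ z)
    (fun i _ => by rw [covariance_dotProduct_stdG, h])
  exact h1.comp (φ := id) (ψ := fun f : Unit → ℝ => f ()) measurable_id (by fun_prop)

lemma measureReal_dotProduct_gt_pos {b : κ → ℝ} (h : b ⬝ᵥ b ≠ 0) (u : ℝ) :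
    0 < (stdG κ).real {z | u < b ⬝ᵥ z} := by
  refine ENNReal.toReal_pos (IsOpen.measure_pos _ ?_ ?_).ne' (measure_ne_top _ _)
  · exact isOpen_lt continuous_const (by fun_prop)
  -- A multiple of b at which the form takes the value u + 1.
  · refine ⟨((u + 1) / (b ⬝ᵥ b)) • b, ?_⟩
    simp [dotProduct_smul, h]

lemma ae_dotProduct_ne {b : κ → ℝ} (h : b ⬝ᵥ b ≠ 0) (u : ℝ) :
    ∀ᵐ z ∂stdG κ, b ⬝ᵥ z ≠ u := by
  have hL : HasGaussianLaw (fun z : κ → ℝ => b ⬝ᵥ z) (stdG κ) :=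
    (IsGaussian.hasGaussianLaw_id (μ := stdG κ)).map_fun
      (LinearMap.toContinuousLinearMap (dotProductBilin ℝ ℝ b))
  have h1 := hL.map_eq_gaussianReal
  have hv : Var[fun z : κ → ℝ => b ⬝ᵥ z; stdG κ] = b ⬝ᵥ b := by
    rw [← covariance_self (by fun_prop), covariance_dotProduct_stdG]
  have hb : 0 ≤ b ⬝ᵥ b := by
    simpa using dotProduct_star_self_nonneg b
  have hne : Var[fun z : κ → ℝ => b ⬝ᵥ z; stdG κ].toNNReal ≠ 0 := by
    rw [hv]
    exact (Real.toNNReal_pos.2 (lt_of_le_of_ne hb h.symm)).ne'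
  have h2 : (stdG κ).map (fun z => b ⬝ᵥ z) {u} = 0 := by
    rw [h1]
    exact gaussianReal_absolutelyContinuous _ hne (by simp)
  rw [Measure.map_apply (by fun_prop) (measurableSet_singleton u)] at h2
  exact measure_eq_zero_iff_ae_notMem.1 h2

end Gaussian

/-! ### Symmetric matrices whose row `o` is diagonal, and the sign change of the entry (o, o). -/

section BlockMatrix

variable {n : Type*} [Fintype n]

lemma dotProduct_self_pos {w : n → ℝ} (hw : w ≠ 0) : 0 < w ⬝ᵥ w :=
  lt_of_le_of_ne (by simpa using dotProduct_star_self_nonneg w)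
    fun h => hw (dotProduct_self_eq_zero.1 h.symm)

lemma mulVec_apply_of_block {M : Matrix n n ℝ} {o : n} (h : ∀ b, b ≠ o → M o b = 0) (w : n → ℝ) :
    (M *ᵥ w) o = M o o * w o := by
  simp only [Matrix.mulVec, dotProduct]
  exact Finset.sum_eq_single o (fun b _ hb => by simp [h b hb]) (by simp)

variable [DecidableEq n]

/-- The matrix of the reflection in the hyperplane orthogonal to the `o`-th basis vector. -/
def reflMat (o : n) : Matrix n n ℝ := Matrix.diagonal fun i => if i = o then -1 else 1

lemma det_reflMat (o : n) : (reflMat o).det = -1 := by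
  simp [reflMat, Finset.prod_ite_eq']

lemma reflMat_mul_apply (o : n) (M : Matrix n n ℝ) (i j : n) :
    (reflMat o * M) i j = if i = o then -M i j else M i j := by
  simp only [reflMat, Matrix.diagonal_mul]
  split_ifs <;> simp

lemma reflMat_mul_mulVec_dotProduct (o : n) (M : Matrix n n ℝ) (w : n → ℝ) :
    w ⬝ᵥ (reflMat o * M) *ᵥ w = w ⬝ᵥ M *ᵥ w - 2 * (w o * (M *ᵥ w) o) := by
  rw [← Matrix.mulVec_mulVec]
  simp only [reflMat, dotProduct, Matrix.mulVec_diagonal]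
  rw [← Finset.add_sum_erase _ _ (Finset.mem_univ o),
    ← Finset.add_sum_erase _ (fun i => w i * (M *ᵥ w) i) (Finset.mem_univ o)]
  have : ∀ i ∈ Finset.univ.erase o, w i * ((if i = o then -1 else 1) * (M *ᵥ w) i) =
      w i * (M *ᵥ w) i := fun i hi => by simp [Finset.ne_of_mem_erase hi]
  rw [Finset.sum_congr rfl this]
  simp
  ring

lemma finrank_coord_eq_zero (o : n) :
    Module.finrank ℝ (LinearMap.ker (LinearMap.proj o : (n → ℝ) →ₗ[ℝ] ℝ)) + 1 =
      Fintype.card n := by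
  have h := LinearMap.finrank_range_add_finrank_ker (LinearMap.proj o : (n → ℝ) →ₗ[ℝ] ℝ)
  have hr : LinearMap.range (LinearMap.proj o : (n → ℝ) →ₗ[ℝ] ℝ) = ⊤ :=
    LinearMap.range_eq_top.2 fun c => ⟨Pi.single o c, by simp⟩
  rw [hr] at h
  simp only [finrank_top, Module.finrank_self, Module.finrank_fintype_fun_eq_card] at h
  omega

lemma negInertia_lt_of_diag_pos {M : Matrix n n ℝ} {o : n} (h : 0 < M o o) :
    negInertia M + 1 ≤ Fintype.card n := by
  have h1 : 1 ≤ sigPos M.toQuadraticForm' := by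
    have hs : (Pi.single o 1 : n → ℝ) ≠ 0 := by simp
    rw [← finrank_span_singleton (K := ℝ) hs]
    refine le_sigPos_of_posDef _ fun w hw => ?_
    obtain ⟨c, hc⟩ := Submodule.mem_span_singleton.1 w.2
    have hc0 : c ≠ 0 := by
      rintro rfl
      apply hw
      ext1
      rw [← hc]; simp
    rw [QuadraticMap.restrict_apply, toQuadraticForm'_apply_eq, ← hc]
    simp only [Matrix.mulVec_smul, dotProduct_smul, smul_dotProduct, Matrix.mulVec_single,
      single_dotProduct, smul_eq_mul]
    simp
    rw [← mul_assoc]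
    exact mul_pos (mul_self_pos.2 hc0) h
  have h4 := QuadraticForm.sigPos_add_sigNeg_add_radical (Q := M.toQuadraticForm')
  simp only [Module.finrank_fintype_fun_eq_card] at h4
  rw [negInertia]
  omega

lemma abs_det_reflMat_mul (o : n) (M : Matrix n n ℝ) : |(reflMat o * M).det| = |M.det| := by
  rw [Matrix.det_mul, det_reflMat]
  simp

lemma isHermitian_reflMat_mul {M : Matrix n n ℝ} (hM : M.IsHermitian) {o : n}
    (h : ∀ b, b ≠ o → M o b = 0) : (reflMat o * M).IsHermitian := by
  ext i j
  have hs : ∀ i j, M j i = M i j := fun i j => by simpa using hM.apply i j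
  simp only [Matrix.conjTranspose_apply, star_trivial, reflMat_mul_apply]
  by_cases hi : i = o <;> by_cases hj : j = o
  · simp [hi, hj]
  · subst hi
    simp [hj, hs, h j hj]
  · subst hj
    have h0 := h i hi
    rw [hs] at h0
    simp [hi, hs, h0]
  · simp [hi, hj, hs]

/-- If the reflected matrix is negative definite, then M is negative on the hyperplane w_o = 0 and
positive at the basis vector `o`, so its index is exactly n - 1; |det| is unchanged by the
reflection. -/
lemma idxDet_reflMat_mul_le {M : Matrix n n ℝ} (hM : M.IsHermitian) {o : n}
    (h : ∀ b, b ≠ o → M o b = 0) :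
    idxDet (Fintype.card n) (reflMat o * M) ≤ idxDet (Fintype.card n - 1) M := by
  by_cases hn : negInertia (reflMat o * M) = Fintype.card n
  · have hpd := posDef_neg_of_negInertia_eq_card (isHermitian_reflMat_mul hM h) hn
    have hneg : ∀ w : n → ℝ, w ≠ 0 → w ⬝ᵥ (reflMat o * M) *ᵥ w < 0 := fun w hw => by
      have := hpd.dotProduct_mulVec_pos hw
      simpa [Matrix.neg_mulVec] using this
    have hoo : 0 < M o o := by
      have := hpd.diag_pos (i := o)
      simpa [reflMat_mul_apply] using this
    have h1 := negInertia_lt_of_diag_pos hoo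
    have h2 := finrank_le_negInertia (A := M)
      (LinearMap.ker (LinearMap.proj o : (n → ℝ) →ₗ[ℝ] ℝ)) fun w hw hw0 => by
        have hwo : w o = 0 := hw
        have := hneg w hw0
        rw [reflMat_mul_mulVec_dotProduct, hwo] at this
        simpa using this
    have h3 := finrank_coord_eq_zero o
    have h4 : negInertia M = Fintype.card n - 1 := by omega
    rw [idxDet, idxDet, if_pos hn, if_pos h4, abs_det_reflMat_mul]
  · rw [idxDet, if_neg hn]
    exact idxDet_nonneg _ _

lemma dotProduct_mulVec_of_block {M : Matrix n n ℝ} (hM : M.IsHermitian) {o : n}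
    (h : ∀ b, b ≠ o → M o b = 0) (w : n → ℝ) :
    w ⬝ᵥ M *ᵥ w = M o o * w o ^ 2 +
      Function.update w o 0 ⬝ᵥ M *ᵥ Function.update w o 0 := by
  have hw : w = Function.update w o 0 + Pi.single o (w o) := by
    ext i
    by_cases hi : i = o
    · subst hi; simp
    · simp [hi]
  set v := Function.update w o 0 with hv
  have hvo : v o = 0 := by simp [hv]
  have h2 : ∀ v : n → ℝ, v ⬝ᵥ M *ᵥ Pi.single o (w o) = w o * (M *ᵥ v) o := by
    intro v
    rw [Matrix.dotProduct_mulVec, ← Matrix.mulVec_transpose,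
      show Mᵀ = M by simpa using hM.eq, dotProduct_single, mul_comm]
  conv_lhs => rw [hw]
  rw [Matrix.mulVec_add, dotProduct_add, add_dotProduct, add_dotProduct, h2, h2,
    single_dotProduct, mulVec_apply_of_block h, mulVec_apply_of_block h, hvo]
  simp
  ring

/-- Partial converse, valid when the complementary block is negative definite. By the sign of M_oo,
either M has index n, or M is singular, or the reflected matrix is negative definite. -/
lemma idxDet_le_of_block {M : Matrix n n ℝ} (hM : M.IsHermitian) {o : n}
    (h : ∀ b, b ≠ o → M o b = 0)
    (hneg : ∀ w : n → ℝ, w o = 0 → w ≠ 0 → w ⬝ᵥ M *ᵥ w < 0) :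
    idxDet (Fintype.card n - 1) M ≤ idxDet (Fintype.card n) (reflMat o * M) := by
  -- Keeps the truncated difference `card n - 1` distinct from `card n`.
  have hcard : 0 < Fintype.card n := Fintype.card_pos_iff.2 ⟨o⟩
  have key : ∀ A : Matrix n n ℝ, A.IsHermitian → (∀ b, b ≠ o → A o b = 0) → A o o < 0 →
      (∀ w : n → ℝ, w o = 0 → w ≠ 0 → w ⬝ᵥ A *ᵥ w < 0) → negInertia A = Fintype.card n := by
    intro A hA hAo hoo hAn
    refine negInertia_eq_card_of_posDef_neg
      (Matrix.PosDef.of_dotProduct_mulVec_pos hA.neg fun w hw => ?_)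
    have : w ⬝ᵥ A *ᵥ w < 0 := by
      rw [dotProduct_mulVec_of_block hA hAo]
      by_cases hu : Function.update w o 0 = 0
      · have hwo : w o ≠ 0 := by
          intro h0
          apply hw
          rw [← hu, ← h0, Function.update_eq_self]
        rw [hu]
        have : 0 < w o ^ 2 := by positivity
        simp
        nlinarith
      · have := hAn (Function.update w o 0) (by simp) hu
        nlinarith [sq_nonneg (w o)]
    simpa [Matrix.neg_mulVec] using this
  rcases lt_trichotomy (M o o) 0 with hlt | heq | hgt
  · have := key M hM h hlt hneg
    rw [idxDet, if_neg (by omega)]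
    exact idxDet_nonneg _ _
  · have hdet : M.det = 0 := by
      apply Matrix.det_eq_zero_of_row_eq_zero o
      intro j
      by_cases hj : j = o
      · rw [hj, heq]
      · exact h j hj
    refine (idxDet_le _ _).trans ?_
    rw [hdet, abs_zero]
    exact idxDet_nonneg _ _
  · have := key (reflMat o * M) (isHermitian_reflMat_mul hM h)
      (fun b hb => by simp [reflMat_mul_apply, h b hb]) (by simpa [reflMat_mul_apply] using hgt)
      (fun w hwo hw => by
        rw [reflMat_mul_mulVec_dotProduct, hwo]
        simpa using hneg w hwo hw)
    refine (idxDet_le _ _).trans ?_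
    rw [idxDet, if_pos this, abs_det_reflMat_mul]

omit [DecidableEq n] in
lemma abs_dotProduct_mulVec_le (M : Matrix n n ℝ) (w : n → ℝ) :
    |w ⬝ᵥ M *ᵥ w| ≤ (∑ i, ∑ j, |M i j|) * (w ⬝ᵥ w) := by
  have hsq : ∀ i, w i ^ 2 ≤ w ⬝ᵥ w := fun i => by
    simp only [dotProduct, ← sq]
    exact Finset.single_le_sum (f := fun i => w i ^ 2) (fun _ _ => sq_nonneg _) (Finset.mem_univ i)
  generalize w ⬝ᵥ w = T at hsq ⊢
  simp only [dotProduct, Matrix.mulVec, Finset.mul_sum, Finset.sum_mul]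
  refine (Finset.abs_sum_le_sum_abs _ _).trans (Finset.sum_le_sum fun i _ => ?_)
  refine (Finset.abs_sum_le_sum_abs _ _).trans (Finset.sum_le_sum fun j _ => ?_)
  rw [show w i * (M i j * w j) = M i j * (w i * w j) by ring, abs_mul]
  gcongr
  have h1 := hsq i
  have h2 := hsq j
  rw [abs_le]
  constructor <;> nlinarith [sq_nonneg (w i + w j), sq_nonneg (w i - w j)]

/-- The identity matrix with its `o`-th diagonal entry replaced by `0`. -/
def offMat (o : n) : Matrix n n ℝ := Matrix.diagonal fun i => if i = o then 0 else 1

lemma dotProduct_offMat_mulVec (o : n) (w : n → ℝ) :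
    w ⬝ᵥ offMat o *ᵥ w = w ⬝ᵥ w - w o ^ 2 := by
  rw [eq_sub_iff_add_eq]
  simp only [offMat, dotProduct, Matrix.mulVec_diagonal]
  rw [← Finset.add_sum_erase _ _ (Finset.mem_univ o),
    ← Finset.add_sum_erase _ (fun i => w i * w i) (Finset.mem_univ o)]
  have : ∀ i ∈ Finset.univ.erase o, w i * ((if i = o then 0 else 1) * w i) =
      w i * w i := fun i hi => by simp [Finset.ne_of_mem_erase hi]
  rw [Finset.sum_congr rfl this]
  simp
  ring

/-- With S the sum of the |M'_ij|, a shift x > S makes the complementary block negative definite. If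
x ≤ S, all entries of M are at most 2S in absolute value and the Leibniz formula bounds the
determinant, so the error no longer involves x except through the condition x ≤ S. -/
lemma idxDet_le_add_of_block {M : Matrix n n ℝ} (hM : M.IsHermitian) {o : n}
    (h : ∀ b, b ≠ o → M o b = 0) {M' : Matrix n n ℝ} {x : ℝ} (hx : 0 ≤ x)
    (hMM : M = M' - x • offMat o) :
    idxDet (Fintype.card n - 1) M ≤ idxDet (Fintype.card n) (reflMat o * M) +
      if x ≤ ∑ i, ∑ j, |M' i j| then
        (Fintype.card n).factorial * (2 * ∑ i, ∑ j, |M' i j|) ^ Fintype.card n else 0 := by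
  set S := ∑ i, ∑ j, |M' i j|
  have hS : ∀ i j, |M' i j| ≤ S := fun i j =>
    (Finset.single_le_sum (f := fun j => |M' i j|) (fun _ _ => abs_nonneg _) (Finset.mem_univ j)).trans
      (Finset.single_le_sum (f := fun i => ∑ j, |M' i j|)
        (fun _ _ => Finset.sum_nonneg fun _ _ => abs_nonneg _) (Finset.mem_univ i))
  split_ifs with hle
  · have h1 : ∀ i j, |M i j| ≤ 2 * S := by
      intro i j
      have : |(x • offMat o) i j| ≤ x := by
        simp only [offMat, Matrix.smul_apply, Matrix.diagonal_apply, smul_eq_mul]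
        split_ifs <;> simp [abs_of_nonneg hx, hx]
      rw [hMM, Matrix.sub_apply]
      refine (abs_sub _ _).trans ?_
      linarith [hS i j]
    have h2 := Matrix.det_le (A := M) (abv := AbsoluteValue.abs) h1
    rw [nsmul_eq_mul] at h2
    have h3 : |M.det| ≤ (Fintype.card n).factorial * (2 * S) ^ Fintype.card n := h2
    linarith [idxDet_le (Fintype.card n - 1) M, idxDet_nonneg (Fintype.card n) (reflMat o * M)]
  · rw [add_zero]
    refine idxDet_le_of_block hM h fun w hwo hw => ?_
    have hww : 0 < w ⬝ᵥ w := dotProduct_self_pos hw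
    rw [hMM, Matrix.sub_mulVec, dotProduct_sub, Matrix.smul_mulVec, dotProduct_smul,
      dotProduct_offMat_mulVec, hwo, smul_eq_mul]
    have := (abs_le.1 (abs_dotProduct_mulVec_le M' w)).2
    have : S * (w ⬝ᵥ w) < x * (w ⬝ᵥ w) := by
      gcongr
      exact not_le.1 hle
    simp
    linarith

lemma one_le_det_of_one_le {A : Matrix n n ℝ} (hA : A.IsHermitian)
    (h : ∀ w : n → ℝ, w ⬝ᵥ w ≤ w ⬝ᵥ A *ᵥ w) : 1 ≤ A.det := by
  have h1 : ∀ i, 1 ≤ hA.eigenvalues i := by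
    intro i
    have h2 := h (hA.eigenvectorBasis i).ofLp
    rw [hA.mulVec_eigenvectorBasis, dotProduct_smul] at h2
    have h3 : (hA.eigenvectorBasis i).ofLp ⬝ᵥ (hA.eigenvectorBasis i).ofLp = 1 := by
      have h4 := hA.eigenvectorBasis.orthonormal.1 i
      have h5 : ‖hA.eigenvectorBasis i‖ ^ 2 = 1 := by rw [h4]; norm_num
      rw [EuclideanSpace.real_norm_sq_eq] at h5
      simpa [dotProduct, sq] using h5
    rw [h3] at h2
    simpa using h2
  rw [hA.det_eq_prod_eigenvalues]
  exact Finset.one_le_prod fun i _ => h1 i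

/-- The hypotheses force -M ≥ I: the entry (o, o) contributes at least 1, and on the other block the
shift by x ≥ 2 loses at most 1 to M'. -/
lemma one_le_idxDet_of_block {M : Matrix n n ℝ} (hM : M.IsHermitian) {o : n}
    (h : ∀ b, b ≠ o → M o b = 0) {M' : Matrix n n ℝ} {x : ℝ} (hx : 2 ≤ x)
    (hMM : M = M' - x • offMat o) (hoo : M' o o ≤ -1)
    (hS : (∑ i, ∑ j, |M' i j|) - |M' o o| ≤ 1) : 1 ≤ idxDet (Fintype.card n) M := by
  have hq : ∀ w : n → ℝ, w ⬝ᵥ w ≤ w ⬝ᵥ (-M) *ᵥ w := by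
    intro w
    set v := Function.update w o 0 with hv
    have hvo : v o = 0 := by simp [hv]
    have hvv : w ⬝ᵥ w = v ⬝ᵥ v + w o ^ 2 := by
      have h1 := dotProduct_mulVec_of_block (M := (1 : Matrix n n ℝ)) (by simp) (o := o)
        (fun b hb => by simp [hb.symm]) w
      simp only [Matrix.one_mulVec, Matrix.one_apply_eq, one_mul] at h1
      rw [h1, add_comm]
    have hMo : M o o = M' o o := by
      rw [hMM]
      simp [offMat]
    have hvM : v ⬝ᵥ M *ᵥ v = v ⬝ᵥ M' *ᵥ v - x * (v ⬝ᵥ v) := by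
      rw [hMM, Matrix.sub_mulVec, dotProduct_sub, Matrix.smul_mulVec, dotProduct_smul,
        dotProduct_offMat_mulVec, hvo, smul_eq_mul]
      simp
    have hvM' : v ⬝ᵥ M' *ᵥ v ≤ 1 * (v ⬝ᵥ v) := by
      -- Erasing the entry (o, o), invisible to vectors with v_o = 0, makes the absolute sum of the
      -- entries the quantity bounded by `hS`.
      set M'' := M'.updateRow o (Function.update (M' o) o 0) with hM''
      have hvM2 : v ⬝ᵥ M' *ᵥ v = v ⬝ᵥ M'' *ᵥ v := by
        simp only [dotProduct, Matrix.mulVec]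
        refine Finset.sum_congr rfl fun i _ => ?_
        by_cases hi : i = o
        · simp [hi, hvo]
        · simp [hM'', Matrix.updateRow_ne hi]
      have hsum : ∑ i, ∑ j, |M'' i j| = (∑ i, ∑ j, |M' i j|) - |M' o o| := by
        rw [eq_sub_iff_add_eq, ← Finset.add_sum_erase _ _ (Finset.mem_univ o),
          ← Finset.add_sum_erase _ (fun i => ∑ j, |M' i j|) (Finset.mem_univ o)]
        have e1 : ∀ i ∈ Finset.univ.erase o, ∑ j, |M'' i j| = ∑ j, |M' i j| := fun i hi => by
          simp [hM'', Matrix.updateRow_ne (Finset.ne_of_mem_erase hi)]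
        have e2 : ∑ j, |M'' o j| + |M' o o| = ∑ j, |M' o j| := by
          rw [← Finset.add_sum_erase _ _ (Finset.mem_univ o),
            ← Finset.add_sum_erase _ (fun j => |M' o j|) (Finset.mem_univ o)]
          have e3 : ∀ j ∈ Finset.univ.erase o, |M'' o j| = |M' o j| := fun j hj => by
            simp [hM'', Finset.ne_of_mem_erase hj]
          rw [Finset.sum_congr rfl e3]
          simp [hM'', add_comm]
        rw [Finset.sum_congr rfl e1, ← e2]
        ring
      rw [hvM2]
      refine (le_abs_self _).trans ((abs_dotProduct_mulVec_le _ _).trans ?_)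
      rw [hsum]
      have : 0 ≤ v ⬝ᵥ v := by simpa using dotProduct_star_self_nonneg v
      gcongr
    have hv0 : 0 ≤ v ⬝ᵥ v := by simpa using dotProduct_star_self_nonneg v
    rw [Matrix.neg_mulVec, dotProduct_neg, dotProduct_mulVec_of_block hM h, hMo, ← hv, hvM, hvv]
    nlinarith [sq_nonneg (w o)]
  have hdet := one_le_det_of_one_le hM.neg hq
  have hn : negInertia M = Fintype.card n := by
    refine negInertia_eq_card_of_posDef_neg
      (Matrix.PosDef.of_dotProduct_mulVec_pos hM.neg fun w hw => ?_)
    have hww : 0 < w ⬝ᵥ w := dotProduct_self_pos hw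
    simpa using hww.trans_le (hq w)
  rw [idxDet, if_pos hn]
  rw [Matrix.det_neg] at hdet
  refine hdet.trans ((le_abs_self _).trans ?_)
  rw [abs_mul, abs_pow]
  simp

end BlockMatrix

/-! ### The limit u → ∞ for the degenerate limiting Gaussian law. -/

section Ratio

variable {N : ℕ}

/-- The integrand of the Kac-Rice density, as a function of the values of `(∇²X(t), X(t), X(0))`. -/
def kacRice (k : ℕ) (u : ℝ) (y : UpperIdx N ⊕ Fin 2 → ℝ) : ℝ :=
  if u < y (Sum.inr 0) ∧ u < y (Sum.inr 1) then idxDet k (matri fun p => y (Sum.inl p)) else 0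

lemma continuous_idxDet_hess (k : ℕ) :
    Continuous fun y : UpperIdx N ⊕ Fin 2 → ℝ => idxDet k (matri fun p => y (Sum.inl p)) :=
  (continuous_idxDet_matri k).comp (by fun_prop)

lemma measurableSet_above (u : ℝ) :
    MeasurableSet {y : UpperIdx N ⊕ Fin 2 → ℝ | u < y (Sum.inr 0) ∧ u < y (Sum.inr 1)} :=
  (measurableSet_lt measurable_const (measurable_pi_apply _)).inter
    (measurableSet_lt measurable_const (measurable_pi_apply _))

lemma measurable_kacRice (k : ℕ) (u : ℝ) : Measurable (kacRice (N := N) k u) :=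
  Measurable.ite (measurableSet_above u) (continuous_idxDet_hess k).measurable measurable_const

lemma kacRice_nonneg (k : ℕ) (u : ℝ) (y : UpperIdx N ⊕ Fin 2 → ℝ) : 0 ≤ kacRice k u y := by
  unfold kacRice
  split_ifs
  · exact idxDet_nonneg _ _
  · exact le_rfl

lemma abs_kacRice_le (k : ℕ) (u : ℝ) (y : UpperIdx N ⊕ Fin 2 → ℝ) :
    |kacRice k u y| ≤ N.factorial * (1 + ‖y‖) ^ N := by
  rw [abs_of_nonneg (kacRice_nonneg _ _ _)]
  have h0 : (0 : ℝ) ≤ N.factorial * (1 + ‖y‖) ^ N := by positivity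
  unfold kacRice
  split_ifs
  · refine (idxDet_le _ _).trans ?_
    have h1 := Matrix.det_le (A := matri fun p => y (Sum.inl p)) (abv := AbsoluteValue.abs)
      (x := 1 + ‖y‖) fun i j => by
        have := norm_le_pi_norm y (Sum.inl ⟨(min i j, max i j), min_le_max⟩)
        change |y _| ≤ _
        rw [← Real.norm_eq_abs]
        linarith
    rw [nsmul_eq_mul, Fintype.card_fin] at h1
    exact h1
  · exact h0

lemma continuousAt_kacRice (k : ℕ) (u : ℝ) {y : UpperIdx N ⊕ Fin 2 → ℝ}
    (h0 : y (Sum.inr 0) ≠ u) (h1 : y (Sum.inr 1) ≠ u) : ContinuousAt (kacRice k u) y := by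
  have c0 : Continuous fun y : UpperIdx N ⊕ Fin 2 → ℝ => y (Sum.inr 0) := by fun_prop
  have c1 : Continuous fun y : UpperIdx N ⊕ Fin 2 → ℝ => y (Sum.inr 1) := by fun_prop
  by_cases h : u < y (Sum.inr 0) ∧ u < y (Sum.inr 1)
  · refine (continuous_idxDet_hess k).continuousAt.congr ?_
    filter_upwards [c0.continuousAt.eventually_mem (lt_mem_nhds h.1),
      c1.continuousAt.eventually_mem (lt_mem_nhds h.2)] with y' h2 h3
    exact (if_pos ⟨h2, h3⟩).symm
  · refine continuousAt_const (y := (0 : ℝ)) |>.congr ?_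
    rw [not_and_or, not_lt, not_lt] at h
    rcases h with h | h
    · filter_upwards [c0.continuousAt.eventually_mem (gt_mem_nhds (lt_of_le_of_ne h h0))] with y' h2
      exact (if_neg fun h3 => lt_asymm h3.1 h2).symm
    · filter_upwards [c1.continuousAt.eventually_mem (gt_mem_nhds (lt_of_le_of_ne h h1))] with y' h2
      exact (if_neg fun h3 => lt_asymm h3.2 h2).symm

/-- The coordinate of the diagonal entry `(o, o)`. -/
abbrev diagIdx (o : Fin N) : UpperIdx N := ⟨(o, o), le_rfl⟩

/-- Covariance matrices of `(M, x, x')`, `M` a symmetric matrix, such that `x = x'`, the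
off-diagonal part of the `o`-th row of `M` vanishes, `M o o` is uncorrelated with the rest, and the
covariance of `x` with the remaining block of `M` is `-c` times the identity matrix. -/
structure IsDegenerateCov (V : Matrix (UpperIdx N ⊕ Fin 2) (UpperIdx N ⊕ Fin 2) ℝ) (o : Fin N)
    (c : ℝ) : Prop where
  c_pos : 0 < c
  val_pos : 0 < V (Sum.inr 0) (Sum.inr 0)
  val_eq : ∀ a b, V (Sum.inr a) (Sum.inr b) = V (Sum.inr 0) (Sum.inr 0)
  diag_pos : 0 < V (Sum.inl (diagIdx o)) (Sum.inl (diagIdx o))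
  diag_zero : ∀ j, j ≠ Sum.inl (diagIdx o) → V (Sum.inl (diagIdx o)) j = 0
  row_zero : ∀ p : UpperIdx N, p ≠ diagIdx o → (p.1.1 = o ∨ p.1.2 = o) →
    V (Sum.inl p) (Sum.inl p) = 0
  cross : ∀ p : UpperIdx N, p.1.1 ≠ o → p.1.2 ≠ o →
    V (Sum.inl p) (Sum.inr 0) = if p.1.1 = p.1.2 then -c else 0

variable {κ : Type*} [Fintype κ] {B : Matrix (UpperIdx N ⊕ Fin 2) κ ℝ} {o : Fin N} {c : ℝ}

/-- The coordinate of the entry `(i, j)` of a symmetric matrix. -/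
def entryIdx (i j : Fin N) : UpperIdx N := ⟨(min i j, max i j), min_le_max⟩

lemma matri_apply (a : UpperIdx N → ℝ) (i j : Fin N) : matri a i j = a (entryIdx i j) := rfl

lemma entryIdx_self (i : Fin N) : entryIdx i i = diagIdx i := by
  simp [entryIdx, diagIdx]

lemma entryIdx_eq_diagIdx_iff {i j o : Fin N} : entryIdx i j = diagIdx o ↔ i = o ∧ j = o := by
  constructor
  · intro h
    have h1 : min i j = o := congrArg (fun p : UpperIdx N => p.1.1) h
    have h2 : max i j = o := congrArg (fun p : UpperIdx N => p.1.2) h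
    rcases le_total i j with h3 | h3
    · rw [min_eq_left h3] at h1
      rw [max_eq_right h3] at h2
      exact ⟨h1, h2⟩
    · rw [min_eq_right h3] at h1
      rw [max_eq_left h3] at h2
      exact ⟨h2, h1⟩
  · rintro ⟨rfl, rfl⟩
    exact entryIdx_self _

lemma entryIdx_cases (i j : Fin N) :
    ((entryIdx i j).1.1 = i ∧ (entryIdx i j).1.2 = j) ∨
      ((entryIdx i j).1.1 = j ∧ (entryIdx i j).1.2 = i) := by
  rcases le_total i j with h | h
  · left; simp [entryIdx, h]
  · right; simp [entryIdx, h]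

namespace IsDegenerateCov

/-- A variable of variance zero has a zero row in the factor B, so the block structure holds for
every z and not just almost surely. -/
lemma row_eq_zero (hV : IsDegenerateCov (B * Bᵀ) o c) {i j : Fin N} (h : i = o ∨ j = o)
    (hij : ¬(i = o ∧ j = o)) : B (Sum.inl (entryIdx i j)) = 0 := by
  have h1 := hV.row_zero (entryIdx i j) (fun h => hij (entryIdx_eq_diagIdx_iff.1 h)) (by
    rcases entryIdx_cases i j with ⟨h1, h2⟩ | ⟨h1, h2⟩ <;> rw [h1, h2] <;> tauto)
  exact dotProduct_self_eq_zero.1 h1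

lemma val_row_eq (hV : IsDegenerateCov (B * Bᵀ) o c) : B (Sum.inr 1) = B (Sum.inr 0) := by
  rw [← sub_eq_zero, ← dotProduct_self_eq_zero]
  have h : ∀ a b, B (Sum.inr a) ⬝ᵥ B (Sum.inr b) = (B * Bᵀ) (Sum.inr 0) (Sum.inr 0) :=
    fun a b => hV.val_eq a b
  simp only [sub_dotProduct, dotProduct_sub, h]
  ring

/-- The linear forms whose values are the entries of the Hessian part made uncorrelated with the
value part. -/
def decorr (B : Matrix (UpperIdx N ⊕ Fin 2) κ ℝ) (o : Fin N) (a : ℝ) (ij : Fin N × Fin N) : κ → ℝ :=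
  B (Sum.inl (entryIdx ij.1 ij.2)) + (a * offMat o ij.1 ij.2) • B (Sum.inr 0)

/-- The coefficient c / Var(x) is the regression coefficient: adding it times x to a diagonal entry
of the complementary block cancels the covariance -c. All other entries are already uncorrelated
with x. -/
lemma decorr_dotProduct (hV : IsDegenerateCov (B * Bᵀ) o c) (ij : Fin N × Fin N) :
    decorr B o (c / (B * Bᵀ) (Sum.inr 0) (Sum.inr 0)) ij ⬝ᵥ B (Sum.inr 0) = 0 := by
  obtain ⟨i, j⟩ := ij
  have hx : B (Sum.inr 0) ⬝ᵥ B (Sum.inr 0) = (B * Bᵀ) (Sum.inr 0) (Sum.inr 0) := rfl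
  simp only [decorr, add_dotProduct, smul_dotProduct, smul_eq_mul, hx]
  have hv := hV.val_pos.ne'
  by_cases ho : i = o ∧ j = o
  · have h1 := hV.diag_zero (Sum.inr 0) (by simp)
    rw [← entryIdx_self] at h1
    have h2 : B (Sum.inl (entryIdx o o)) ⬝ᵥ B (Sum.inr 0) = 0 := h1
    simp [ho.1, ho.2, h2, offMat]
  by_cases h : i = o ∨ j = o
  · rw [hV.row_eq_zero h ho]
    have : offMat o i j = 0 := by
      by_cases hij : i = j
      · exact absurd ⟨by rcases h with h | h <;> simp_all, by rcases h with h | h <;> simp_all⟩ ho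
      · simp [offMat, hij]
    simp [this]
  · push Not at h
    have h1 := hV.cross (entryIdx i j)
      (by rcases entryIdx_cases i j with ⟨h1, h2⟩ | ⟨h1, h2⟩ <;> rw [h1] <;> tauto)
      (by rcases entryIdx_cases i j with ⟨h1, h2⟩ | ⟨h1, h2⟩ <;> rw [h2] <;> tauto)
    have h2 : ((entryIdx i j).1.1 = (entryIdx i j).1.2) ↔ i = j := by
      rcases entryIdx_cases i j with ⟨h1, h2⟩ | ⟨h1, h2⟩ <;> rw [h1, h2]
      exact eq_comm
    simp only [h2] at h1
    have h3 : B (Sum.inl (entryIdx i j)) ⬝ᵥ B (Sum.inr 0) = if i = j then -c else 0 := h1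
    rw [h3]
    by_cases hij : i = j
    · subst hij
      simp only [if_true, offMat, Matrix.diagonal_apply_eq, h.1, if_false, mul_one]
      field_simp
      ring
    · simp [hij, offMat]

variable (B) in
/-- The symmetric matrix with the law of the Hessian part. -/
def hess (z : κ → ℝ) : Matrix (Fin N) (Fin N) ℝ := matri fun p => (B *ᵥ z) (Sum.inl p)

lemma hess_block (hV : IsDegenerateCov (B * Bᵀ) o c) (z : κ → ℝ) (b : Fin N) (hb : b ≠ o) :
    hess B z o b = 0 := by
  have h := hV.row_eq_zero (i := o) (j := b) (Or.inl rfl) (fun h => hb h.2)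
  change B (Sum.inl (entryIdx o b)) ⬝ᵥ z = 0
  rw [h, zero_dotProduct]

variable (B o) in
/-- The part of the Hessian which is uncorrelated with the value. -/
def compHess (a : ℝ) (z : κ → ℝ) : Matrix (Fin N) (Fin N) ℝ :=
  Matrix.of fun i j => decorr B o a (i, j) ⬝ᵥ z

lemma hess_eq (a : ℝ) (z : κ → ℝ) :
    hess B z = compHess B o a z - (a * (B *ᵥ z) (Sum.inr 0)) • offMat o := by
  ext i j
  simp only [compHess, decorr, Matrix.sub_apply, Matrix.of_apply, add_dotProduct, smul_dotProduct,
    Matrix.smul_apply, smul_eq_mul]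
  change B (Sum.inl (entryIdx i j)) ⬝ᵥ z = _ + _ * (B (Sum.inr 0) ⬝ᵥ z) - a * (B (Sum.inr 0) ⬝ᵥ z) * _
  ring

variable (N o) in
/-- The reflection of the diagonal coordinate `(o, o)`. -/
def reflCoord : Matrix (UpperIdx N ⊕ Fin 2) (UpperIdx N ⊕ Fin 2) ℝ :=
  reflMat (Sum.inl (diagIdx o))

/-- The reflection only changes the sign of covariances between M_oo and the other coordinates, and
these vanish. This is the symmetry behind the value 1/2. -/
lemma reflCoord_mul_transpose (hV : IsDegenerateCov (B * Bᵀ) o c) :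
    (reflCoord N o * B) * (reflCoord N o * B)ᵀ = B * Bᵀ := by
  have hsymm : ∀ i j, (B * Bᵀ) i j = (B * Bᵀ) j i := fun i j => dotProduct_comm (B i) (B j)
  have : (reflCoord N o * B) * (reflCoord N o * B)ᵀ = reflCoord N o * (B * Bᵀ) * (reflCoord N o)ᵀ := by
    simp [Matrix.mul_assoc]
  rw [this]
  ext i j
  simp only [reflCoord, reflMat, Matrix.diagonal_transpose, Matrix.mul_diagonal,
    Matrix.diagonal_mul]
  by_cases hi : i = Sum.inl (diagIdx o) <;> by_cases hj : j = Sum.inl (diagIdx o)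
  · simp [hi, hj]
  · rw [hi, hV.diag_zero j hj]; simp
  · rw [hj, hsymm, hV.diag_zero i hi]; simp
  · simp [hi, hj]

lemma hess_reflCoord (hV : IsDegenerateCov (B * Bᵀ) o c) (z : κ → ℝ) :
    hess (reflCoord N o * B) z = reflMat o * hess B z := by
  ext i j
  have h1 : hess (reflCoord N o * B) z i j =
      (if entryIdx i j = diagIdx o then -1 else 1) * hess B z i j := by
    simp only [hess, matri_apply, ← Matrix.mulVec_mulVec, reflCoord, reflMat,
      Matrix.mulVec_diagonal, Sum.inl.injEq]
  rw [h1, reflMat_mul_apply]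
  simp only [entryIdx_eq_diagIdx_iff]
  by_cases hi : i = o
  · subst hi
    by_cases hj : j = i
    · simp [hj]
    · simp [hj, hV.hess_block z j hj]
  · simp [hi]

lemma reflCoord_mulVec_inr (z : κ → ℝ) (a : Fin 2) :
    ((reflCoord N o * B) *ᵥ z) (Sum.inr a) = (B *ᵥ z) (Sum.inr a) := by
  simp [← Matrix.mulVec_mulVec, reflCoord, reflMat, Matrix.mulVec_diagonal]

lemma mulVec_inr (hV : IsDegenerateCov (B * Bᵀ) o c) (z : κ → ℝ) (a : Fin 2) :
    (B *ᵥ z) (Sum.inr a) = B (Sum.inr 0) ⬝ᵥ z := by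
  fin_cases a
  · rfl
  · change B (Sum.inr 1) ⬝ᵥ z = _
    rw [hV.val_row_eq]

lemma kacRice_eq (hV : IsDegenerateCov (B * Bᵀ) o c) (k : ℕ) (u : ℝ) (z : κ → ℝ) :
    kacRice k u (B *ᵥ z) = if u < B (Sum.inr 0) ⬝ᵥ z then idxDet k (hess B z) else 0 := by
  simp [kacRice, hV.mulVec_inr, hess]

lemma kacRice_reflCoord_eq (hV : IsDegenerateCov (B * Bᵀ) o c) (k : ℕ) (u : ℝ) (z : κ → ℝ) :
    kacRice k u ((reflCoord N o * B) *ᵥ z) =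
      if u < B (Sum.inr 0) ⬝ᵥ z then idxDet k (reflMat o * hess B z) else 0 := by
  rw [← hV.hess_reflCoord]
  simp [kacRice, reflCoord_mulVec_inr, hV.mulVec_inr, hess]

lemma integral_kacRice_le (hV : IsDegenerateCov (B * Bᵀ) o c) (u : ℝ) :
    ∫ z, kacRice N u (B *ᵥ z) ∂stdG κ ≤ ∫ z, kacRice (N - 1) u (B *ᵥ z) ∂stdG κ := by
  -- The index-N integral is computed with the reflected factor, which has the same law; the two
  -- integrands can then be compared pointwise.
  rw [← integral_mulVec_stdG_eq hV.reflCoord_mul_transpose (measurable_kacRice N u)]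
  refine integral_mono (integrable_mulVec_stdG (measurable_kacRice _ _) (abs_kacRice_le _ _) _)
    (integrable_mulVec_stdG (measurable_kacRice _ _) (abs_kacRice_le _ _) _) fun z => ?_
  simp only [hV.kacRice_reflCoord_eq, hV.kacRice_eq]
  split_ifs
  · simpa using idxDet_reflMat_mul_le (M := hess B z) (matri_isHermitian _) (hV.hess_block z)
  · exact le_rfl

lemma ite_le_ite_of_le {p q S T : ℝ} (h : p ≤ q) (hT : 0 ≤ T) :
    (if q ≤ S then T else 0) ≤ if p ≤ S then T else 0 := by
  split_ifs with h1 h2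
  · exact le_rfl
  · exact absurd (h.trans h1) h2
  · exact hT
  · exact le_rfl

/-- The bound for the contribution of the matrices with an exceptional index. -/
def tailBound (r : ℝ) (M : Fin N × Fin N → ℝ) : ℝ :=
  if r ≤ ∑ i, ∑ j, |M (i, j)| then N.factorial * (2 * ∑ i, ∑ j, |M (i, j)|) ^ N else 0

lemma measurable_tailBound (r : ℝ) : Measurable (tailBound (N := N) r) :=
  Measurable.ite (measurableSet_le measurable_const (by fun_prop)) (by fun_prop) measurable_const

lemma tailBound_nonneg (r : ℝ) (M : Fin N × Fin N → ℝ) : 0 ≤ tailBound r M := by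
  unfold tailBound
  split_ifs
  · have : 0 ≤ ∑ i, ∑ j, |M (i, j)| := by positivity
    positivity
  · exact le_rfl

lemma tailBound_le (r : ℝ) (M : Fin N × Fin N → ℝ) :
    tailBound r M ≤ N.factorial * (2 * (N * N)) ^ N * (1 + ‖M‖) ^ N := by
  have h0 : 0 ≤ ∑ i, ∑ j, |M (i, j)| := by positivity
  have h1 : ∑ i, ∑ j, |M (i, j)| ≤ N * N * ‖M‖ := by
    calc ∑ i, ∑ j, |M (i, j)| ≤ ∑ _i : Fin N, ∑ _j : Fin N, ‖M‖ :=
          Finset.sum_le_sum fun i _ => Finset.sum_le_sum fun j _ => norm_le_pi_norm M (i, j)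
      _ = _ := by simp [mul_assoc]
  unfold tailBound
  split_ifs
  · rw [mul_assoc, ← mul_pow]
    have h2 : 2 * ∑ i, ∑ j, |M (i, j)| ≤ 2 * (N * N) * (1 + ‖M‖) := by
      nlinarith [norm_nonneg M, (by positivity : (0 : ℝ) ≤ N * N)]
    exact mul_le_mul_of_nonneg_left (pow_le_pow_left₀ (by positivity) h2 _) (by positivity)
  · positivity

lemma integrable_tailBound (r a : ℝ) :
    Integrable (fun z => tailBound r fun ij => decorr B o a ij ⬝ᵥ z) (stdG κ) :=
  integrable_mulVec_stdG (measurable_tailBound r)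
    (fun y => by
      rw [abs_of_nonneg (tailBound_nonneg _ _)]
      exact tailBound_le r y) (Matrix.of (decorr B o a))

/-- For each z the integrand vanishes once r exceeds the sum of the entries; the case r = 0
dominates. -/
lemma tendsto_integral_tailBound (a : ℝ) :
    Tendsto (fun r => ∫ z, tailBound r (fun ij => decorr B o a ij ⬝ᵥ z) ∂stdG κ) atTop (𝓝 0) := by
  have h : Tendsto (fun r => ∫ z, tailBound r (fun ij => decorr B o a ij ⬝ᵥ z) ∂stdG κ) atTop
      (𝓝 (∫ _z, (0 : ℝ) ∂stdG κ)) := by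
    refine tendsto_integral_filter_of_dominated_convergence
      (fun z => tailBound 0 fun ij => decorr B o a ij ⬝ᵥ z)
      (.of_forall fun r => (integrable_tailBound r a).aestronglyMeasurable)
      (.of_forall fun r => .of_forall fun z => ?_) (integrable_tailBound 0 a)
      (.of_forall fun z => ?_)
    · rw [Real.norm_of_nonneg (tailBound_nonneg _ _)]
      have h0 : 0 ≤ ∑ i, ∑ j, |decorr B o a (i, j) ⬝ᵥ z| := by positivity
      simp only [tailBound, if_pos h0]
      split_ifs
      · exact le_rfl
      · positivity
    · refine tendsto_const_nhds.congr' ?_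
      filter_upwards [eventually_gt_atTop (∑ i, ∑ j, |decorr B o a (i, j) ⬝ᵥ z|)] with r hr
      exact (if_neg (not_le.2 hr)).symm
  simpa using h

lemma indepFun (hV : IsDegenerateCov (B * Bᵀ) o c) :
    IndepFun (fun z ij => decorr B o (c / (B * Bᵀ) (Sum.inr 0) (Sum.inr 0)) ij ⬝ᵥ z)
      (fun z => B (Sum.inr 0) ⬝ᵥ z) (stdG κ) :=
  indepFun_dotProduct_stdG _ _ hV.decorr_dotProduct

/-- The pointwise error depends only on the part of the Hessian independent of x, so its integral
over x > u factorizes. The factor P(x > u) is what makes it comparable with the lower bound of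
`le_integral_kacRice`. -/
lemma integral_kacRice_pred_le (hV : IsDegenerateCov (B * Bᵀ) o c) {u : ℝ} (hu : 0 < u) :
    ∫ z, kacRice (N - 1) u (B *ᵥ z) ∂stdG κ ≤ ∫ z, kacRice N u (B *ᵥ z) ∂stdG κ +
      (∫ z, tailBound (c / (B * Bᵀ) (Sum.inr 0) (Sum.inr 0) * u)
        (fun ij => decorr B o (c / (B * Bᵀ) (Sum.inr 0) (Sum.inr 0)) ij ⬝ᵥ z) ∂stdG κ) *
      (stdG κ).real {z | u < B (Sum.inr 0) ⬝ᵥ z} := by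
  set a := c / (B * Bᵀ) (Sum.inr 0) (Sum.inr 0) with ha
  have ha0 : 0 < a := div_pos hV.c_pos hV.val_pos
  have hms : MeasurableSet {z : κ → ℝ | u < B (Sum.inr 0) ⬝ᵥ z} :=
    measurableSet_lt measurable_const (by fun_prop)
  have hind : ∫ z, (tailBound (a * u) fun ij => decorr B o a ij ⬝ᵥ z) *
      (Set.Ioi u).indicator (fun _ => (1 : ℝ)) (B (Sum.inr 0) ⬝ᵥ z) ∂stdG κ =
      (∫ z, tailBound (a * u) (fun ij => decorr B o a ij ⬝ᵥ z) ∂stdG κ) *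
      (stdG κ).real {z | u < B (Sum.inr 0) ⬝ᵥ z} := by
    have h1 := hV.indepFun.integral_fun_comp_mul_comp (f := tailBound (a * u))
      (g := (Set.Ioi u).indicator fun _ => (1 : ℝ)) (by fun_prop) (by fun_prop)
      (measurable_tailBound _).aestronglyMeasurable
      ((measurable_const.indicator measurableSet_Ioi).aestronglyMeasurable)
    rw [h1]
    congr 1
    rw [← integral_indicator_one hms]
    rfl
  have hint2 : Integrable (fun z => (tailBound (a * u) fun ij => decorr B o a ij ⬝ᵥ z) *
      (Set.Ioi u).indicator (fun _ => (1 : ℝ)) (B (Sum.inr 0) ⬝ᵥ z)) (stdG κ) := by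
    refine (integrable_tailBound (B := B) (o := o) (a * u) a).mul_bdd (c := 1) ?_ ?_
    · exact ((measurable_const.indicator measurableSet_Ioi).comp
        (by fun_prop : Measurable fun z : κ → ℝ => B (Sum.inr 0) ⬝ᵥ z)).aestronglyMeasurable
    · refine .of_forall fun z => ?_
      by_cases hz : B (Sum.inr 0) ⬝ᵥ z ∈ Set.Ioi u <;> simp [hz]
  rw [← hind, ← integral_mulVec_stdG_eq hV.reflCoord_mul_transpose (measurable_kacRice N u),
    ← integral_add (integrable_mulVec_stdG (measurable_kacRice _ _) (abs_kacRice_le _ _) _) hint2]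
  refine integral_mono (integrable_mulVec_stdG (measurable_kacRice _ _) (abs_kacRice_le _ _) _)
    ((integrable_mulVec_stdG (measurable_kacRice _ _) (abs_kacRice_le _ _) _).add hint2) fun z => ?_
  simp only [hV.kacRice_reflCoord_eq, hV.kacRice_eq]
  split_ifs with hz
  · have h1 := idxDet_le_add_of_block (M := hess B z) (matri_isHermitian _) (hV.hess_block z)
      (x := a * (B *ᵥ z) (Sum.inr 0)) (by rw [hV.mulVec_inr]; exact mul_nonneg ha0.le (hu.trans hz).le)
      (hess_eq a z)
    rw [hV.mulVec_inr] at h1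
    simp only [Fintype.card_fin] at h1
    refine h1.trans ?_
    gcongr
    rw [Set.indicator_of_mem (Set.mem_Ioi.2 hz), mul_one, tailBound]
    simp only [compHess, Matrix.of_apply]
    have h2 : a * u ≤ a * (B (Sum.inr 0) ⬝ᵥ z) := by gcongr
    exact ite_le_ite_of_le h2 (by positivity)
  · rw [zero_add]
    exact mul_nonneg (tailBound_nonneg _ _) (Set.indicator_nonneg (fun _ _ => zero_le_one) _)

/-- The event that the uncorrelated part is close to a negative multiple of a matrix unit. -/
def goodSet (o : Fin N) : Set (Fin N × Fin N → ℝ) :=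
  {M | M (o, o) < -1 ∧ (∑ i, ∑ j, |M (i, j)|) - |M (o, o)| < 1}

lemma isOpen_goodSet : IsOpen (goodSet o) := by
  have h1 : IsOpen {M : Fin N × Fin N → ℝ | M (o, o) < -1} :=
    isOpen_lt (by fun_prop) continuous_const
  have h2 : IsOpen {M : Fin N × Fin N → ℝ | (∑ i, ∑ j, |M (i, j)|) - |M (o, o)| < 1} :=
    isOpen_lt (by fun_prop) continuous_const
  exact h1.inter h2

lemma goodSet_prob_pos (hV : IsDegenerateCov (B * Bᵀ) o c) (a : ℝ) :
    0 < (stdG κ).real ((fun z ij => decorr B o a ij ⬝ᵥ z) ⁻¹' goodSet o) := by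
  refine ENNReal.toReal_pos (IsOpen.measure_pos _ (isOpen_goodSet.preimage (by fun_prop)) ?_).ne'
    (measure_ne_top _ _)
  set s := (B * Bᵀ) (Sum.inl (diagIdx o)) (Sum.inl (diagIdx o)) with hs
  -- At this point the decorrelated matrix is -2 at (o, o) and zero elsewhere, because the form for
  -- M_oo is orthogonal to all the others.
  refine ⟨(-2 / s) • B (Sum.inl (diagIdx o)), ?_⟩
  have hval : ∀ ij : Fin N × Fin N, decorr B o a ij ⬝ᵥ ((-2 / s) • B (Sum.inl (diagIdx o))) =
      if ij = (o, o) then -2 else 0 := by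
    rintro ⟨i, j⟩
    have hx : B (Sum.inr 0) ⬝ᵥ B (Sum.inl (diagIdx o)) = 0 := by
      rw [dotProduct_comm]
      exact hV.diag_zero (Sum.inr 0) (by simp)
    simp only [decorr, dotProduct_smul, add_dotProduct, smul_dotProduct, hx, smul_eq_mul,
      mul_zero, add_zero, Prod.mk.injEq]
    split_ifs with h
    · rw [entryIdx_eq_diagIdx_iff.2 h]
      have : B (Sum.inl (diagIdx o)) ⬝ᵥ B (Sum.inl (diagIdx o)) = s := rfl
      rw [this, div_mul_cancel₀ _ hV.diag_pos.ne']
    · have : B (Sum.inl (entryIdx i j)) ⬝ᵥ B (Sum.inl (diagIdx o)) = 0 := by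
        rw [dotProduct_comm]
        exact hV.diag_zero _ (by
          rw [Ne, Sum.inl.injEq, entryIdx_eq_diagIdx_iff]
          exact h)
      rw [this, mul_zero]
  simp only [Set.mem_preimage, goodSet, Set.mem_ofPred_eq, hval]
  constructor
  · norm_num
  · have h1 : ∑ i, ∑ j, |if (i, j) = (o, o) then (-2 : ℝ) else 0| = 2 := by
      rw [Finset.sum_eq_single o, Finset.sum_eq_single o]
      · simp
      · intro b _ hb; simp [hb]
      · simp
      · intro b _ hb; simp [hb]
      · simp
    rw [h1]
    norm_num

/-- On `goodSet` and x > w the integrand is at least 1, and these two events are independent. The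
choice w = u serves the asymptotics; a larger w gives positivity for every u. -/
lemma le_integral_kacRice (hV : IsDegenerateCov (B * Bᵀ) o c) {u w : ℝ} (huw : u ≤ w)
    (hw : 2 ≤ c / (B * Bᵀ) (Sum.inr 0) (Sum.inr 0) * w) :
    (stdG κ).real ((fun z ij => decorr B o (c / (B * Bᵀ) (Sum.inr 0) (Sum.inr 0)) ij ⬝ᵥ z) ⁻¹'
      goodSet o) * (stdG κ).real {z | w < B (Sum.inr 0) ⬝ᵥ z} ≤
      ∫ z, kacRice N u (B *ᵥ z) ∂stdG κ := by
  set a := c / (B * Bᵀ) (Sum.inr 0) (Sum.inr 0) with ha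
  have ha0 : 0 < a := div_pos hV.c_pos hV.val_pos
  have hind := hV.indepFun.measure_inter_preimage_eq_mul (goodSet o) (Set.Ioi w)
    isOpen_goodSet.measurableSet measurableSet_Ioi
  have hms : MeasurableSet (((fun z ij => decorr B o a ij ⬝ᵥ z) ⁻¹' goodSet o) ∩
      (fun z => B (Sum.inr 0) ⬝ᵥ z) ⁻¹' Set.Ioi w) :=
    (isOpen_goodSet.preimage (by fun_prop)).measurableSet.inter
      (isOpen_Ioi.preimage (by fun_prop)).measurableSet
  have h1 : (stdG κ).real ((fun z ij => decorr B o a ij ⬝ᵥ z) ⁻¹' goodSet o) *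
      (stdG κ).real {z | w < B (Sum.inr 0) ⬝ᵥ z} =
      (stdG κ).real (((fun z ij => decorr B o a ij ⬝ᵥ z) ⁻¹' goodSet o) ∩
      (fun z => B (Sum.inr 0) ⬝ᵥ z) ⁻¹' Set.Ioi w) := by
    simp only [Measure.real]
    rw [hind, ENNReal.toReal_mul]
    rfl
  rw [h1, ← integral_indicator_one hms]
  refine integral_mono ((integrable_const (1 : ℝ)).indicator hms)
    (integrable_mulVec_stdG (measurable_kacRice _ _) (abs_kacRice_le _ _) _) fun z => ?_
  refine Set.indicator_apply_le' (fun hz => ?_) fun _ => kacRice_nonneg _ _ _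
  obtain ⟨⟨hz1, hz2⟩, hz3⟩ := hz
  have hz3 : w < B (Sum.inr 0) ⬝ᵥ z := hz3
  rw [hV.kacRice_eq, if_pos (huw.trans_lt hz3)]
  have h2 := one_le_idxDet_of_block (M := hess B z) (matri_isHermitian _) (hV.hess_block z)
    (x := a * (B *ᵥ z) (Sum.inr 0)) (by
      rw [hV.mulVec_inr]
      exact hw.trans (by gcongr)) (hess_eq a z) hz1.le hz2.le
  simpa using h2

lemma integral_kacRice_pos (hV : IsDegenerateCov (B * Bᵀ) o c) (u : ℝ) :
    0 < ∫ z, kacRice N u (B *ᵥ z) ∂stdG κ := by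
  have ha0 : 0 < c / (B * Bᵀ) (Sum.inr 0) (Sum.inr 0) := div_pos hV.c_pos hV.val_pos
  have h := hV.le_integral_kacRice (le_max_left u (2 / (c / (B * Bᵀ) (Sum.inr 0) (Sum.inr 0)))) (by
    refine le_trans (le_of_eq ?_) (mul_le_mul_of_nonneg_left (le_max_right _ _) ha0.le)
    exact (mul_div_cancel₀ _ ha0.ne').symm)
  exact (mul_pos (hV.goodSet_prob_pos _) (measureReal_dotProduct_gt_pos hV.val_pos.ne' _)).trans_le h

/-- With I and J the integrals for index N and N - 1, one has I ≤ J ≤ (1 + G(u)/p) I for large u, so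
the ratio lies between 1/(2 + G(u)/p) and 1/2. -/
theorem tendsto_ratio (hV : IsDegenerateCov (B * Bᵀ) o c) :
    Tendsto (fun u => (∫ z, kacRice N u (B *ᵥ z) ∂stdG κ) /
      (∫ z, kacRice (N - 1) u (B *ᵥ z) ∂stdG κ + ∫ z, kacRice N u (B *ᵥ z) ∂stdG κ))
      atTop (𝓝 (1 / 2)) := by
  set a := c / (B * Bᵀ) (Sum.inr 0) (Sum.inr 0) with ha
  have ha0 : 0 < a := div_pos hV.c_pos hV.val_pos
  set p := (stdG κ).real ((fun z ij => decorr B o a ij ⬝ᵥ z) ⁻¹' goodSet o) with hp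
  have hp0 : 0 < p := hV.goodSet_prob_pos a
  set G := fun u => ∫ z, tailBound (a * u) (fun ij => decorr B o a ij ⬝ᵥ z) ∂stdG κ with hG
  have hG0 : Tendsto G atTop (𝓝 0) :=
    (tendsto_integral_tailBound (B := B) (o := o) a).comp (tendsto_id.const_mul_atTop ha0)
  have hlow : Tendsto (fun u => 1 / (2 + G u / p)) atTop (𝓝 (1 / 2)) := by
    have : Tendsto (fun u => 1 / (2 + G u / p)) atTop (𝓝 (1 / (2 + 0 / p))) :=
      (tendsto_const_nhds.div (tendsto_const_nhds.add (hG0.div_const p)) (by simp))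
    simpa using this
  refine tendsto_of_tendsto_of_tendsto_of_le_of_le' hlow tendsto_const_nhds ?_ ?_
  · filter_upwards [eventually_ge_atTop (2 / a), eventually_gt_atTop 0] with u hu hu0
    have hI := hV.integral_kacRice_pos u
    have h1 := hV.integral_kacRice_pred_le hu0
    have h2 := hV.le_integral_kacRice (le_refl u) (by
      rw [← ha]; rw [div_le_iff₀' ha0] at hu; exact hu)
    have h3 := measureReal_dotProduct_gt_pos hV.val_pos.ne' u
    have h4 := hV.integral_kacRice_le u
    rw [← ha] at h1 h2
    change _ ≤ _ + G u * _ at h1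
    change p * _ ≤ _ at h2
    have hGn : 0 ≤ G u := integral_nonneg fun z => tailBound_nonneg _ _
    set I := ∫ z, kacRice N u (B *ᵥ z) ∂stdG κ
    set J := ∫ z, kacRice (N - 1) u (B *ᵥ z) ∂stdG κ
    set q := (stdG κ).real {z | u < B (Sum.inr 0) ⬝ᵥ z}
    -- The probability q of x > u cancels thanks to p q ≤ I.
    have h5 : G u * q ≤ G u / p * I := by
      rw [div_mul_eq_mul_div, le_div_iff₀ hp0]
      nlinarith
    rw [div_le_div_iff₀ (by positivity) (by linarith)]
    nlinarith
  · refine .of_forall fun u => ?_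
    have hI := hV.integral_kacRice_pos u
    have h4 := hV.integral_kacRice_le u
    rw [div_le_div_iff₀ (by linarith) (by norm_num)]
    linarith

end IsDegenerateCov

end Ratio

/-! ### Spaces of centered Gaussian variables closed under almost sure limits. -/

section CenteredGaussian

variable {Ω : Type*} [MeasurableSpace Ω] {P : Measure Ω} [IsProbabilityMeasure P]

/-- `Y` is a centered Gaussian random variable. -/
structure IsCenteredGaussian (P : Measure Ω) (Y : Ω → ℝ) : Prop where
  law : HasGaussianLaw Y P
  mean : ∫ ω, Y ω ∂P = 0

omit [IsProbabilityMeasure P] in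
lemma IsCenteredGaussian.charFun_eq {Y : Ω → ℝ} (hY : IsCenteredGaussian P Y) (θ : ℝ) :
    charFun (P.map Y) θ = Complex.exp (-((Var[Y; P] * θ ^ 2 / 2 : ℝ) : ℂ)) := by
  rw [hY.law.map_eq_gaussianReal, charFun_gaussianReal, hY.mean]
  congr 1
  rw [Real.coe_toNNReal _ (variance_nonneg _ _)]
  push_cast
  ring

/-- Characteristic functions converge by dominated convergence, and for centered Gaussian variables
their modulus determines the variance. Thus pathwise derivatives also have the expected covariances.
-/
lemma IsCenteredGaussian.of_tendsto {Y : ℕ → Ω → ℝ} {Z : Ω → ℝ}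
    (hY : ∀ n, IsCenteredGaussian P (Y n))
    (hlim : ∀ᵐ ω ∂P, Tendsto (fun n => Y n ω) atTop (𝓝 (Z ω))) :
    IsCenteredGaussian P Z ∧ Tendsto (fun n => Var[Y n; P]) atTop (𝓝 Var[Z; P]) := by
  have hZm : AEMeasurable Z P :=
    aemeasurable_of_tendsto_metrizable_ae atTop (fun n => (hY n).law.aemeasurable) hlim
  have : IsProbabilityMeasure (P.map Z) := Measure.isProbabilityMeasure_map hZm
  have hchar : ∀ θ : ℝ, Tendsto (fun n => charFun (P.map (Y n)) θ) atTop
      (𝓝 (charFun (P.map Z) θ)) := by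
    intro θ
    simp_rw [charFun_apply_real]
    rw [integral_map hZm (by fun_prop)]
    have h1 : ∀ n, ∫ x, Complex.exp (θ * x * Complex.I) ∂(P.map (Y n)) =
        ∫ ω, Complex.exp (θ * Y n ω * Complex.I) ∂P := fun n => by
      rw [integral_map (hY n).law.aemeasurable (by fun_prop)]
    simp_rw [h1]
    refine tendsto_integral_of_dominated_convergence (fun _ => 1) (fun n => ?_)
      (integrable_const 1) (fun n => ?_) ?_
    · have := (hY n).law.aemeasurable
      exact AEMeasurable.aestronglyMeasurable (by fun_prop)
    · refine .of_forall fun ω => ?_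
      rw [← Complex.ofReal_mul, Complex.norm_exp_ofReal_mul_I]
    · filter_upwards [hlim] with ω hω
      have hc : Continuous fun x : ℝ => Complex.exp (θ * x * Complex.I) := by fun_prop
      exact (hc.tendsto _).comp hω
  -- A nonzero frequency at which the limit does not vanish excludes variances escaping to infinity
  -- and allows taking the logarithm.
  obtain ⟨θ, hθ, hne⟩ : ∃ θ : ℝ, θ ≠ 0 ∧ charFun (P.map Z) θ ≠ 0 := by
    have hc : ContinuousAt (charFun (P.map Z)) 0 := (continuous_charFun).continuousAt
    have h0 : charFun (P.map Z) 0 ≠ 0 := by simp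
    have h1 : ∀ᶠ θ in 𝓝[≠] (0 : ℝ), charFun (P.map Z) θ ≠ 0 :=
      (hc.eventually_ne h0).filter_mono nhdsWithin_le_nhds
    obtain ⟨θ, h2, h3⟩ := (h1.and self_mem_nhdsWithin).exists
    exact ⟨θ, h3, h2⟩
  have hnorm : Tendsto (fun n => Real.exp (-(Var[Y n; P] * θ ^ 2 / 2))) atTop
      (𝓝 ‖charFun (P.map Z) θ‖) := by
    refine (hchar θ).norm.congr fun n => ?_
    rw [(hY n).charFun_eq, ← Complex.ofReal_neg, Complex.norm_exp_ofReal]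
  have hvar : Tendsto (fun n => Var[Y n; P]) atTop
      (𝓝 (-Real.log ‖charFun (P.map Z) θ‖ * 2 / θ ^ 2)) := by
    have h1 := ((Real.continuousAt_log (norm_ne_zero_iff.2 hne)).tendsto.comp hnorm).neg
    refine ((h1.mul_const 2).div_const (θ ^ 2)).congr fun n => ?_
    simp only [Function.comp_apply, Real.log_exp, neg_neg]
    field_simp
  set s := -Real.log ‖charFun (P.map Z) θ‖ * 2 / θ ^ 2 with hs
  have hs0 : 0 ≤ s := ge_of_tendsto' hvar fun n => variance_nonneg _ _
  have hmap : P.map Z = gaussianReal 0 s.toNNReal := by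
    refine Measure.ext_of_charFun (funext fun θ => ?_)
    refine tendsto_nhds_unique (hchar θ) ?_
    have hc : Continuous fun v : ℝ => Complex.exp (-((v * θ ^ 2 / 2 : ℝ) : ℂ)) := by fun_prop
    have h2 := (hc.tendsto s).comp hvar
    rw [charFun_gaussianReal, Real.coe_toNNReal _ hs0]
    have h3 := h2.congr fun n => ((hY n).charFun_eq θ).symm
    convert h3 using 2
    push_cast
    congr 1
    ring
  have hlaw : HasGaussianLaw Z P := ⟨by rw [hmap]; infer_instance⟩
  have hmean : ∫ ω, Z ω ∂P = 0 := by
    have := integral_map (μ := P) (f := fun x : ℝ => x) hZm (by fun_prop)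
    rw [← this, hmap]
    exact integral_id_gaussianReal
  refine ⟨⟨hlaw, hmean⟩, ?_⟩
  have hv : Var[Z; P] = s := by
    have h3 := variance_map (μ := P) (Y := Z) (X := id) (by fun_prop) hZm
    rw [hmap] at h3
    simp only [variance_id_gaussianReal, Function.id_comp] at h3
    rw [← h3, Real.coe_toNNReal _ hs0]
  rwa [hv]

/-- The almost sure limits of sequences of elements of a space of random variables. -/
def aeLimits (P : Measure Ω) (W : Submodule ℝ (Ω → ℝ)) : Submodule ℝ (Ω → ℝ) where
  carrier := {Y | ∃ Z : ℕ → Ω → ℝ, (∀ n, Z n ∈ W) ∧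
    ∀ᵐ ω ∂P, Tendsto (fun n => Z n ω) atTop (𝓝 (Y ω))}
  add_mem' := by
    rintro Y Y' ⟨Z, hZ, hl⟩ ⟨Z', hZ', hl'⟩
    refine ⟨fun n => Z n + Z' n, fun n => W.add_mem (hZ n) (hZ' n), ?_⟩
    filter_upwards [hl, hl'] with ω h h' using h.add h'
  zero_mem' := ⟨fun _ => 0, fun _ => W.zero_mem, .of_forall fun _ => tendsto_const_nhds⟩
  smul_mem' := by
    rintro c Y ⟨Z, hZ, hl⟩
    refine ⟨fun n => c • Z n, fun n => W.smul_mem c (hZ n), ?_⟩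
    filter_upwards [hl] with ω h using h.const_mul c

omit [IsProbabilityMeasure P] in
lemma le_aeLimits (W : Submodule ℝ (Ω → ℝ)) : W ≤ aeLimits P W :=
  fun Y hY => ⟨fun _ => Y, fun _ => hY, .of_forall fun _ => tendsto_const_nhds⟩

/-- All elements of a space of random variables are centered Gaussian. -/
def IsGaussianSpace (P : Measure Ω) (W : Submodule ℝ (Ω → ℝ)) : Prop :=
  ∀ Y ∈ W, IsCenteredGaussian P Y

lemma IsGaussianSpace.aeLimits {W : Submodule ℝ (Ω → ℝ)} (hW : IsGaussianSpace P W) :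
    IsGaussianSpace P (aeLimits P W) := by
  rintro Y ⟨Z, hZ, hl⟩
  exact (IsCenteredGaussian.of_tendsto (fun n => hW _ (hZ n)) hl).1

namespace IsGaussianSpace

variable {W : Submodule ℝ (Ω → ℝ)}

omit [IsProbabilityMeasure P] in
lemma memLp (hW : IsGaussianSpace P W) {Y : Ω → ℝ} (hY : Y ∈ W) : MemLp Y 2 P :=
  (hW Y hY).law.memLp_two

/-- Polarization, which transfers convergence of variances to covariances. -/
lemma covariance_eq (hW : IsGaussianSpace P W) {Y Z : Ω → ℝ} (hY : Y ∈ W) (hZ : Z ∈ W) :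
    cov[Y, Z; P] = (Var[Y + Z; P] - Var[Y - Z; P]) / 4 := by
  rw [variance_add (hW.memLp hY) (hW.memLp hZ), variance_sub (hW.memLp hY) (hW.memLp hZ)]
  ring

lemma tendsto_covariance (hW : IsGaussianSpace P W) {Y : ℕ → Ω → ℝ} {Z V : Ω → ℝ}
    (hY : ∀ n, Y n ∈ W) (hZ : Z ∈ W) (hV : V ∈ W)
    (hlim : ∀ᵐ ω ∂P, Tendsto (fun n => Y n ω) atTop (𝓝 (Z ω))) :
    Tendsto (fun n => cov[Y n, V; P]) atTop (𝓝 cov[Z, V; P]) := by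
  rw [hW.covariance_eq hZ hV]
  simp_rw [fun n => hW.covariance_eq (hY n) hV]
  refine Tendsto.div_const (Tendsto.sub ?_ ?_) _
  · refine (IsCenteredGaussian.of_tendsto (fun n => hW _ (W.add_mem (hY n) hV)) ?_).2
    filter_upwards [hlim] with ω h using h.add_const _
  · refine (IsCenteredGaussian.of_tendsto (fun n => hW _ (W.sub_mem (hY n) hV)) ?_).2
    filter_upwards [hlim] with ω h using h.sub_const _

variable {N : ℕ}

lemma tendsto_slope_of_hasDerivAt {g : ℝ → ℝ} {g' : ℝ} (hg : HasDerivAt g g' 0) :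
    Tendsto (fun n : ℕ => ((n : ℝ) + 1) * (g (1 / ((n : ℝ) + 1)) - g 0)) atTop (𝓝 g') := by
  have h1 := hg.tendsto_slope_zero
  have h2 : Tendsto (fun n : ℕ => 1 / ((n : ℝ) + 1)) atTop (𝓝[≠] 0) :=
    tendsto_nhdsWithin_iff.2 ⟨tendsto_one_div_add_atTop_nhds_zero_nat, .of_forall fun n => by
      simp only [Set.mem_compl_iff, Set.mem_singleton_iff]
      positivity⟩
  refine (h1.comp h2).congr fun n => ?_
  simp

omit [IsProbabilityMeasure P] in
lemma mem_aeLimits_of_lineDifferentiableAt {F : E N → Ω → ℝ} (hF : ∀ s, F s ∈ W) {t e : E N}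
    (hd : ∀ᵐ ω ∂P, LineDifferentiableAt ℝ (fun s => F s ω) t e) :
    (fun ω => lineDeriv ℝ (fun s => F s ω) t e) ∈ GaussField.aeLimits P W := by
  refine ⟨fun n => ((n : ℝ) + 1) • (F (t + (1 / ((n : ℝ) + 1)) • e) - F t), fun n =>
    W.smul_mem _ (W.sub_mem (hF _) (hF _)), ?_⟩
  filter_upwards [hd] with ω h
  have := tendsto_slope_of_hasDerivAt h.hasLineDerivAt
  simpa using this

/-- Difference quotients along the steps 1/(n+1) converge almost surely inside a Gaussian space, so
differentiation commutes with the covariance. -/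
lemma covariance_lineDeriv (hW : IsGaussianSpace P W) {F : E N → Ω → ℝ} (hF : ∀ s, F s ∈ W)
    {t e : E N} (hd : ∀ᵐ ω ∂P, LineDifferentiableAt ℝ (fun s => F s ω) t e)
    (hZ : (fun ω => lineDeriv ℝ (fun s => F s ω) t e) ∈ W) {V : Ω → ℝ} (hV : V ∈ W)
    {g : ℝ → ℝ} {g' : ℝ} (hg : HasDerivAt g g' 0)
    (hcov : ∀ᶠ h in 𝓝 (0 : ℝ), cov[F (t + h • e), V; P] = g h) :
    cov[fun ω => lineDeriv ℝ (fun s => F s ω) t e, V; P] = g' := by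
  have h1 : HasDerivAt (fun h : ℝ => cov[F (t + h • e), V; P]) g' 0 :=
    hg.congr_of_eventuallyEq hcov
  have h2 := tendsto_slope_of_hasDerivAt h1
  refine tendsto_nhds_unique (hW.tendsto_covariance
    (Y := fun n : ℕ => ((n : ℝ) + 1) • (F (t + (1 / ((n : ℝ) + 1)) • e) - F t)) (fun n =>
    W.smul_mem _ (W.sub_mem (hF _) (hF _))) hZ hV ?_) (h2.congr fun n => ?_)
  · filter_upwards [hd] with ω h
    have := tendsto_slope_of_hasDerivAt h.hasLineDerivAt
    simpa using this
  · rw [covariance_smul_left, covariance_sub_left (hW.memLp (hF _)) (hW.memLp (hF _))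
      (hW.memLp hV)]
    simp

end IsGaussianSpace

end CenteredGaussian

/-! ### Derivatives of the covariance function -/

section Radial

variable {N : ℕ} {ρ : ℝ → ℝ} {ε : ℝ}

/-- `ρ` is five times differentiable on `[0, ε)`. -/
def SmoothNear (ρ : ℝ → ℝ) (ε : ℝ) : Prop :=
  ∀ k < 5, ∀ x ∈ Set.Ico (0 : ℝ) ε,
    HasDerivWithinAt (rhoDeriv ρ k) (rhoDeriv ρ (k + 1) x) (Set.Ici 0) x

lemma hasDerivWithinAt_rhoDeriv {k : ℕ} {x : ℝ}
    (h : DifferentiableWithinAt ℝ (rhoDeriv ρ k) (Set.Ici 0) x) :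
    HasDerivWithinAt (rhoDeriv ρ k) (rhoDeriv ρ (k + 1) x) (Set.Ici 0) x := by
  have := h.hasDerivWithinAt
  rwa [rhoDeriv, ← iteratedDerivWithin_succ] at this

/-- The Kronecker symbol. -/
def kd (i j : Fin N) : ℝ := if i = j then 1 else 0

lemma kd_comm (i j : Fin N) : kd i j = kd j i := by simp [kd, eq_comm]

/-- The first partial derivatives of `d ↦ ρ (‖d‖ ^ 2)`. -/
def radial₁ (ρ : ℝ → ℝ) (i : Fin N) (d : E N) : ℝ := 2 * d i * rhoDeriv ρ 1 (‖d‖ ^ 2)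

/-- The second partial derivatives of `d ↦ ρ (‖d‖ ^ 2)`. -/
def radial₂ (ρ : ℝ → ℝ) (i j : Fin N) (d : E N) : ℝ :=
  2 * kd i j * rhoDeriv ρ 1 (‖d‖ ^ 2) + 4 * d i * d j * rhoDeriv ρ 2 (‖d‖ ^ 2)

/-- The third partial derivatives of `d ↦ ρ (‖d‖ ^ 2)`. -/
def radial₃ (ρ : ℝ → ℝ) (i j k : Fin N) (d : E N) : ℝ :=
  4 * (kd i j * d k + kd i k * d j + kd j k * d i) * rhoDeriv ρ 2 (‖d‖ ^ 2) +
    8 * d i * d j * d k * rhoDeriv ρ 3 (‖d‖ ^ 2)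

/-- The fourth partial derivatives of `d ↦ ρ (‖d‖ ^ 2)`. -/
def radial₄ (ρ : ℝ → ℝ) (i j k l : Fin N) (d : E N) : ℝ :=
  4 * (kd i j * kd k l + kd i k * kd j l + kd j k * kd i l) * rhoDeriv ρ 2 (‖d‖ ^ 2) +
    8 * (kd i j * d k * d l + kd i k * d j * d l + kd j k * d i * d l + kd i l * d j * d k +
      kd j l * d i * d k + kd k l * d i * d j) * rhoDeriv ρ 3 (‖d‖ ^ 2) +
    16 * d i * d j * d k * d l * rhoDeriv ρ 4 (‖d‖ ^ 2)

lemma hasDerivAt_coord (d : E N) (i l : Fin N) :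
    HasDerivAt (fun h : ℝ => (d + h • EuclideanSpace.single l (1 : ℝ)) i) (kd i l) 0 := by
  have : (fun h : ℝ => (d + h • EuclideanSpace.single l (1 : ℝ)) i) =
      fun h => d i + h * kd i l := by
    ext h
    simp [kd]
  rw [this]
  simpa using ((hasDerivAt_id (0 : ℝ)).mul_const (kd i l)).const_add (d i)

lemma hasDerivAt_norm_sq (d : E N) (l : Fin N) :
    HasDerivAt (fun h : ℝ => ‖d + h • EuclideanSpace.single l (1 : ℝ)‖ ^ 2) (2 * d l) 0 := by
  simp_rw [EuclideanSpace.real_norm_sq_eq]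
  have h1 := HasDerivAt.fun_sum (u := Finset.univ) fun i _ => (hasDerivAt_coord d i l).fun_pow 2
  refine h1.congr_deriv ?_
  simp [kd]

/-- The chain rule gives a two-sided derivative, even at d = 0, because ‖·‖² takes values in [0, ∞),
where the one-sided derivative suffices. -/
lemma SmoothNear.hasDerivAt (hρ : SmoothNear ρ ε) {k : ℕ} (hk : k < 5) {d : E N}
    (hd : ‖d‖ ^ 2 < ε) (l : Fin N) :
    HasDerivAt (fun h : ℝ => rhoDeriv ρ k (‖d + h • EuclideanSpace.single l (1 : ℝ)‖ ^ 2))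
      (rhoDeriv ρ (k + 1) (‖d‖ ^ 2) * (2 * d l)) 0 :=
  (hρ k hk (‖d‖ ^ 2) ⟨by positivity, hd⟩).comp_hasDerivAt_of_eq 0 (hasDerivAt_norm_sq d l)
    (.of_forall fun h => Set.mem_Ici.2 (sq_nonneg _)) (by simp)

lemma rhoDeriv_zero : rhoDeriv ρ 0 = ρ := iteratedDerivWithin_zero

lemma SmoothNear.hasDerivAt_radial₀ (hρ : SmoothNear ρ ε) {d : E N} (hd : ‖d‖ ^ 2 < ε)
    (i : Fin N) :
    HasDerivAt (fun h : ℝ => ρ (‖d + h • EuclideanSpace.single i (1 : ℝ)‖ ^ 2))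
      (radial₁ ρ i d) 0 := by
  have := hρ.hasDerivAt (k := 0) (by norm_num) hd i
  rw [rhoDeriv_zero] at this
  refine this.congr_deriv ?_
  simp only [radial₁]
  ring

lemma SmoothNear.hasDerivAt_radial₁ (hρ : SmoothNear ρ ε) {d : E N} (hd : ‖d‖ ^ 2 < ε)
    (i j : Fin N) :
    HasDerivAt (fun h : ℝ => radial₁ ρ i (d + h • EuclideanSpace.single j (1 : ℝ)))
      (radial₂ ρ i j d) 0 := by
  have h1 := hρ.hasDerivAt (k := 1) (by norm_num) hd j
  have h2 := ((hasDerivAt_coord d i j).const_mul 2).fun_mul h1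
  refine h2.congr_deriv ?_
  simp only [radial₂, zero_smul, add_zero]
  ring

lemma SmoothNear.hasDerivAt_radial₂ (hρ : SmoothNear ρ ε) {d : E N} (hd : ‖d‖ ^ 2 < ε)
    (i j k : Fin N) :
    HasDerivAt (fun h : ℝ => radial₂ ρ i j (d + h • EuclideanSpace.single k (1 : ℝ)))
      (radial₃ ρ i j k d) 0 := by
  have h1 := hρ.hasDerivAt (k := 1) (by norm_num) hd k
  have h2 := hρ.hasDerivAt (k := 2) (by norm_num) hd k
  have h3 := (h1.const_mul (2 * kd i j)).fun_add
    ((((hasDerivAt_coord d i k).const_mul 4).fun_mul (hasDerivAt_coord d j k)).fun_mul h2)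
  refine h3.congr_deriv ?_
  simp only [radial₃, zero_smul, add_zero]
  ring

lemma SmoothNear.hasDerivAt_radial₃ (hρ : SmoothNear ρ ε) {d : E N} (hd : ‖d‖ ^ 2 < ε)
    (i j k l : Fin N) :
    HasDerivAt (fun h : ℝ => radial₃ ρ i j k (d + h • EuclideanSpace.single l (1 : ℝ)))
      (radial₄ ρ i j k l d) 0 := by
  have h2 := hρ.hasDerivAt (k := 2) (by norm_num) hd l
  have h3 := hρ.hasDerivAt (k := 3) (by norm_num) hd l
  have hi := hasDerivAt_coord d i l
  have hj := hasDerivAt_coord d j l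
  have hk := hasDerivAt_coord d k l
  have h4 := (((((hk.const_mul (kd i j)).fun_add (hj.const_mul (kd i k))).fun_add
    (hi.const_mul (kd j k))).const_mul 4).fun_mul h2).fun_add ((((hi.const_mul 8).fun_mul hj).fun_mul hk).fun_mul h3)
  refine h4.congr_deriv ?_
  simp only [radial₄, zero_smul, add_zero]
  ring

lemma HasDerivAt.comp_neg_zero {g : ℝ → ℝ} {g' : ℝ} (h : HasDerivAt g g' 0) :
    HasDerivAt (fun x => g (-x)) (-g') 0 := by
  have := HasDerivAt.comp_of_eq (0 : ℝ) h (hasDerivAt_neg (0 : ℝ)) (by simp)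
  simpa [Function.comp_def] using this

end Radial

/-! ### Covariances of the field and its derivatives up to second order. -/

section Covariances

variable {Ω : Type*} [MeasurableSpace Ω] {P : Measure Ω} [IsProbabilityMeasure P] {N : ℕ}
  {X : E N → Ω → ℝ} {ρ : ℝ → ℝ} {ε : ℝ}

omit [IsProbabilityMeasure P] in
lemma IsQualified.isGaussianSpace_span (hX : IsQualified P X ρ) :
    IsGaussianSpace P (Submodule.span ℝ (Set.range X)) := by
  intro Y hY
  obtain ⟨c, rfl⟩ := Finsupp.mem_span_range_iff_exists_finsupp.1 hY
  constructor
  · have h1 := (hX.gaussian.hasGaussianLaw c.support).map_fun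
      (LinearMap.toContinuousLinearMap
        (dotProductBilin ℝ ℝ (fun i : c.support => c i) : (c.support → ℝ) →ₗ[ℝ] ℝ))
    have h2 : (c.sum fun t a => a • X t) = fun ω => ∑ t : c.support, c t * X t ω := by
      ext ω
      simp only [Finsupp.sum, Finset.sum_apply, Pi.smul_apply, smul_eq_mul]
      exact (Finset.sum_coe_sort c.support fun t => c t * X t ω).symm
    rw [h2]
    exact h1
  · simp only [Finsupp.sum, Finset.sum_apply, Pi.smul_apply]
    rw [integral_finsetSum]
    · simp [integral_const_mul, hX.centered]
    · exact fun t _ => ((hX.gaussian.hasGaussianLaw_eval t).integrable).const_mul _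

/-- The space of centered Gaussian random variables generated by the field and by its derivatives
up to the second order. -/
def fieldSpace (P : Measure Ω) (X : E N → Ω → ℝ) : Submodule ℝ (Ω → ℝ) :=
  aeLimits P (aeLimits P (Submodule.span ℝ (Set.range X)))

namespace IsQualified

lemma isGaussianSpace (hX : IsQualified P X ρ) : IsGaussianSpace P (fieldSpace P X) :=
  hX.isGaussianSpace_span.aeLimits.aeLimits

omit [IsProbabilityMeasure P] in
lemma val_mem (t : E N) : X t ∈ fieldSpace P X :=
  le_aeLimits _ (le_aeLimits _ (Submodule.subset_span ⟨t, rfl⟩))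

omit [IsProbabilityMeasure P] in
lemma grad_mem_aeLimits (hX : IsQualified P X ρ) (t : E N) (i : Fin N) :
    grad X t i ∈ aeLimits P (Submodule.span ℝ (Set.range X)) :=
  IsGaussianSpace.mem_aeLimits_of_lineDifferentiableAt
    (F := X) (fun s => Submodule.subset_span (Set.mem_range_self s))
    (hX.partials.mono fun _ h => (h t i i).1)

omit [IsProbabilityMeasure P] in
lemma grad_mem (hX : IsQualified P X ρ) (t : E N) (i : Fin N) : grad X t i ∈ fieldSpace P X :=
  le_aeLimits _ (hX.grad_mem_aeLimits t i)

omit [IsProbabilityMeasure P] in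
lemma secondDeriv_mem (hX : IsQualified P X ρ) (t : E N) (i j : Fin N) :
    secondDeriv X t i j ∈ fieldSpace P X :=
  IsGaussianSpace.mem_aeLimits_of_lineDifferentiableAt
    (fun s => hX.grad_mem_aeLimits s i) (hX.partials.mono fun _ h => (h t i j).2)

lemma covariance_grad (hX : IsQualified P X ρ) {t : E N} {i : Fin N} {V : Ω → ℝ}
    (hV : V ∈ fieldSpace P X) {g : ℝ → ℝ} {g' : ℝ} (hg : HasDerivAt g g' 0)
    (hcov : ∀ᶠ h in 𝓝 (0 : ℝ), cov[X (t + h • EuclideanSpace.single i 1), V; P] = g h) :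
    cov[grad X t i, V; P] = g' :=
  hX.isGaussianSpace.covariance_lineDeriv val_mem (hX.partials.mono fun _ h => (h t i i).1)
    (hX.grad_mem t i) hV hg hcov

lemma covariance_secondDeriv (hX : IsQualified P X ρ) {t : E N} {i j : Fin N} {V : Ω → ℝ}
    (hV : V ∈ fieldSpace P X) {g : ℝ → ℝ} {g' : ℝ} (hg : HasDerivAt g g' 0)
    (hcov : ∀ᶠ h in 𝓝 (0 : ℝ), cov[grad X (t + h • EuclideanSpace.single j 1) i, V; P] = g h) :
    cov[secondDeriv X t i j, V; P] = g' :=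
  hX.isGaussianSpace.covariance_lineDeriv (fun s => hX.grad_mem s i)
    (hX.partials.mono fun _ h => (h t i j).2) (hX.secondDeriv_mem t i j) hV hg hcov

lemma eventually_near {d v : E N} (h : ‖d‖ ^ 2 < ε) :
    ∀ᶠ x in 𝓝 (0 : ℝ), ‖d + x • v‖ ^ 2 < ε := by
  have hc : Continuous fun x : ℝ => ‖d + x • v‖ ^ 2 := by fun_prop
  exact hc.continuousAt.eventually_mem (gt_mem_nhds (by simpa using h))

lemma eventually_near_neg {d v : E N} (h : ‖d‖ ^ 2 < ε) :
    ∀ᶠ x in 𝓝 (0 : ℝ), ‖d + -x • v‖ ^ 2 < ε := by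
  have hc : Continuous fun x : ℝ => ‖d + -x • v‖ ^ 2 := by fun_prop
  exact hc.continuousAt.eventually_mem (gt_mem_nhds (by simpa using h))

variable (hX : IsQualified P X ρ) (hρ : SmoothNear ρ ε)
include hX hρ

/-- The minus sign comes from differentiating in s a function of t - s; each derivative at s
contributes one. -/
lemma cov_grad_val {s t : E N} (h : ‖t - s‖ ^ 2 < ε) (i : Fin N) :
    cov[grad X s i, X t; P] = -radial₁ ρ i (t - s) := by
  refine hX.covariance_grad (val_mem t) (HasDerivAt.comp_neg_zero (hρ.hasDerivAt_radial₀ h i))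
    (.of_forall fun x => ?_)
  rw [hX.isotropic]
  congr 3
  module

lemma cov_grad_grad {s t : E N} (h : ‖t - s‖ ^ 2 < ε) (i j : Fin N) :
    cov[grad X s i, grad X t j; P] = -radial₂ ρ i j (t - s) := by
  rw [covariance_comm]
  refine hX.covariance_grad (hX.grad_mem s i) (hρ.hasDerivAt_radial₁ h i j).neg ?_
  filter_upwards [eventually_near h] with x hx
  have e : t + x • EuclideanSpace.single j (1 : ℝ) - s =
    t - s + x • EuclideanSpace.single j (1 : ℝ) := by module
  rw [covariance_comm, hX.cov_grad_val hρ (by rwa [e]), e]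
  rfl

lemma cov_second_val {s t : E N} (h : ‖t - s‖ ^ 2 < ε) (i j : Fin N) :
    cov[secondDeriv X s i j, X t; P] = radial₂ ρ i j (t - s) := by
  refine (hX.covariance_secondDeriv (val_mem t)
    (HasDerivAt.comp_neg_zero (hρ.hasDerivAt_radial₁ h i j)).neg ?_).trans (neg_neg _)
  filter_upwards [eventually_near_neg h] with x hx
  have e : t - (s + x • EuclideanSpace.single j (1 : ℝ)) =
    t - s + -x • EuclideanSpace.single j (1 : ℝ) := by module
  rw [hX.cov_grad_val hρ (by rwa [e]), e]
  rfl

lemma cov_second_grad {s t : E N} (h : ‖t - s‖ ^ 2 < ε) (i j k : Fin N) :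
    cov[secondDeriv X s i j, grad X t k; P] = radial₃ ρ i j k (t - s) := by
  rw [covariance_comm]
  refine hX.covariance_grad (hX.secondDeriv_mem s i j) (hρ.hasDerivAt_radial₂ h i j k) ?_
  filter_upwards [eventually_near h] with x hx
  have e : t + x • EuclideanSpace.single k (1 : ℝ) - s =
    t - s + x • EuclideanSpace.single k (1 : ℝ) := by module
  rw [covariance_comm, hX.cov_second_val hρ (by rwa [e]), e]

lemma cov_second_second {s t : E N} (h : ‖t - s‖ ^ 2 < ε) (i j k l : Fin N) :
    cov[secondDeriv X s i j, secondDeriv X t k l; P] = radial₄ ρ i j k l (t - s) := by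
  rw [covariance_comm]
  refine hX.covariance_secondDeriv (hX.secondDeriv_mem s i j)
    (hρ.hasDerivAt_radial₃ h i j k l) ?_
  filter_upwards [eventually_near h] with x hx
  have e : t + x • EuclideanSpace.single l (1 : ℝ) - s =
    t - s + x • EuclideanSpace.single l (1 : ℝ) := by module
  rw [covariance_comm, hX.cov_second_grad hρ (by rwa [e]), e]

end IsQualified

end Covariances

/-- The quadratic form at e_i + v e_j; v is later taken so as to form a regression residual. -/
lemma posDef_two_entries {ι : Type*} [Fintype ι] [DecidableEq ι] {M : Matrix ι ι ℝ} (hM : M.PosDef)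
    {i j : ι} (hij : i ≠ j) (v : ℝ) : 0 < M i i + 2 * v * M i j + v ^ 2 * M j j := by
  have h0 : (Pi.single i 1 + Pi.single j v : ι → ℝ) ≠ 0 := by
    intro h
    have := congrFun h i
    simp [hij] at this
  have h1 := hM.dotProduct_mulVec_pos h0
  have h2 : M j i = M i j := by simpa using hM.isHermitian.apply i j
  simp [Matrix.mulVec_add, add_dotProduct, dotProduct_add, h2] at h1
  linarith

/-! ### One-sided differentiability of the slope of ρ' at the origin. -/

section Analysis

variable {ρ : ℝ → ℝ} {ε : ℝ}

/-- The quotient `(ρ' x - ρ' 0) / x`, extended continuously to `x = 0`. -/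
def rhoSlope (ρ : ℝ → ℝ) (x : ℝ) : ℝ :=
  if x = 0 then rhoDeriv ρ 2 0 else (rhoDeriv ρ 1 x - rhoDeriv ρ 1 0) / x

lemma rhoSlope_zero : rhoSlope ρ 0 = rhoDeriv ρ 2 0 := by simp [rhoSlope]

lemma rhoDeriv_one_eq (x : ℝ) : rhoDeriv ρ 1 x = rhoDeriv ρ 1 0 + x * rhoSlope ρ x := by
  by_cases h : x = 0
  · simp [h]
  · simp only [rhoSlope, h, if_false]
    field_simp
    ring

lemma SmoothNear.hasDerivWithinAt_zero (hρ : SmoothNear ρ ε) (hε : 0 < ε) {k : ℕ} (hk : k < 5) :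
    HasDerivWithinAt (rhoDeriv ρ k) (rhoDeriv ρ (k + 1) 0) (Set.Ici 0) 0 :=
  hρ k hk 0 ⟨le_rfl, hε⟩

lemma SmoothNear.hasDerivWithinAt_rhoSlope (hρ : SmoothNear ρ ε) (hε : 0 < ε) :
    HasDerivWithinAt (rhoSlope ρ) (rhoDeriv ρ 3 0 / 2) (Set.Ici 0) 0 := by
  rw [hasDerivWithinAt_iff_isLittleO, isLittleO_iff]
  intro c hc
  have h2 := (hρ.hasDerivWithinAt_zero hε (k := 2) (by norm_num))
  rw [hasDerivWithinAt_iff_isLittleO, isLittleO_iff] at h2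
  obtain ⟨η, hη, h3⟩ := Metric.eventually_nhds_iff.1 (eventually_nhdsWithin_iff.1 (h2 hc))
  have h4 : ∀ᶠ x in 𝓝 (0 : ℝ), dist x 0 < min η ε :=
    Metric.eventually_nhds_iff.2 ⟨min η ε, lt_min hη hε, fun _ h => h⟩
  filter_upwards [self_mem_nhdsWithin, h4.filter_mono nhdsWithin_le_nhds] with x hx0 hx
  rw [Real.dist_0_eq_abs, abs_of_nonneg hx0, lt_min_iff] at hx
  rcases eq_or_lt_of_le (Set.mem_Ici.1 hx0) with rfl | hx0
  · simp
  have h5 : ∀ y ∈ Set.Icc 0 x, HasDerivWithinAt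
      (fun y => rhoDeriv ρ 1 y - (rhoDeriv ρ 2 0 * y + rhoDeriv ρ 3 0 / 2 * y ^ 2))
      (rhoDeriv ρ 2 y - (rhoDeriv ρ 2 0 + rhoDeriv ρ 3 0 * y)) (Set.Icc 0 x) y := by
    intro y hy
    have h6 := (hρ 1 (by norm_num) y ⟨hy.1, hy.2.trans_lt hx.2⟩).mono
      (Set.Icc_subset_Ici_self : Set.Icc 0 x ⊆ Set.Ici 0)
    have h7 := ((hasDerivWithinAt_id y (Set.Icc 0 x)).const_mul (rhoDeriv ρ 2 0)).fun_add
      (((hasDerivWithinAt_id y (Set.Icc 0 x)).fun_pow 2).const_mul (rhoDeriv ρ 3 0 / 2))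
    refine (h6.fun_sub h7).congr_deriv ?_
    simp
    ring
  -- The mean value inequality on [0, x], with derivative bounded by c x, gives a second-order
  -- Taylor remainder of ρ' of size at most c x².
  have h8 := Convex.norm_image_sub_le_of_norm_hasDerivWithin_le (C := c * x) h5 (fun y hy => by
    have := h3 (y := y) (by
      rw [Real.dist_0_eq_abs, abs_of_nonneg hy.1]
      exact hy.2.trans_lt hx.1) hy.1
    simp only [sub_zero, smul_eq_mul, Real.norm_eq_abs] at this ⊢
    rw [abs_of_nonneg hy.1] at this
    calc _ = |rhoDeriv ρ 2 y - rhoDeriv ρ 2 0 - y * rhoDeriv ρ (2 + 1) 0| := by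
          congr 1
          ring
      _ ≤ c * y := this
      _ ≤ c * x := by gcongr; exact hy.2) (convex_Icc 0 x) (Set.left_mem_Icc.2 hx0.le)
    (Set.right_mem_Icc.2 hx0.le)
  simp only [sub_zero, smul_eq_mul, Real.norm_eq_abs, rhoSlope_zero, abs_of_pos hx0] at h8 ⊢
  have h9 : rhoSlope ρ x - rhoDeriv ρ 2 0 - x * (rhoDeriv ρ 3 0 / 2) = (rhoDeriv ρ 1 x -
      (rhoDeriv ρ 2 0 * x + rhoDeriv ρ 3 0 / 2 * x ^ 2) - (rhoDeriv ρ 1 0 -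
      (rhoDeriv ρ 2 0 * 0 + rhoDeriv ρ 3 0 / 2 * 0 ^ 2))) / x := by
    simp only [rhoSlope, hx0.ne', if_false]
    field_simp
    ring
  rw [h9, abs_div, abs_of_pos hx0, div_le_iff₀ hx0]
  exact h8

end Analysis

/-! ### Signs and inequalities for the derivatives of ρ at 0. -/

section Constants

variable {Ω : Type*} [MeasurableSpace Ω] {P : Measure Ω} {N : ℕ} {X : E N → Ω → ℝ} {ρ : ℝ → ℝ}
  {ε : ℝ}

namespace IsQualified

lemma exists_smoothNear (hX : IsQualified P X ρ) : ∃ ε > 0, SmoothNear ρ ε := by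
  obtain ⟨⟨δ, hδ, h⟩, -⟩ := hX.sixth_deriv
  exact ⟨δ, hδ, fun k hk x hx => hasDerivWithinAt_rhoDeriv (h k hk x hx)⟩

variable [IsProbabilityMeasure P] (hX : IsQualified P X ρ) (hρ : SmoothNear ρ ε) (hε : 0 < ε)
include hX hρ hε

lemma cov_grad_grad_self (t : E N) (i j : Fin N) :
    cov[grad X t i, grad X t j; P] = -(2 * kd i j * rhoDeriv ρ 1 0) := by
  rw [hX.cov_grad_grad hρ (by simpa)]
  simp [radial₂]

lemma cov_second_second_self (t : E N) (i j k l : Fin N) :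
    cov[secondDeriv X t i j, secondDeriv X t k l; P] =
      4 * (kd i j * kd k l + kd i k * kd j l + kd j k * kd i l) * rhoDeriv ρ 2 0 := by
  rw [hX.cov_second_second hρ (by simpa)]
  simp [radial₄]

lemma cov_second_val_self (t : E N) (i j : Fin N) :
    cov[secondDeriv X t i j, X t; P] = 2 * kd i j * rhoDeriv ρ 1 0 := by
  rw [hX.cov_second_val hρ (by simpa)]
  simp [radial₂]

lemma rhoDeriv_one_neg : rhoDeriv ρ 1 0 < 0 := by
  have h2 := hX.two_le
  let i : Fin N := ⟨0, by omega⟩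
  have ht : (EuclideanSpace.single i (1 : ℝ)) ≠ 0 := by
    simp
  have h := (hX.nondegenerate _ ht).diag_pos (i := Sum.inr (Sum.inl i))
  simp only [covMat, Matrix.of_apply, Sum.elim_inr, gradVec, Sum.elim_inl] at h
  rw [hX.cov_grad_grad_self hρ hε] at h
  simp only [kd, if_true] at h
  linarith

lemma rhoDeriv_two_pos : 0 < rhoDeriv ρ 2 0 := by
  have h2 := hX.two_le
  let i : Fin N := ⟨0, by omega⟩
  have ht : (EuclideanSpace.single i (1 : ℝ)) ≠ 0 := by
    simp
  have h := (hX.nondegenerate _ ht).diag_pos (i := Sum.inl (Sum.inl ⟨(i, i), le_rfl⟩))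
  simp only [covMat, Matrix.of_apply, valueVec, Sum.elim_inl] at h
  rw [hX.cov_second_second_self hρ hε] at h
  simp only [kd, if_true] at h
  linarith

lemma sq_rhoDeriv_one_lt : rhoDeriv ρ 1 0 ^ 2 < 3 * rhoDeriv ρ 2 0 := by
  have h2 := hX.two_le
  let i : Fin N := ⟨0, by omega⟩
  have ht : (EuclideanSpace.single i (1 : ℝ)) ≠ 0 := by
    simp
  have hc := hX.rhoDeriv_two_pos hρ hε
  have h := posDef_two_entries (hX.nondegenerate _ ht)
    (i := Sum.inl (Sum.inl ⟨(i, i), le_rfl⟩)) (j := Sum.inl (Sum.inr 0)) (by simp)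
    -- With this coefficient the combination is a multiple of the residual of X after regression on
    -- X_ii, whose variance is 1 - ρ'(0)²/(3ρ''(0)).
    (-(6 * rhoDeriv ρ 2 0) / rhoDeriv ρ 1 0)
  simp only [covMat, Matrix.of_apply, valueVec, Sum.elim_inl, Sum.elim_inr,
    Matrix.cons_val_zero] at h
  rw [hX.cov_second_second_self hρ hε, hX.cov_second_val_self hρ hε, hX.isotropic, sub_self] at h
  have hm := (hX.rhoDeriv_one_neg hρ hε).ne
  simp only [kd, if_true, norm_zero, ne_eq, OfNat.ofNat_ne_zero, not_false_eq_true, zero_pow,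
    hX.unit_variance] at h
  have h3 : 0 < 12 * rhoDeriv ρ 2 0 * (3 * rhoDeriv ρ 2 0 - rhoDeriv ρ 1 0 ^ 2) := by
    have := mul_pos h (sq_pos_of_ne_zero hm)
    refine this.trans_eq ?_
    field_simp
    ring
  have := (pos_iff_pos_of_mul_pos h3).1 (by linarith)
  linarith

-- On the axis, with x = h², the fourth derivative is 12ρ''(x) + 48xρ'''(x) + 16x²ρ''''(x); the
-- limit is (-24 - 96)ρ'''(0). It is the variance of X_111.
omit hX in
lemma tendsto_radial₄_single (o : Fin N) :
    Tendsto (fun h : ℝ => (h⁻¹) ^ 2 * (2 * (12 * rhoDeriv ρ 2 0) -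
      2 * radial₄ ρ o o o o (EuclideanSpace.single o h))) (𝓝[≠] 0) (𝓝 (-120 * rhoDeriv ρ 3 0)) := by
  have hx : Tendsto (fun h : ℝ => h ^ 2) (𝓝[≠] 0) (𝓝[>] 0) := by
    refine tendsto_nhdsWithin_iff.2 ⟨?_, ?_⟩
    · have : Tendsto (fun h : ℝ => h ^ 2) (𝓝 0) (𝓝 (0 ^ 2)) := (continuous_pow 2).tendsto 0
      simpa using this.mono_left nhdsWithin_le_nhds
    · filter_upwards [self_mem_nhdsWithin] with h hh
      exact sq_pos_of_ne_zero hh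
  have hsub : 𝓝[>] (0 : ℝ) ≤ 𝓝[≥] 0 := nhdsWithin_mono _ Set.Ioi_subset_Ici_self
  have h2 := ((hρ.hasDerivWithinAt_zero hε (k := 2) (by norm_num)).mono
    Set.Ioi_subset_Ici_self)
  rw [hasDerivWithinAt_iff_tendsto_slope' (by simp)] at h2
  have h3 := (hρ.hasDerivWithinAt_zero hε (k := 3) (by norm_num)).continuousWithinAt.tendsto
  have h4 := (hρ.hasDerivWithinAt_zero hε (k := 4) (by norm_num)).continuousWithinAt.tendsto
  have hid : Tendsto (fun x : ℝ => x) (𝓝[>] 0) (𝓝 0) := nhdsWithin_le_nhds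
  have h5 := ((h2.const_mul (-24)).add ((h3.mono_left hsub).const_mul (-96))).add
    ((hid.mul (h4.mono_left hsub)).const_mul (-32))
  have h6 := h5.comp hx
  have e : -24 * rhoDeriv ρ (2 + 1) 0 + -96 * rhoDeriv ρ 3 0 + -32 * (0 * rhoDeriv ρ 4 0) =
    -120 * rhoDeriv ρ 3 0 := by ring
  rw [e] at h6
  refine h6.congr' ?_
  filter_upwards [self_mem_nhdsWithin] with h hh
  have hh : h ≠ 0 := hh
  simp [radial₄, kd, slope_def_field]
  field_simp
  ring

/-- The quantity is the variance of X_111(0) conditional on the first component of ∇X(0). It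
reappears, divided by 4, as the variance of M_oo in the limit. -/
lemma third_variance_pos : 0 < -120 * rhoDeriv ρ 3 0 -
    144 * rhoDeriv ρ 2 0 ^ 2 / (-2 * rhoDeriv ρ 1 0) := by
  have hm := hX.rhoDeriv_one_neg hρ hε
  obtain ⟨Z, ⟨hZ2, hZ⟩, hpos⟩ := hX.nondegenerate_third
  set o : Fin N := ⟨0, _⟩ with ho
  set A : ℝ → Ω → ℝ := fun h ω => h⁻¹ * (secondDeriv X (0 + h • EuclideanSpace.single o 1) o o ω -
    secondDeriv X 0 o o ω) with hA
  have hAm : ∀ h, A h ∈ fieldSpace P X := fun h => (fieldSpace P X).smul_mem _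
    ((fieldSpace P X).sub_mem (hX.secondDeriv_mem _ _ _) (hX.secondDeriv_mem _ _ _))
  have hG := hX.isGaussianSpace
  -- Mean square convergence yields an almost surely convergent sequence, which brings the third
  -- derivative under the Gaussian-limit lemmas.
  obtain ⟨h, hh, hlim⟩ := (tendstoInMeasure_of_tendsto_eLpNorm (by norm_num)
    (fun h => (hG.memLp (hAm h)).1) hZ2.1 hZ).exists_seq_tendsto_ae'
  have hh0 : Tendsto h atTop (𝓝 0) := hh.mono_right nhdsWithin_le_nhds
  have hne : ∀ᶠ n in atTop, h n ≠ 0 := hh.eventually self_mem_nhdsWithin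
  have hsmall : ∀ᶠ n in atTop, ‖EuclideanSpace.single o (h n)‖ ^ 2 < ε := by
    have : Tendsto (fun n => ‖EuclideanSpace.single o (h n)‖ ^ 2) atTop (𝓝 0) := by
      simpa using hh0.norm.pow 2
    exact this.eventually_lt_const hε
  have hs : ∀ x : ℝ, (0 : E N) + x • EuclideanSpace.single o (1 : ℝ) =
      EuclideanSpace.single o x := fun x => by
    ext i
    simp
  have hZm : Z ∈ aeLimits P (fieldSpace P X) := ⟨fun n => A (h n), fun n => hAm _, hlim⟩
  have hvar : Var[Z; P] = -120 * rhoDeriv ρ 3 0 := by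
    refine tendsto_nhds_unique (IsCenteredGaussian.of_tendsto (fun n => hG _ (hAm (h n))) hlim).2 ?_
    refine ((tendsto_radial₄_single hρ hε o).comp hh).congr' ?_
    filter_upwards [hsmall] with n hn
    have hB := hG.memLp (hX.secondDeriv_mem (EuclideanSpace.single o (h n)) o o)
    have hC := hG.memLp (hX.secondDeriv_mem 0 o o)
    simp only [hA, hs, Function.comp_def]
    rw [variance_const_mul, variance_fun_sub hB hC, ← covariance_self hB.aemeasurable,
      ← covariance_self hC.aemeasurable, hX.cov_second_second_self hρ hε,
      hX.cov_second_second_self hρ hε, covariance_comm, hX.cov_second_second hρ (by simpa using hn)]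
    simp only [sub_zero, kd, if_true]
    ring
  have hcov : cov[Z, grad X 0 o; P] = -12 * rhoDeriv ρ 2 0 := by
    refine tendsto_nhds_unique (hG.aeLimits.tendsto_covariance (fun n => le_aeLimits _ (hAm (h n)))
      hZm (le_aeLimits _ (hX.grad_mem 0 o)) hlim) ?_
    have h2 := (hρ.hasDerivWithinAt_zero hε (k := 2) (by norm_num)).continuousWithinAt.tendsto
    have h3 := (hρ.hasDerivWithinAt_zero hε (k := 3) (by norm_num)).continuousWithinAt.tendsto
    have hsq : Tendsto (fun n => h n ^ 2) atTop (𝓝[≥] 0) := tendsto_nhdsWithin_iff.2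
      ⟨by simpa using hh0.pow 2, .of_forall fun n => Set.mem_Ici.2 (sq_nonneg _)⟩
    have h4 := ((h2.comp hsq).const_mul (-12)).add
      (((hh0.pow 2).mul (h3.comp hsq)).const_mul (-8))
    simp only [ne_eq, OfNat.ofNat_ne_zero, not_false_eq_true, zero_pow, zero_mul, mul_zero,
      add_zero] at h4
    refine h4.congr' ?_
    filter_upwards [hsmall, hne] with n hn hn0
    have hB := hG.memLp (hX.secondDeriv_mem (EuclideanSpace.single o (h n)) o o)
    have hC := hG.memLp (hX.secondDeriv_mem 0 o o)
    have hD := hG.memLp (hX.grad_mem 0 o)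
    simp only [hA, hs, Function.comp_def]
    rw [covariance_const_mul_left, covariance_fun_sub_left hB hC hD,
      hX.cov_second_grad hρ (by simpa using hn), hX.cov_second_grad hρ (by simpa using hε)]
    simp [radial₃, kd]
    field_simp
    ring
  -- The coefficient is minus covariance over variance, so the combination is the residual of the
  -- regression on X_1(0).
  have h := posDef_two_entries hpos (i := Sum.inl 0) (j := Sum.inr o) (by simp)
    (12 * rhoDeriv ρ 2 0 / (-2 * rhoDeriv ρ 1 0))
  simp only [covMat, Matrix.of_apply, Sum.elim_inl, Sum.elim_inr] at h
  rw [covariance_self hZ2.1.aemeasurable, hvar, hcov, hX.cov_grad_grad_self hρ hε] at h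
  refine h.trans_eq ?_
  simp only [kd, if_true]
  field_simp
  ring

end IsQualified

end Constants

/-! ### Conditional covariance matrices as Schur complements. -/

section Conditional

variable {Ω : Type*} [MeasurableSpace Ω] {P : Measure Ω}

/-- A Schur complement does not depend on the basis chosen for the conditioning variables; here T
brings their covariance to the convenient form W. -/
lemma conj_sub_mul_inv_mul {α β γ : Type*} [Fintype α] [Fintype β] [Fintype γ] [DecidableEq γ]
    {A : Matrix α α ℝ} {B : Matrix α γ ℝ} {C T W : Matrix γ γ ℝ} (K : Matrix β α ℝ)
    (hT : T * C * Tᵀ = W) (hW : IsUnit W.det) :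
    K * (A - B * C⁻¹ * Bᵀ) * Kᵀ =
      K * A * Kᵀ - (K * B * Tᵀ) * W⁻¹ * (K * B * Tᵀ)ᵀ := by
  have h1 : C⁻¹ = Tᵀ * W⁻¹ * T := by
    refine Matrix.inv_eq_left_inv ?_
    have h2 : (W⁻¹ * T * C) * Tᵀ = 1 := by
      rw [Matrix.mul_assoc W⁻¹, Matrix.mul_assoc W⁻¹, hT, Matrix.nonsing_inv_mul _ hW]
    rw [mul_eq_one_comm] at h2
    simpa only [Matrix.mul_assoc] using h2
  rw [h1]
  simp only [Matrix.mul_sub, Matrix.sub_mul, Matrix.transpose_mul, Matrix.transpose_transpose,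
    Matrix.mul_assoc]

lemma covMat_transpose {ι κ : Type*} (Y : ι → Ω → ℝ) (Z : κ → Ω → ℝ) :
    (covMat P Y Z)ᵀ = covMat P Z Y := by
  ext i j
  exact covariance_comm _ _

lemma covMat_mulVec_left [IsFiniteMeasure P] {ι κ η : Type*} [Fintype κ] {Y : κ → Ω → ℝ}
    {Z : η → Ω → ℝ} (A : Matrix ι κ ℝ) (hY : ∀ i, MemLp (Y i) 2 P) (hZ : ∀ i, MemLp (Z i) 2 P) :
    covMat P (fun i ω => ∑ j, A i j * Y j ω) Z = A * covMat P Y Z := by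
  ext i k
  simp only [covMat, Matrix.of_apply, Matrix.mul_apply]
  rw [covariance_fun_sum_left (fun j => (hY j).const_mul _) (hZ k)]
  simp only [covariance_const_mul_left]

lemma covMat_mulVec_right [IsFiniteMeasure P] {ι κ η : Type*} [Fintype κ] {Y : κ → Ω → ℝ}
    {Z : η → Ω → ℝ} (A : Matrix ι κ ℝ) (hY : ∀ i, MemLp (Y i) 2 P) (hZ : ∀ i, MemLp (Z i) 2 P) :
    covMat P Z (fun i ω => ∑ j, A i j * Y j ω) = covMat P Z Y * Aᵀ := by
  rw [← covMat_transpose, covMat_mulVec_left A hY hZ, Matrix.transpose_mul, covMat_transpose]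

lemma memLp_mulVec {ι κ : Type*} [Fintype κ] {Y : κ → Ω → ℝ}
    (A : Matrix ι κ ℝ) (hY : ∀ i, MemLp (Y i) 2 P) (i : ι) :
    MemLp (fun ω => ∑ j, A i j * Y j ω) 2 P :=
  memLp_finsetSum _ fun j _ => (hY j).const_mul _

variable {N : ℕ} {X : E N → Ω → ℝ}

/-- With uncorrelated conditioning variables G the inverse matrix becomes a sum over b of regression
terms. -/
lemma condCov_conj_apply [IsFiniteMeasure P] {t : E N} {β : Type*} [Fintype β]
    (hV : ∀ i, MemLp (valueVec X t i) 2 P) (hG : ∀ i, MemLp (gradVec X t i) 2 P)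
    (K : Matrix β (UpperIdx N ⊕ Fin 2) ℝ) (T : Matrix (Fin N ⊕ Fin N) (Fin N ⊕ Fin N) ℝ)
    {w : Fin N ⊕ Fin N → ℝ} (hw : ∀ b, w b ≠ 0) {Y : β → Ω → ℝ} {G : Fin N ⊕ Fin N → Ω → ℝ}
    (hY : Y = fun i ω => ∑ j, K i j * valueVec X t j ω)
    (hG' : G = fun i ω => ∑ j, T i j * gradVec X t j ω)
    (hcov : ∀ b c, cov[G b, G c; P] = if b = c then w b else 0) (p q : β) :
    (K * condCov P X t * Kᵀ) p q = cov[Y p, Y q; P] -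
      ∑ b, cov[Y p, G b; P] * cov[Y q, G b; P] / w b := by
  have hT : T * covMat P (gradVec X t) (gradVec X t) * Tᵀ = Matrix.diagonal w := by
    rw [← covMat_mulVec_left T hG hG, ← covMat_mulVec_right T hG (memLp_mulVec T hG), ← hG']
    ext b c
    simp only [covMat, Matrix.of_apply, hcov, Matrix.diagonal_apply]
  have hdet : IsUnit (Matrix.diagonal w).det := by
    rw [Matrix.det_diagonal]
    exact (Finset.prod_ne_zero_iff.2 fun b _ => hw b).isUnit
  rw [condCov, conj_sub_mul_inv_mul K hT hdet, ← covMat_mulVec_left K hV hV,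
    ← covMat_mulVec_right K hV (memLp_mulVec K hV), ← covMat_mulVec_left K hV hG,
    ← covMat_mulVec_right T hG (memLp_mulVec K hV), ← hY, ← hG']
  have hinv : (Matrix.diagonal w)⁻¹ = Matrix.diagonal fun b => (w b)⁻¹ := by
    refine Matrix.inv_eq_left_inv ?_
    rw [Matrix.diagonal_mul_diagonal]
    simp [hw]
  rw [hinv, Matrix.sub_apply, Matrix.mul_apply]
  simp only [Matrix.mul_diagonal, covMat, Matrix.of_apply, Matrix.transpose_apply]
  congr 1
  exact Finset.sum_congr rfl fun b _ => by ring

lemma posDef_condCov {t : E N}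
    (h : (covMat P (Sum.elim (valueVec X t) (gradVec X t))
      (Sum.elim (valueVec X t) (gradVec X t))).PosDef) :
    (covMat P (gradVec X t) (gradVec X t)).PosDef ∧ (condCov P X t).PosDef := by
  have hblock : covMat P (Sum.elim (valueVec X t) (gradVec X t))
      (Sum.elim (valueVec X t) (gradVec X t)) = Matrix.fromBlocks
      (covMat P (valueVec X t) (valueVec X t)) (covMat P (valueVec X t) (gradVec X t))
      (covMat P (valueVec X t) (gradVec X t))ᴴ (covMat P (gradVec X t) (gradVec X t)) := by
    rw [Matrix.conjTranspose_eq_transpose_of_trivial, covMat_transpose]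
    ext (i | i) (j | j) <;> rfl
  have hG : (covMat P (gradVec X t) (gradVec X t)).PosDef := by
    have := h.submatrix (e := Sum.inr) Sum.inr_injective
    exact this
  refine ⟨hG, ?_⟩
  have hinst : Invertible (covMat P (gradVec X t) (gradVec X t)) := hG.isUnit.invertible
  rw [hblock] at h
  have h1 := (Matrix.PosDef.fromBlocks₂₂ _ _ hG).1 h.posSemidef
  have h2 := h.det_pos.ne'
  rw [Matrix.det_fromBlocks₂₂, Matrix.invOf_eq_nonsing_inv] at h2
  rw [condCov]
  rw [Matrix.conjTranspose_eq_transpose_of_trivial] at h1 h2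
  exact h1.posDef_iff_isUnit.2 ((Matrix.isUnit_iff_isUnit_det _).2 (right_ne_zero_of_mul h2).isUnit)

end Conditional

/-! ### Derivatives of ρ(‖·‖²) as multilinear forms. -/

section Contraction

variable {N : ℕ} {ρ : ℝ → ℝ}

/-- Applied in one variable at a time, it reduces contractions of the radial derivatives to their
values on basis vectors. -/
lemma sum_mul_single {f : (Fin N → ℝ) → ℝ} (hf : IsLinearMap ℝ f) (v : Fin N → ℝ) :
    ∑ i, v i * f (Pi.single i 1) = f v := by
  conv_rhs => rw [pi_eq_sum_univ' v]
  have := map_sum (hf.mk' f) (fun i => v i • Pi.single i (1 : ℝ)) Finset.univ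
  simp only [IsLinearMap.mk'_apply, hf.map_smul, smul_eq_mul] at this
  rw [← this]

/-- The second derivative of `d ↦ ρ (‖d‖ ^ 2)` along the vectors `u`, `v`. -/
def form₂ (ρ : ℝ → ℝ) (d : E N) (u v : Fin N → ℝ) : ℝ :=
  2 * (u ⬝ᵥ v) * rhoDeriv ρ 1 (‖d‖ ^ 2) + 4 * (u ⬝ᵥ d) * (v ⬝ᵥ d) * rhoDeriv ρ 2 (‖d‖ ^ 2)

/-- The third derivative of `d ↦ ρ (‖d‖ ^ 2)` along the vectors `u`, `v`, `w`. -/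
def form₃ (ρ : ℝ → ℝ) (d : E N) (u v w : Fin N → ℝ) : ℝ :=
  4 * ((u ⬝ᵥ v) * (w ⬝ᵥ d) + (u ⬝ᵥ w) * (v ⬝ᵥ d) + (v ⬝ᵥ w) * (u ⬝ᵥ d)) * rhoDeriv ρ 2 (‖d‖ ^ 2) +
    8 * (u ⬝ᵥ d) * (v ⬝ᵥ d) * (w ⬝ᵥ d) * rhoDeriv ρ 3 (‖d‖ ^ 2)

/-- The fourth derivative of `d ↦ ρ (‖d‖ ^ 2)` at the origin along the vectors `u`, `v`, `w`,
`y`. -/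
def form₄ (ρ : ℝ → ℝ) (u v w y : Fin N → ℝ) : ℝ :=
  4 * ((u ⬝ᵥ v) * (w ⬝ᵥ y) + (u ⬝ᵥ w) * (v ⬝ᵥ y) + (v ⬝ᵥ w) * (u ⬝ᵥ y)) * rhoDeriv ρ 2 0

lemma single_dotProduct_single (i j : Fin N) :
    (Pi.single i 1 : Fin N → ℝ) ⬝ᵥ Pi.single j 1 = kd i j := by
  simp [kd, Pi.single_apply, eq_comm]

lemma sum_mul_radial₁ (d : E N) (u : Fin N → ℝ) :
    ∑ i, u i * radial₁ ρ i d = 2 * (u ⬝ᵥ d) * rhoDeriv ρ 1 (‖d‖ ^ 2) := by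
  simp only [radial₁, dotProduct, Finset.mul_sum, Finset.sum_mul]
  exact Finset.sum_congr rfl fun i _ => by ring

lemma sum_mul_radial₂ (d : E N) (u v : Fin N → ℝ) :
    ∑ i, u i * ∑ j, v j * radial₂ ρ i j d = form₂ ρ d u v := by
  have h1 : ∀ i j, radial₂ ρ i j d = form₂ ρ d (Pi.single i 1) (Pi.single j 1) := fun i j => by
    rw [radial₂, form₂, single_dotProduct_single]
    simp only [single_one_dotProduct]
  simp_rw [h1]
  have h2 : ∀ u, IsLinearMap ℝ fun v => form₂ ρ d u v := fun u =>
    ⟨fun _ _ => by simp only [form₂, add_dotProduct, dotProduct_add]; ring,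
      fun _ _ => by simp only [form₂, smul_dotProduct, dotProduct_smul, smul_eq_mul]; ring⟩
  have h3 : ∀ v, IsLinearMap ℝ fun u => form₂ ρ d u v := fun v =>
    ⟨fun _ _ => by simp only [form₂, add_dotProduct]; ring,
      fun _ _ => by simp only [form₂, smul_dotProduct, smul_eq_mul]; ring⟩
  simp_rw [fun u => sum_mul_single (h2 u) v, sum_mul_single (h3 v)]

lemma sum_mul_radial₃ (d : E N) (u v w : Fin N → ℝ) :
    ∑ i, u i * ∑ j, v j * ∑ k, w k * radial₃ ρ i j k d = form₃ ρ d u v w := by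
  have h1 : ∀ i j k, radial₃ ρ i j k d =
      form₃ ρ d (Pi.single i 1) (Pi.single j 1) (Pi.single k 1) := fun i j k => by
    rw [radial₃, form₃]
    simp only [single_dotProduct_single]
    simp only [single_one_dotProduct]
  simp_rw [h1]
  have h2 : ∀ u v, IsLinearMap ℝ fun w => form₃ ρ d u v w := fun u v =>
    ⟨fun _ _ => by simp only [form₃, add_dotProduct, dotProduct_add]; ring,
      fun _ _ => by simp only [form₃, smul_dotProduct, dotProduct_smul, smul_eq_mul]; ring⟩
  have h3 : ∀ u w, IsLinearMap ℝ fun v => form₃ ρ d u v w := fun u w =>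
    ⟨fun _ _ => by simp only [form₃, add_dotProduct, dotProduct_add]; ring,
      fun _ _ => by simp only [form₃, smul_dotProduct, dotProduct_smul, smul_eq_mul]; ring⟩
  have h4 : ∀ v w, IsLinearMap ℝ fun u => form₃ ρ d u v w := fun v w =>
    ⟨fun _ _ => by simp only [form₃, add_dotProduct]; ring,
      fun _ _ => by simp only [form₃, smul_dotProduct, smul_eq_mul]; ring⟩
  simp_rw [fun u v => sum_mul_single (h2 u v) w, fun u => sum_mul_single (h3 u w) v,
    sum_mul_single (h4 v w)]

lemma sum_mul_radial₄ (u v w y : Fin N → ℝ) :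
    ∑ i, u i * ∑ j, v j * ∑ k, w k * ∑ l, y l * radial₄ ρ i j k l (0 : E N) = form₄ ρ u v w y := by
  have h1 : ∀ i j k l, radial₄ ρ i j k l (0 : E N) =
      form₄ ρ (Pi.single i 1) (Pi.single j 1) (Pi.single k 1) (Pi.single l 1) := fun i j k l => by
    simp only [radial₄, form₄, single_dotProduct_single]
    simp
  simp_rw [h1]
  have h2 : ∀ u v w : Fin N → ℝ, IsLinearMap ℝ fun y => form₄ ρ u v w y := fun u v w =>
    ⟨fun _ _ => by simp only [form₄, dotProduct_add]; ring,
      fun _ _ => by simp only [form₄, dotProduct_smul, smul_eq_mul]; ring⟩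
  have h3 : ∀ u v y : Fin N → ℝ, IsLinearMap ℝ fun w => form₄ ρ u v w y := fun u v y =>
    ⟨fun _ _ => by simp only [form₄, add_dotProduct, dotProduct_add]; ring,
      fun _ _ => by simp only [form₄, smul_dotProduct, dotProduct_smul, smul_eq_mul]; ring⟩
  have h4 : ∀ u w y : Fin N → ℝ, IsLinearMap ℝ fun v => form₄ ρ u v w y := fun u w y =>
    ⟨fun _ _ => by simp only [form₄, add_dotProduct, dotProduct_add]; ring,
      fun _ _ => by simp only [form₄, smul_dotProduct, dotProduct_smul, smul_eq_mul]; ring⟩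
  have h5 : ∀ v w y : Fin N → ℝ, IsLinearMap ℝ fun u => form₄ ρ u v w y := fun v w y =>
    ⟨fun _ _ => by simp only [form₄, add_dotProduct]; ring,
      fun _ _ => by simp only [form₄, smul_dotProduct, smul_eq_mul]; ring⟩
  simp_rw [fun u v w => sum_mul_single (h2 u v w) y, fun u v => sum_mul_single (h3 u v y) w,
    fun u => sum_mul_single (h4 u w y) v, sum_mul_single (h5 v w y)]

end Contraction

/-- The vectors `R a` form an orthonormal basis of `ℝ ^ N` and `R o` is the direction of `t`. -/
structure IsFrame {N : ℕ} (R : Fin N → Fin N → ℝ) (o : Fin N) (t : E N) : Prop where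
  dot : ∀ a b, R a ⬝ᵥ R b = kd a b
  dot_dir : ∀ a, R a ⬝ᵥ t = ‖t‖ * kd a o

lemma exists_isFrame {N : ℕ} (o : Fin N) {t : E N} (ht : t ≠ 0) :
    ∃ R : Fin N → Fin N → ℝ, IsFrame R o t := by
  have hv : Orthonormal ℝ (({o} : Set (Fin N)).domRestrict fun _ => ‖t‖⁻¹ • t) := by
    refine ⟨fun i => ?_, fun i j hij => (hij (Subsingleton.elim i j)).elim⟩
    simp [norm_smul, ht]
  obtain ⟨b, hb⟩ := hv.exists_orthonormalBasis_extension_of_card_eq (by simp)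
  have hbo := hb o rfl
  have hin : ∀ u v : E N, u.ofLp ⬝ᵥ v.ofLp = inner ℝ v u := fun u v => by
    simp [EuclideanSpace.inner_eq_star_dotProduct]
  have horth : ∀ a c, inner ℝ (b a) (b c) = kd a c := fun a c => by
    rw [orthonormal_iff_ite.1 b.orthonormal a c, kd]
  have ht' : t = ‖t‖ • b o := by
    rw [hbo, smul_smul, mul_inv_cancel₀ (norm_ne_zero_iff.2 ht), one_smul]
  refine ⟨fun a => (b a).ofLp, fun a c => ?_, fun a => ?_⟩
  · rw [hin, horth, kd_comm]
  · conv_lhs => rw [ht']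
    rw [hin, inner_smul_left, horth, kd_comm]
    simp

/-! ### Covariances in an orthonormal frame. -/

section Rotated

variable {Ω : Type*} [MeasurableSpace Ω] {P : Measure Ω} {N : ℕ} {X : E N → Ω → ℝ} {ρ : ℝ → ℝ}
  {ε : ℝ}

/-- The entry `(i, j)` of the symmetric matrix whose vectorization is the Hessian. -/
def symHess (X : E N → Ω → ℝ) (t : E N) (i j : Fin N) : Ω → ℝ :=
  secondDeriv X t (min i j) (max i j)

/-- The entries of the Hessian in the frame `R`. -/
def rotHess (X : E N → Ω → ℝ) (R : Fin N → Fin N → ℝ) (t : E N) (a b : Fin N) (ω : Ω) : ℝ :=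
  ∑ i, R a i * ∑ j, R b j * symHess X t i j ω

/-- The entries of the gradient in the frame `R`. -/
def rotGrad (X : E N → Ω → ℝ) (R : Fin N → Fin N → ℝ) (t : E N) (a : Fin N) (ω : Ω) : ℝ :=
  ∑ i, R a i * grad X t i ω

omit [MeasurableSpace Ω] in
lemma sum_mul_mem {W : Submodule ℝ (Ω → ℝ)} {ι : Type*} [Fintype ι] (c : ι → ℝ) {Y : ι → Ω → ℝ}
    (hY : ∀ i, Y i ∈ W) : (fun ω => ∑ i, c i * Y i ω) ∈ W := by
  have h : (fun ω => ∑ i, c i * Y i ω) = ∑ i, c i • Y i := by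
    ext ω
    simp
  rw [h]
  exact W.sum_mem fun i _ => W.smul_mem _ (hY i)

lemma IsGaussianSpace.covariance_sum_mul_left [IsProbabilityMeasure P] {W : Submodule ℝ (Ω → ℝ)}
    (hW : IsGaussianSpace P W) {ι : Type*} [Fintype ι] (c : ι → ℝ) {Y : ι → Ω → ℝ} {V : Ω → ℝ}
    (hY : ∀ i, Y i ∈ W) (hV : V ∈ W) :
    cov[fun ω => ∑ i, c i * Y i ω, V; P] = ∑ i, c i * cov[Y i, V; P] := by
  rw [covariance_fun_sum_left (fun i => (hW.memLp (hY i)).const_mul _) (hW.memLp hV)]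
  simp only [covariance_const_mul_left]

lemma radial₂_min_max (i j : Fin N) (d : E N) :
    radial₂ ρ (min i j) (max i j) d = radial₂ ρ i j d := by
  rcases le_total i j with h | h
  · rw [min_eq_left h, max_eq_right h]
  · rw [min_eq_right h, max_eq_left h]
    simp only [radial₂, kd_comm j i]
    ring

lemma radial₃_min_max (i j k : Fin N) (d : E N) :
    radial₃ ρ (min i j) (max i j) k d = radial₃ ρ i j k d := by
  rcases le_total i j with h | h
  · rw [min_eq_left h, max_eq_right h]
  · rw [min_eq_right h, max_eq_left h]
    simp only [radial₃, kd_comm j i]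
    ring

/-- The order of pathwise differentiation is not known to be immaterial, so the symmetrized Hessian
uses ordered indices; its covariances are symmetric nevertheless. -/
lemma radial₄_min_max (i j k l : Fin N) :
    radial₄ ρ (min i j) (max i j) (min k l) (max k l) (0 : E N) =
      radial₄ ρ i j k l (0 : E N) := by
  rcases le_total i j with h | h <;> rcases le_total k l with h' | h' <;>
    simp only [h, h', min_eq_left, max_eq_right, min_eq_right, max_eq_left, radial₄, kd_comm j i,
      kd_comm l k, PiLp.zero_apply] <;> ring

namespace IsQualified

lemma symHess_mem (hX : IsQualified P X ρ) [IsProbabilityMeasure P] (t : E N) (i j : Fin N) :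
    symHess X t i j ∈ fieldSpace P X := hX.secondDeriv_mem _ _ _

lemma rotHess_mem (hX : IsQualified P X ρ) [IsProbabilityMeasure P] (R : Fin N → Fin N → ℝ)
    (t : E N) (a b : Fin N) : rotHess X R t a b ∈ fieldSpace P X :=
  sum_mul_mem _ fun _ => sum_mul_mem _ fun _ => hX.symHess_mem _ _ _

lemma rotGrad_mem (hX : IsQualified P X ρ) [IsProbabilityMeasure P] (R : Fin N → Fin N → ℝ)
    (t : E N) (a : Fin N) : rotGrad X R t a ∈ fieldSpace P X :=
  sum_mul_mem _ fun _ => hX.grad_mem _ _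

variable [IsProbabilityMeasure P] (hX : IsQualified P X ρ)
include hX

lemma cov_rotHess_left (R : Fin N → Fin N → ℝ) (t : E N) (a b : Fin N) {V : Ω → ℝ}
    (hV : V ∈ fieldSpace P X) :
    cov[rotHess X R t a b, V; P] = ∑ i, R a i * ∑ j, R b j * cov[symHess X t i j, V; P] := by
  refine (hX.isGaussianSpace.covariance_sum_mul_left (R a)
    (fun _ => sum_mul_mem _ fun _ => hX.symHess_mem _ _ _) hV).trans ?_
  refine Finset.sum_congr rfl fun i _ => ?_
  rw [hX.isGaussianSpace.covariance_sum_mul_left (R b) (fun _ => hX.symHess_mem _ _ _) hV]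

lemma cov_rotGrad_left (R : Fin N → Fin N → ℝ) (t : E N) (a : Fin N) {V : Ω → ℝ}
    (hV : V ∈ fieldSpace P X) :
    cov[rotGrad X R t a, V; P] = ∑ i, R a i * cov[grad X t i, V; P] :=
  hX.isGaussianSpace.covariance_sum_mul_left (R a) (fun _ => hX.grad_mem _ _) hV

lemma cov_rotHess_right (R : Fin N → Fin N → ℝ) (t : E N) (a b : Fin N) {V : Ω → ℝ}
    (hV : V ∈ fieldSpace P X) :
    cov[V, rotHess X R t a b; P] = ∑ i, R a i * ∑ j, R b j * cov[V, symHess X t i j; P] := by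
  rw [covariance_comm, hX.cov_rotHess_left R t a b hV]
  simp only [covariance_comm V]

lemma cov_rotGrad_right (R : Fin N → Fin N → ℝ) (t : E N) (a : Fin N) {V : Ω → ℝ}
    (hV : V ∈ fieldSpace P X) :
    cov[V, rotGrad X R t a; P] = ∑ i, R a i * cov[V, grad X t i; P] := by
  rw [covariance_comm, hX.cov_rotGrad_left R t a hV]
  simp only [covariance_comm V]

variable (hρ : SmoothNear ρ ε) (R : Fin N → Fin N → ℝ)
include hρ

lemma cov_rotHess_rotHess (hε : 0 < ε) (t : E N) (a b c d : Fin N) :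
    cov[rotHess X R t a b, rotHess X R t c d; P] = form₄ ρ (R a) (R b) (R c) (R d) := by
  rw [hX.cov_rotHess_left R t a b (hX.rotHess_mem R t c d), ← sum_mul_radial₄]
  simp_rw [hX.cov_rotHess_right R t c d (hX.symHess_mem t _ _)]
  refine Finset.sum_congr rfl fun i _ => congrArg _ <| Finset.sum_congr rfl fun j _ => congrArg _ <|
    Finset.sum_congr rfl fun k _ => congrArg _ <| Finset.sum_congr rfl fun l _ => congrArg _ ?_
  rw [symHess, symHess, hX.cov_second_second hρ (by simpa), sub_self, radial₄_min_max]

lemma cov_rotHess_rotGrad {s t : E N} (h : ‖t - s‖ ^ 2 < ε) (a b c : Fin N) :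
    cov[rotHess X R s a b, rotGrad X R t c; P] = form₃ ρ (t - s) (R a) (R b) (R c) := by
  rw [hX.cov_rotHess_left R s a b (hX.rotGrad_mem R t c), ← sum_mul_radial₃]
  simp_rw [hX.cov_rotGrad_right R t c (hX.symHess_mem s _ _)]
  refine Finset.sum_congr rfl fun i _ => congrArg _ <| Finset.sum_congr rfl fun j _ => congrArg _ <|
    Finset.sum_congr rfl fun k _ => congrArg _ ?_
  rw [symHess, hX.cov_second_grad hρ h, radial₃_min_max]

lemma cov_rotHess_val {s t : E N} (h : ‖t - s‖ ^ 2 < ε) (a b : Fin N) :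
    cov[rotHess X R s a b, X t; P] = form₂ ρ (t - s) (R a) (R b) := by
  rw [hX.cov_rotHess_left R s a b (val_mem t), ← sum_mul_radial₂]
  refine Finset.sum_congr rfl fun i _ => congrArg _ <| Finset.sum_congr rfl fun j _ => congrArg _ ?_
  rw [symHess, hX.cov_second_val hρ h, radial₂_min_max]

lemma cov_rotGrad_rotGrad {s t : E N} (h : ‖t - s‖ ^ 2 < ε) (a b : Fin N) :
    cov[rotGrad X R s a, rotGrad X R t b; P] = -form₂ ρ (t - s) (R a) (R b) := by
  rw [hX.cov_rotGrad_left R s a (hX.rotGrad_mem R t b), ← sum_mul_radial₂]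
  simp_rw [hX.cov_rotGrad_right R t b (hX.grad_mem s _), hX.cov_grad_grad hρ h]
  simp

lemma cov_rotGrad_val {s t : E N} (h : ‖t - s‖ ^ 2 < ε) (a : Fin N) :
    cov[rotGrad X R s a, X t; P] =
      -(2 * (R a ⬝ᵥ (t - s).ofLp) * rhoDeriv ρ 1 (‖t - s‖ ^ 2)) := by
  rw [hX.cov_rotGrad_left R s a (val_mem t), ← sum_mul_radial₁]
  simp_rw [hX.cov_grad_val hρ h]
  simp

end IsQualified

end Rotated

/-! ### Explicit conditional covariances as functions of x = ‖t‖². -/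

section Entries

variable {N : ℕ}

/-- The covariances of `(∇²X(t), X(t), X(0))` in an adapted frame, where `x = ‖t‖ ^ 2`. -/
def baseCov (ρ : ℝ → ℝ) (o : Fin N) : UpperIdx N ⊕ Fin 2 → UpperIdx N ⊕ Fin 2 → ℝ → ℝ
  | .inl p, .inl q, _ => 4 * (kd p.1.1 p.1.2 * kd q.1.1 q.1.2 + kd p.1.1 q.1.1 * kd p.1.2 q.1.2 +
      kd p.1.2 q.1.1 * kd p.1.1 q.1.2) * rhoDeriv ρ 2 0
  | .inl p, .inr i, x => if i = 0 then 2 * kd p.1.1 p.1.2 * rhoDeriv ρ 1 0 else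
      2 * kd p.1.1 p.1.2 * rhoDeriv ρ 1 x + 4 * x * kd p.1.1 o * kd p.1.2 o * rhoDeriv ρ 2 x
  | .inr i, .inl p, x => if i = 0 then 2 * kd p.1.1 p.1.2 * rhoDeriv ρ 1 0 else
      2 * kd p.1.1 p.1.2 * rhoDeriv ρ 1 x + 4 * x * kd p.1.1 o * kd p.1.2 o * rhoDeriv ρ 2 x
  | .inr i, .inr j, x => if i = j then 1 else rhoDeriv ρ 0 x

/-- The covariances of `(∇²X(t), X(t), X(0))` and `∇X(t) - ∇X(0)` in an adapted frame, divided by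
`‖t‖`, where `x = ‖t‖ ^ 2`. -/
def crossCov (ρ : ℝ → ℝ) (o : Fin N) : UpperIdx N ⊕ Fin 2 → Fin N → ℝ → ℝ
  | .inl p, c, x => 4 * (kd p.1.1 p.1.2 * kd c o + kd p.1.1 c * kd p.1.2 o +
      kd p.1.2 c * kd p.1.1 o) * rhoDeriv ρ 2 x +
      8 * x * kd p.1.1 o * kd p.1.2 o * kd c o * rhoDeriv ρ 3 x
  | .inr _, c, x => 2 * kd c o * rhoDeriv ρ 1 x

/-- The ratio of the covariances with the sum and with the difference of the gradients. -/
def crossSign : UpperIdx N ⊕ Fin 2 → ℝ := Sum.elim (fun _ => -1) ![-1, 1]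

/-- Half of the variance of an entry of `∇X(t) - ∇X(0)`, divided by `‖t‖ ^ 2`. -/
def diffVar (ρ : ℝ → ℝ) (o c : Fin N) (x : ℝ) : ℝ := 2 * rhoSlope ρ x + 4 * kd c o * rhoDeriv ρ 2 x

/-- Half of the variance of an entry of `∇X(t) + ∇X(0)`. -/
def sumVar (ρ : ℝ → ℝ) (o c : Fin N) (x : ℝ) : ℝ :=
  -2 * rhoDeriv ρ 1 0 - 2 * rhoDeriv ρ 1 x - 4 * x * kd c o * rhoDeriv ρ 2 x

/-- The entries of the conditional covariance matrix in an adapted frame, as functions of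
`x = ‖t‖ ^ 2`. -/
def condEntry (ρ : ℝ → ℝ) (o : Fin N) (p q : UpperIdx N ⊕ Fin 2) (x : ℝ) : ℝ :=
  baseCov ρ o p q x - ∑ c, crossCov ρ o p c x * crossCov ρ o q c x *
    (1 / (2 * diffVar ρ o c x) + crossSign p * crossSign q * (x / (2 * sumVar ρ o c x)))

/-- The action of `M ↦ S * M * Sᵀ` on the vectorized matrix. -/
def congrMap (S : Matrix (Fin N) (Fin N) ℝ) :
    (UpperIdx N ⊕ Fin 2 → ℝ) →ₗ[ℝ] (UpperIdx N ⊕ Fin 2 → ℝ) where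
  toFun y := Sum.elim (fun p => (S * matri (fun p => y (.inl p)) * Sᵀ) p.1.1 p.1.2)
    fun i => y (.inr i)
  map_add' y z := by
    have h : matri (fun p => (y + z) (.inl p)) =
        matri (fun p => y (.inl p)) + matri (fun p => z (.inl p)) := by
      ext i j
      simp [matri]
    ext (p | i)
    · change (S * matri (fun p => (y + z) (.inl p)) * Sᵀ) _ _ = _
      rw [h, Matrix.mul_add, Matrix.add_mul]
      rfl
    · simp
  map_smul' c y := by
    have h : matri (fun p => (c • y) (.inl p)) = c • matri (fun p => y (.inl p)) := by
      ext i j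
      simp [matri]
    ext (p | i)
    · change (S * matri (fun p => (c • y) (.inl p)) * Sᵀ) _ _ = _
      rw [h, Matrix.mul_smul, Matrix.smul_mul]
      rfl
    · simp

lemma matri_congrMap (S : Matrix (Fin N) (Fin N) ℝ) (y : UpperIdx N ⊕ Fin 2 → ℝ) :
    matri (fun p => congrMap S y (.inl p)) = S * matri (fun p => y (.inl p)) * Sᵀ := by
  have hsymm : (S * matri (fun p => y (.inl p)) * Sᵀ)ᵀ =
      S * matri (fun p => y (.inl p)) * Sᵀ := by
    have := (matri_isHermitian fun p => y (.inl p)).eq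
    rw [Matrix.conjTranspose_eq_transpose_of_trivial] at this
    simp [Matrix.transpose_mul, this, Matrix.mul_assoc]
  ext i j
  change (S * matri (fun p => y (.inl p)) * Sᵀ) (min i j) (max i j) = _
  rcases le_total i j with h | h
  · rw [min_eq_left h, max_eq_right h]
  · rw [min_eq_right h, max_eq_left h]
    exact congrFun (congrFun hsymm i) j

lemma kacRice_congrMap {S : Matrix (Fin N) (Fin N) ℝ} (hS : S.det ≠ 0) (k : ℕ) (u : ℝ)
    (y : UpperIdx N ⊕ Fin 2 → ℝ) :
    kacRice k u (congrMap S y) = S.det ^ 2 * kacRice k u y := by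
  rw [kacRice, kacRice, matri_congrMap, idxDet_congr k _ _ hS, mul_ite, mul_zero]
  rfl

end Entries

/-! ### The conditional covariance matrix in an adapted frame. -/

section Formula

variable {Ω : Type*} [MeasurableSpace Ω] {P : Measure Ω} {N : ℕ} {X : E N → Ω → ℝ} {ρ : ℝ → ℝ}
  {ε : ℝ}

/-- The vector `(∇²X(t), X(t), X(0))`, the Hessian being taken in the frame `R`. -/
def rotVec (X : E N → Ω → ℝ) (R : Fin N → Fin N → ℝ) (t : E N) : UpperIdx N ⊕ Fin 2 → Ω → ℝ :=
  Sum.elim (fun p => rotHess X R t p.1.1 p.1.2) ![X t, X 0]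

/-- The sum and the difference of the gradients at `t` and `0` in the frame `R`. -/
def rotGradVec (X : E N → Ω → ℝ) (R : Fin N → Fin N → ℝ) (t : E N) : Fin N ⊕ Fin N → Ω → ℝ :=
  Sum.elim (fun c => rotGrad X R t c + rotGrad X R 0 c) (fun c => rotGrad X R t c - rotGrad X R 0 c)

/-- The factor by which the entries of `(∇²X(t), X(t), X(0))` are multiplied when the `a`-th frame
vector is multiplied by `s a`. -/
def entryScale (s : Fin N → ℝ) : UpperIdx N ⊕ Fin 2 → ℝ :=
  Sum.elim (fun p => s p.1.1 * s p.1.2) fun _ => 1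

/-- The matrix of `congrMap` for the scaled frame. -/
def frameMatrix (R : Fin N → Fin N → ℝ) (s : Fin N → ℝ) :
    Matrix (UpperIdx N ⊕ Fin 2) (UpperIdx N ⊕ Fin 2) ℝ :=
  LinearMap.toMatrix' (congrMap (Matrix.of fun a i => s a * R a i))

lemma frameMatrix_mulVec (R : Fin N → Fin N → ℝ) (s : Fin N → ℝ) (y : UpperIdx N ⊕ Fin 2 → ℝ) :
    frameMatrix R s *ᵥ y = congrMap (Matrix.of fun a i => s a * R a i) y :=
  LinearMap.toMatrix'_mulVec _ _

omit [MeasurableSpace Ω] in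
lemma entryScale_mul_rotVec (R : Fin N → Fin N → ℝ) (s : Fin N → ℝ) (t : E N)
    (p : UpperIdx N ⊕ Fin 2) (ω : Ω) :
    entryScale s p * rotVec X R t p ω = ∑ j, frameMatrix R s p j * valueVec X t j ω := by
  change _ = (frameMatrix R s *ᵥ fun j => valueVec X t j ω) p
  rw [frameMatrix_mulVec]
  rcases p with p | i
  · change _ = ((Matrix.of fun a i => s a * R a i) *
      (matri fun q => valueVec X t (.inl q) ω) * (Matrix.of fun a i => s a * R a i)ᵀ) p.1.1 p.1.2
    simp only [Matrix.mul_apply, Matrix.transpose_apply, Matrix.of_apply, matri, entryScale,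
      Sum.elim_inl, rotVec, rotHess, Finset.mul_sum, Finset.sum_mul, valueVec, symHess]
    rw [Finset.sum_comm]
    exact Finset.sum_congr rfl fun i _ => Finset.sum_congr rfl fun j _ => by ring
  · change _ = valueVec X t (.inr i) ω
    simp [entryScale, rotVec, valueVec]

omit [MeasurableSpace Ω] in
lemma rotGradVec_eq (R : Fin N → Fin N → ℝ) (t : E N) :
    rotGradVec X R t = fun i ω => ∑ j, Matrix.fromBlocks (Matrix.of R) (Matrix.of R)
      (Matrix.of R) (-Matrix.of R) i j * gradVec X t j ω := by
  ext (c | c) ω <;>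
  simp [rotGradVec, rotGrad, gradVec, sub_eq_add_neg]

namespace IsQualified

variable [IsProbabilityMeasure P] (hX : IsQualified P X ρ)
include hX

lemma memLp_valueVec (t : E N) (i : UpperIdx N ⊕ Fin 2) : MemLp (valueVec X t i) 2 P := by
  refine hX.isGaussianSpace.memLp ?_
  rcases i with p | i
  · exact hX.secondDeriv_mem _ _ _
  · fin_cases i
    · exact val_mem t
    · exact val_mem 0

lemma memLp_gradVec (t : E N) (i : Fin N ⊕ Fin N) : MemLp (gradVec X t i) 2 P := by
  rcases i with i | i <;> exact hX.isGaussianSpace.memLp (hX.grad_mem _ _)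

variable (hρ : SmoothNear ρ ε) {R : Fin N → Fin N → ℝ} {o : Fin N} {t : E N} (hR : IsFrame R o t)
  (hε : 0 < ε) (ht : ‖t‖ ^ 2 < ε)
include hρ hR hε ht

/-- Sums and differences are uncorrelated because both gradients have the same covariance and their
cross-covariance is symmetric. Different frame components are uncorrelated because the second
derivative of ρ(‖·‖²) at t is diagonal in a frame containing the direction of t. -/
lemma cov_rotGradVec_rotGradVec (b c : Fin N ⊕ Fin N) :
    cov[rotGradVec X R t b, rotGradVec X R t c; P] = if b = c then
      Sum.elim (fun c => 2 * sumVar ρ o c (‖t‖ ^ 2))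
        (fun c => 2 * (‖t‖ ^ 2 * diffVar ρ o c (‖t‖ ^ 2))) b else 0 := by
  have hm : ∀ s c, MemLp (rotGrad X R s c) 2 P := fun s c =>
    hX.isGaussianSpace.memLp (hX.rotGrad_mem R s c)
  have h1 : ∀ s a b, cov[rotGrad X R s a, rotGrad X R s b; P] =
      -(2 * kd a b * rhoDeriv ρ 1 0) := fun s a b => by
    rw [hX.cov_rotGrad_rotGrad hρ R (by simpa)]
    simp [form₂, hR.dot]
  have h2 : ∀ a b, cov[rotGrad X R t a, rotGrad X R 0 b; P] =
      -(2 * kd a b * rhoDeriv ρ 1 (‖t‖ ^ 2) +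
        4 * ‖t‖ ^ 2 * kd a o * kd b o * rhoDeriv ρ 2 (‖t‖ ^ 2)) := fun a b => by
    rw [hX.cov_rotGrad_rotGrad hρ R (by simpa)]
    simp only [form₂, hR.dot, zero_sub, norm_neg, WithLp.ofLp_neg, dotProduct_neg, hR.dot_dir]
    ring
  have h3 : ∀ a b, cov[rotGrad X R 0 a, rotGrad X R t b; P] =
      -(2 * kd a b * rhoDeriv ρ 1 (‖t‖ ^ 2) +
        4 * ‖t‖ ^ 2 * kd a o * kd b o * rhoDeriv ρ 2 (‖t‖ ^ 2)) := fun a b => by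
    rw [covariance_comm, h2, kd_comm]
    ring
  -- Extracts the factor ‖t‖² from the variance of the difference, leaving a quantity with a nonzero
  -- limit.
  have h4 := rhoDeriv_one_eq (ρ := ρ) (‖t‖ ^ 2)
  rcases b with a | a <;> rcases c with b | b
  · simp only [rotGradVec, Sum.elim_inl]
    rw [covariance_add_left (hm _ _) (hm _ _) ((hm _ _).add (hm _ _)),
      covariance_add_right (hm _ _) (hm _ _) (hm _ _),
      covariance_add_right (hm _ _) (hm _ _) (hm _ _), h1, h1, h2, h3]
    by_cases hab : a = b
    · subst hab
      by_cases hao : a = o <;> simp [kd, sumVar, hao] <;> ring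
    · have : ¬ (a = o ∧ b = o) := fun h => hab (h.1.trans h.2.symm)
      by_cases hao : a = o <;> by_cases hbo : b = o <;> simp_all [kd]
  · simp only [rotGradVec, Sum.elim_inl, Sum.elim_inr]
    rw [covariance_add_left (hm _ _) (hm _ _) ((hm _ _).sub (hm _ _)),
      covariance_sub_right (hm _ _) (hm _ _) (hm _ _),
      covariance_sub_right (hm _ _) (hm _ _) (hm _ _), h1, h1, h2, h3, if_neg (by simp)]
    ring
  · simp only [rotGradVec, Sum.elim_inl, Sum.elim_inr]
    rw [covariance_sub_left (hm _ _) (hm _ _) ((hm _ _).add (hm _ _)),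
      covariance_add_right (hm _ _) (hm _ _) (hm _ _),
      covariance_add_right (hm _ _) (hm _ _) (hm _ _), h1, h1, h2, h3, if_neg (by simp)]
    ring
  · simp only [rotGradVec, Sum.elim_inr]
    rw [covariance_sub_left (hm _ _) (hm _ _) ((hm _ _).sub (hm _ _)),
      covariance_sub_right (hm _ _) (hm _ _) (hm _ _),
      covariance_sub_right (hm _ _) (hm _ _) (hm _ _), h1, h1, h2, h3, h4]
    by_cases hab : a = b
    · subst hab
      by_cases hao : a = o <;> simp [kd, diffVar, hao] <;> ring
    · have : ¬ (a = o ∧ b = o) := fun h => hab (h.1.trans h.2.symm)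
      by_cases hao : a = o <;> by_cases hbo : b = o <;> simp_all [kd]

lemma cov_rotVec_rotVec (p q : UpperIdx N ⊕ Fin 2) :
    cov[rotVec X R t p, rotVec X R t q; P] = baseCov ρ o p q (‖t‖ ^ 2) := by
  have h1 : ∀ a b, cov[rotHess X R t a b, X t; P] = 2 * kd a b * rhoDeriv ρ 1 0 := fun a b => by
    rw [hX.cov_rotHess_val hρ R (by simpa)]
    simp [form₂, hR.dot]
  have h2 : ∀ a b, cov[rotHess X R t a b, X 0; P] = 2 * kd a b * rhoDeriv ρ 1 (‖t‖ ^ 2) +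
      4 * ‖t‖ ^ 2 * kd a o * kd b o * rhoDeriv ρ 2 (‖t‖ ^ 2) := fun a b => by
    rw [hX.cov_rotHess_val hρ R (by simpa)]
    simp only [form₂, hR.dot, zero_sub, norm_neg, WithLp.ofLp_neg, dotProduct_neg, hR.dot_dir]
    ring
  rcases p with p | i <;> rcases q with q | j
  · simp only [rotVec, Sum.elim_inl, baseCov]
    rw [hX.cov_rotHess_rotHess hρ R hε]
    simp [form₄, hR.dot]
  · fin_cases j <;> simp [rotVec, baseCov, h1, h2]
  · rw [covariance_comm]
    fin_cases i <;> simp [rotVec, baseCov, h1, h2]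
  · fin_cases i <;> fin_cases j <;>
      simp [rotVec, baseCov, hX.isotropic, hX.unit_variance, rhoDeriv_zero]

/-- The Hessian at t and X(t) correlate only with ∇X(0), and X(0) only with ∇X(t). The sign records
which of the two occurs. -/
lemma cov_rotVec_rotGrad (p : UpperIdx N ⊕ Fin 2) (c : Fin N) :
    cov[rotVec X R t p, rotGrad X R t c; P] =
        (1 + crossSign p) / 2 * (‖t‖ * crossCov ρ o p c (‖t‖ ^ 2)) ∧
      cov[rotVec X R t p, rotGrad X R 0 c; P] =
        (crossSign p - 1) / 2 * (‖t‖ * crossCov ρ o p c (‖t‖ ^ 2)) := by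
  rcases p with p | i
  · simp only [rotVec, Sum.elim_inl]
    rw [hX.cov_rotHess_rotGrad hρ R (by simpa), hX.cov_rotHess_rotGrad hρ R (by simpa)]
    constructor
    · simp [form₃, crossSign]
    · simp only [form₃, hR.dot, zero_sub, norm_neg, WithLp.ofLp_neg, dotProduct_neg, hR.dot_dir,
        crossSign, crossCov, Sum.elim_inl]
      ring
  · have h1 : ∀ s c, cov[X s, rotGrad X R s c; P] = 0 := fun s c => by
      rw [covariance_comm, hX.cov_rotGrad_val hρ R (by simpa)]
      simp
    have h2 : ∀ c, cov[X t, rotGrad X R 0 c; P] = -(2 * (‖t‖ * kd c o) * rhoDeriv ρ 1 (‖t‖ ^ 2)) :=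
      fun c => by
      rw [covariance_comm, hX.cov_rotGrad_val hρ R (by simpa)]
      simp [hR.dot_dir]
    have h3 : ∀ c, cov[X 0, rotGrad X R t c; P] = 2 * (‖t‖ * kd c o) * rhoDeriv ρ 1 (‖t‖ ^ 2) :=
      fun c => by
      rw [covariance_comm, hX.cov_rotGrad_val hρ R (by simpa)]
      simp [hR.dot_dir]
    fin_cases i
    · simp [rotVec, crossSign, crossCov, h1, h2]
      ring
    · simp [rotVec, crossSign, crossCov, h1, h3]
      ring

lemma frameMatrix_conj_condCov (ht0 : t ≠ 0) (hs : ∀ c, sumVar ρ o c (‖t‖ ^ 2) ≠ 0)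
    (hd : ∀ c, diffVar ρ o c (‖t‖ ^ 2) ≠ 0) (s : Fin N → ℝ) (p q : UpperIdx N ⊕ Fin 2) :
    (frameMatrix R s * condCov P X t * (frameMatrix R s)ᵀ) p q =
      entryScale s p * entryScale s q * condEntry ρ o p q (‖t‖ ^ 2) := by
  have hn : ‖t‖ ≠ 0 := norm_ne_zero_iff.2 ht0
  have hm : ∀ s c, MemLp (rotGrad X R s c) 2 P := fun s c =>
    hX.isGaussianSpace.memLp (hX.rotGrad_mem R s c)
  have hv : ∀ p, MemLp (rotVec X R t p) 2 P := by
    rintro (p | i)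
    · exact hX.isGaussianSpace.memLp (hX.rotHess_mem R t _ _)
    · exact hX.memLp_valueVec t (.inr i)
  rw [condCov_conj_apply (hX.memLp_valueVec t) (hX.memLp_gradVec t) (frameMatrix R s) _
    (w := Sum.elim (fun c => 2 * sumVar ρ o c (‖t‖ ^ 2))
        (fun c => 2 * (‖t‖ ^ 2 * diffVar ρ o c (‖t‖ ^ 2))))
    (by rintro (c | c) <;> simp [hs, hd, hn])
    (Y := fun p ω => entryScale s p * rotVec X R t p ω)
    (funext fun p => funext fun ω => entryScale_mul_rotVec R s t p ω) (rotGradVec_eq R t)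
    (hX.cov_rotGradVec_rotGradVec hρ hR hε ht)]
  simp only [covariance_const_mul_left, covariance_const_mul_right]
  rw [hX.cov_rotVec_rotVec hρ hR hε ht, condEntry, mul_sub, Finset.mul_sum, Fintype.sum_sum_type,
    ← Finset.sum_add_distrib]
  congr 1
  · ring
  · refine Finset.sum_congr rfl fun c _ => ?_
    have hc : ∀ p, crossSign p * crossSign p = (1 : ℝ) := fun p : UpperIdx N ⊕ Fin 2 => by
      rcases p with p | i
      · simp [crossSign]
      · fin_cases i <;> simp [crossSign]
    simp only [rotGradVec, Sum.elim_inl, Sum.elim_inr]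
    rw [covariance_add_right (hv _) (hm _ _) (hm _ _), covariance_add_right (hv _) (hm _ _) (hm _ _),
      covariance_sub_right (hv _) (hm _ _) (hm _ _), covariance_sub_right (hv _) (hm _ _) (hm _ _),
      (hX.cov_rotVec_rotGrad hρ hR hε ht p c).1, (hX.cov_rotVec_rotGrad hρ hR hε ht p c).2,
      (hX.cov_rotVec_rotGrad hρ hR hε ht q c).1, (hX.cov_rotVec_rotGrad hρ hR hε ht q c).2]
    have := hs c
    have := hd c
    field_simp
    ring

end IsQualified

end Formula

/-! ### Asymptotics of the conditional covariances as t → 0. -/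

section Limit

variable {N : ℕ} {ρ : ℝ → ℝ} {ε : ℝ} {o : Fin N}

/-- The number of occurrences of `o` in an index. -/
def order (o : Fin N) : UpperIdx N ⊕ Fin 2 → ℕ :=
  Sum.elim (fun p => (if p.1.1 = o then 1 else 0) + if p.1.2 = o then 1 else 0) fun _ => 0

/-- Minimality of `o` ensures that in an ordered pair it can only stand first, unless it stands
twice. -/
lemma order_cases (ho : ∀ i, o ≤ i) (p : UpperIdx N ⊕ Fin 2) :
    order o p = 0 ∨ (order o p = 2 ∧ p = .inl (diagIdx o)) ∨
      (order o p = 1 ∧ ∃ (b : Fin N) (hb : o ≤ b), b ≠ o ∧ p = .inl ⟨(o, b), hb⟩) := by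
  rcases p with ⟨⟨a, b⟩, hab⟩ | i
  · by_cases ha : a = o
    · subst ha
      by_cases hb : b = a
      · subst hb
        exact .inr (.inl ⟨by simp [order], rfl⟩)
      · exact .inr (.inr ⟨by simp [order, hb], b, hab, hb, rfl⟩)
    · have hb : b ≠ o := fun hb => ha (le_antisymm (by simpa [hb] using hab) (ho a))
      exact .inl (by simp [order, ha, hb])
  · exact .inl rfl

/-- The coefficient of `kd c o` in `crossCov`, for an index of even order. -/
def evenCross (ρ : ℝ → ℝ) (o : Fin N) : UpperIdx N ⊕ Fin 2 → ℝ → ℝ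
  | .inl p, x => if p.1.1 = o then 12 * rhoDeriv ρ 2 x + 8 * x * rhoDeriv ρ 3 x else
      4 * kd p.1.1 p.1.2 * rhoDeriv ρ 2 x
  | .inr _, x => 2 * rhoDeriv ρ 1 x

/-- Entries of even order see only the gradient component along t, whereas the entry (o, b) sees
only the component b. This decouples the two kinds of entries. -/
lemma crossCov_of_even {p : UpperIdx N ⊕ Fin 2} (hp : order o p ≠ 1) (c : Fin N) (x : ℝ) :
    crossCov ρ o p c x = evenCross ρ o p x * kd c o := by
  rcases p with ⟨⟨a, b⟩, hab⟩ | i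
  · by_cases ha : a = o <;> by_cases hb : b = o
    · simp only [crossCov, evenCross, ha, hb, kd_comm o c, if_true]
      simp only [kd, if_true]
      ring
    · simp [order, ha, hb] at hp
    · simp [order, ha, hb] at hp
    · simp [crossCov, evenCross, ha, hb, kd]
  · simp only [crossCov, evenCross]
    ring

lemma crossCov_of_odd {b : Fin N} (hob : o ≤ b) (hb : b ≠ o) (c : Fin N) (x : ℝ) :
    crossCov ρ o (.inl ⟨(o, b), hob⟩) c x = 4 * rhoDeriv ρ 2 x * kd b c := by
  simp [crossCov, kd, hb, hb.symm]

lemma condEntry_of_even {p q : UpperIdx N ⊕ Fin 2} (hp : order o p ≠ 1) (hq : order o q ≠ 1)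
    (x : ℝ) : condEntry ρ o p q x = baseCov ρ o p q x - evenCross ρ o p x * evenCross ρ o q x *
      (1 / (2 * diffVar ρ o o x) + crossSign p * crossSign q * (x / (2 * sumVar ρ o o x))) := by
  rw [condEntry, Finset.sum_eq_single o]
  · rw [crossCov_of_even hp, crossCov_of_even hq]
    simp [kd]
  · intro c _ hc
    rw [crossCov_of_even hp]
    simp [kd, hc]
  · simp

lemma baseCov_comm (p q : UpperIdx N ⊕ Fin 2) (x : ℝ) :
    baseCov ρ o p q x = baseCov ρ o q p x := by
  rcases p with p | i <;> rcases q with q | j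
  · simp only [baseCov]
    rw [kd_comm q.1.1 p.1.1, kd_comm q.1.2 p.1.2, kd_comm q.1.2 p.1.1, kd_comm q.1.1 p.1.2]
    ring
  · rfl
  · rfl
  · simp [baseCov, eq_comm]

lemma condEntry_comm (p q : UpperIdx N ⊕ Fin 2) (x : ℝ) :
    condEntry ρ o p q x = condEntry ρ o q p x := by
  rw [condEntry, condEntry, baseCov_comm]
  congr 1
  exact Finset.sum_congr rfl fun c _ => by ring

lemma condEntry_odd_even {b : Fin N} (hob : o ≤ b) (hb : b ≠ o) {q : UpperIdx N ⊕ Fin 2}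
    (hq : order o q ≠ 1) (x : ℝ) : condEntry ρ o (.inl ⟨(o, b), hob⟩) q x = 0 := by
  have h1 : baseCov ρ o (.inl ⟨(o, b), hob⟩) q x = 0 := by
    rcases q with ⟨⟨c, d⟩, hcd⟩ | i
    · by_cases hc : c = o <;> by_cases hd : d = o
      · simp [baseCov, kd, hc, hd, hb, hb.symm]
      · simp [order, hc, hd] at hq
      · simp [order, hc, hd] at hq
      · simp [baseCov, kd, hb.symm, Ne.symm hc, Ne.symm hd]
    · simp [baseCov, kd, hb, hb.symm]
  rw [condEntry, h1, Finset.sum_eq_zero, sub_zero]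
  intro c _
  rw [crossCov_of_odd hob hb, crossCov_of_even hq]
  by_cases hc : c = o
  · simp [kd, hc, hb]
  · simp [kd, hc]

lemma condEntry_odd_odd_zero {b d : Fin N} (hob : o ≤ b) (hb : b ≠ o) (hod : o ≤ d) (hd : d ≠ o)
    (_h2 : rhoDeriv ρ 2 0 ≠ 0) :
    condEntry ρ o (.inl ⟨(o, b), hob⟩) (.inl ⟨(o, d), hod⟩) 0 = 0 := by
  rw [condEntry, Finset.sum_eq_single b]
  · rw [crossCov_of_odd hob hb, crossCov_of_odd hod hd]
    simp [baseCov, kd, hb, hb.symm, hd.symm, diffVar, rhoSlope_zero, eq_comm]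
    split_ifs
    · field_simp
      ring
    · simp
  · intro c _ hc
    rw [crossCov_of_odd hob hb]
    simp [kd, Ne.symm hc]
  · simp

lemma condEntry_diag_even_zero {q : UpperIdx N ⊕ Fin 2} (hq : order o q ≠ 1)
    (h2 : rhoDeriv ρ 2 0 ≠ 0) : condEntry ρ o (.inl (diagIdx o)) q 0 = 0 := by
  rw [condEntry_of_even (by simp [order, diagIdx]) hq]
  rcases q with ⟨⟨c, d⟩, hcd⟩ | i
  · by_cases hc : c = o <;> by_cases hd : d = o
    · simp [baseCov, evenCross, diagIdx, kd, hc, hd, diffVar, rhoSlope_zero]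
      field_simp
      ring
    · simp [order, hc, hd] at hq
    · simp [order, hc, hd] at hq
    · simp [baseCov, evenCross, diagIdx, kd, hc, Ne.symm hc, Ne.symm hd, diffVar, rhoSlope_zero]
      split_ifs
      · field_simp
        ring
      · simp
  · simp [baseCov, evenCross, diagIdx, kd, diffVar, rhoSlope_zero]
    field_simp
    ring

/-- At x = 0 the difference of the gradients divided by ‖t‖ has become the row `o` of the Hessian,
so that conditioning on it annihilates this row. -/
lemma condEntry_zero (ho : ∀ i, o ≤ i) (h2 : rhoDeriv ρ 2 0 ≠ 0) {p q : UpperIdx N ⊕ Fin 2}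
    (h : order o p + order o q ≠ 0) : condEntry ρ o p q 0 = 0 := by
  rcases order_cases ho p with hp | ⟨hp, rfl⟩ | ⟨hp, b, hob, hb, rfl⟩ <;>
  rcases order_cases ho q with hq | ⟨hq, rfl⟩ | ⟨hq, d, hod, hd, rfl⟩
  · exact (h (by omega)).elim
  · rw [condEntry_comm]
    exact condEntry_diag_even_zero (by omega) h2
  · rw [condEntry_comm]
    exact condEntry_odd_even hod hd (by omega) 0
  · exact condEntry_diag_even_zero (by omega) h2
  · exact condEntry_diag_even_zero (by omega) h2
  · rw [condEntry_comm]
    exact condEntry_odd_even hod hd (by omega) 0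
  · exact condEntry_odd_even hob hb (by omega) 0
  · exact condEntry_odd_even hob hb (by omega) 0
  · exact condEntry_odd_odd_zero hob hb hod hd h2

lemma condEntry_odd (ho : ∀ i, o ≤ i) {p q : UpperIdx N ⊕ Fin 2}
    (h : Odd (order o p + order o q)) (x : ℝ) : condEntry ρ o p q x = 0 := by
  rcases order_cases ho p with hp | ⟨hp, rfl⟩ | ⟨hp, b, hob, hb, rfl⟩ <;>
  rcases order_cases ho q with hq | ⟨hq, rfl⟩ | ⟨hq, d, hod, hd, rfl⟩ <;>
  first
  | exact condEntry_odd_even hob hb (by omega) x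
  | exact (condEntry_comm _ _ _).trans (condEntry_odd_even hod hd (by omega) x)
  | (simp only [hp, hq] at h; exact absurd h (by decide))

lemma diffVar_zero (c : Fin N) : diffVar ρ o c 0 = (2 + 4 * kd c o) * rhoDeriv ρ 2 0 := by
  simp only [diffVar, rhoSlope_zero]
  ring

lemma sumVar_zero (c : Fin N) : sumVar ρ o c 0 = -4 * rhoDeriv ρ 1 0 := by
  simp only [sumVar]
  ring

lemma kd_nonneg (i j : Fin N) : 0 ≤ kd i j := by
  unfold kd
  split_ifs <;> simp

namespace SmoothNear

variable (hρ : SmoothNear ρ ε) (hε : 0 < ε)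
include hρ hε

lemma differentiableWithinAt_diffVar (c : Fin N) :
    DifferentiableWithinAt ℝ (diffVar ρ o c) (Set.Ici 0) 0 := by
  have hq := (hρ.hasDerivWithinAt_rhoSlope hε).differentiableWithinAt
  have h2 := (hρ.hasDerivWithinAt_zero hε (k := 2) (by norm_num)).differentiableWithinAt
  exact (hq.const_mul 2).fun_add (h2.const_mul (4 * kd c o))

lemma differentiableWithinAt_sumVar (c : Fin N) :
    DifferentiableWithinAt ℝ (sumVar ρ o c) (Set.Ici 0) 0 := by
  have h1 := (hρ.hasDerivWithinAt_zero hε (k := 1) (by norm_num)).differentiableWithinAt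
  have h2 := (hρ.hasDerivWithinAt_zero hε (k := 2) (by norm_num)).differentiableWithinAt
  unfold sumVar
  fun_prop

lemma differentiableWithinAt_crossCov (p : UpperIdx N ⊕ Fin 2) (c : Fin N) :
    DifferentiableWithinAt ℝ (crossCov ρ o p c) (Set.Ici 0) 0 := by
  have h1 := (hρ.hasDerivWithinAt_zero hε (k := 1) (by norm_num)).differentiableWithinAt
  have h2 := (hρ.hasDerivWithinAt_zero hε (k := 2) (by norm_num)).differentiableWithinAt
  have h3 := (hρ.hasDerivWithinAt_zero hε (k := 3) (by norm_num)).differentiableWithinAt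
  rcases p with p | i <;> unfold crossCov <;> fun_prop

lemma differentiableWithinAt_baseCov (p q : UpperIdx N ⊕ Fin 2) :
    DifferentiableWithinAt ℝ (baseCov ρ o p q) (Set.Ici 0) 0 := by
  have h0 := (hρ.hasDerivWithinAt_zero hε (k := 0) (by norm_num)).differentiableWithinAt
  have h1 := (hρ.hasDerivWithinAt_zero hε (k := 1) (by norm_num)).differentiableWithinAt
  have h2 := (hρ.hasDerivWithinAt_zero hε (k := 2) (by norm_num)).differentiableWithinAt
  rcases p with p | i <;> rcases q with q | j <;> unfold baseCov
  · fun_prop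
  · by_cases h : j = 0 <;> simp only [h, if_true, if_false] <;> fun_prop
  · by_cases h : i = 0 <;> simp only [h, if_true, if_false] <;> fun_prop
  · by_cases h : i = j <;> simp only [h, if_true, if_false] <;> fun_prop

lemma differentiableWithinAt_condEntry (h1 : rhoDeriv ρ 1 0 ≠ 0) (h2 : rhoDeriv ρ 2 0 ≠ 0)
    (p q : UpperIdx N ⊕ Fin 2) :
    DifferentiableWithinAt ℝ (condEntry ρ o p q) (Set.Ici 0) 0 := by
  unfold condEntry
  refine (hρ.differentiableWithinAt_baseCov hε p q).fun_sub
    (DifferentiableWithinAt.fun_sum fun c _ => ?_)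
  have hc := kd_nonneg c o
  have hd : (2 * diffVar ρ o c 0) ≠ 0 := by
    rw [diffVar_zero]
    have : 2 + 4 * kd c o ≠ 0 := by linarith
    positivity
  have hs : (2 * sumVar ρ o c 0) ≠ 0 := by
    rw [sumVar_zero]
    simpa using h1
  exact ((hρ.differentiableWithinAt_crossCov hε p c).fun_mul
    (hρ.differentiableWithinAt_crossCov hε q c)).fun_mul
    (((differentiableWithinAt_const 1).fun_div
      ((hρ.differentiableWithinAt_diffVar hε c).const_mul 2) hd).fun_add
      ((differentiableWithinAt_id.fun_div
        ((hρ.differentiableWithinAt_sumVar hε c).const_mul 2) hs).const_mul _))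

/-- The limit variance of the rescaled second derivative in the direction of `t`. -/
lemma hasDerivWithinAt_condEntry_diag (h1 : rhoDeriv ρ 1 0 ≠ 0) (h2 : rhoDeriv ρ 2 0 ≠ 0) :
    HasDerivWithinAt (condEntry ρ o (.inl (diagIdx o)) (.inl (diagIdx o)))
      ((-120 * rhoDeriv ρ 3 0 - 144 * rhoDeriv ρ 2 0 ^ 2 / (-2 * rhoDeriv ρ 1 0)) / 4)
      (Set.Ici 0) 0 := by
  have hq := hρ.hasDerivWithinAt_rhoSlope hε
  have d1 := hρ.hasDerivWithinAt_zero hε (k := 1) (by norm_num)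
  have d2 := hρ.hasDerivWithinAt_zero hε (k := 2) (by norm_num)
  have d3 := hρ.hasDerivWithinAt_zero hε (k := 3) (by norm_num)
  have did := hasDerivWithinAt_id (0 : ℝ) (Set.Ici 0)
  -- Only the gradient component along t contributes, through the difference and the sum of the
  -- gradients. The factor 1/4 in the derivative is the square of 1/2 in X_oo(t) ≈ (r/2) X_ooo.
  have hfun : condEntry ρ o (.inl (diagIdx o)) (.inl (diagIdx o)) = fun x =>
      12 * rhoDeriv ρ 2 0 - (12 * rhoDeriv ρ 2 x + 8 * x * rhoDeriv ρ 3 x) ^ 2 *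
        (1 / (2 * (2 * rhoSlope ρ x + 4 * rhoDeriv ρ 2 x)) +
          x / (2 * (-2 * rhoDeriv ρ 1 0 - 2 * rhoDeriv ρ 1 x - 4 * x * rhoDeriv ρ 2 x))) := by
    ext x
    rw [condEntry_of_even (by simp [order, diagIdx]) (by simp [order, diagIdx])]
    simp [baseCov, evenCross, diagIdx, kd, diffVar, sumVar, crossSign]
    ring
  rw [hfun]
  have e1 := ((d2.const_mul 12).fun_add ((did.const_mul 8).fun_mul d3)).fun_pow 2
  have e2 := ((hasDerivWithinAt_const (0 : ℝ) (Set.Ici 0) (1 : ℝ)).fun_div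
    (((hq.const_mul 2).fun_add (d2.const_mul 4)).const_mul 2)
    (by simp only [rhoSlope_zero]; intro h; apply h2; linarith))
  have e3 := did.fun_div ((((d1.const_mul 2).const_sub (-2 * rhoDeriv ρ 1 0)).fun_sub
    ((did.const_mul 4).fun_mul d2)).const_mul 2)
    (by simp only [id, mul_zero, zero_mul]; intro h; apply h1; linarith)
  refine ((e1.fun_mul (e2.fun_add e3)).const_sub (12 * rhoDeriv ρ 2 0)).congr_deriv ?_
  simp only [id, mul_zero, zero_mul, rhoSlope_zero, add_zero, sub_zero]
  have e4 : (2 * rhoDeriv ρ 2 0 + 4 * rhoDeriv ρ 2 0) = 6 * rhoDeriv ρ 2 0 := by ring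
  have e5 : (-2 * rhoDeriv ρ 1 0 - 2 * rhoDeriv ρ 1 0) = -4 * rhoDeriv ρ 1 0 := by ring
  rw [e4, e5]
  field_simp
  ring

end SmoothNear

/-- The limit of the conditional covariance matrix in an adapted frame whose vector in the
direction of `t` has length `‖t‖ ^ (-1 / 2)`. -/
def limitCov (ρ : ℝ → ℝ) (o : Fin N) : Matrix (UpperIdx N ⊕ Fin 2) (UpperIdx N ⊕ Fin 2) ℝ :=
  Matrix.of fun p q =>
    if order o p + order o q = 0 then condEntry ρ o p q 0
    else if order o p + order o q = 4 then
      (-120 * rhoDeriv ρ 3 0 - 144 * rhoDeriv ρ 2 0 ^ 2 / (-2 * rhoDeriv ρ 1 0)) / 4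
    else 0

/-- The lengths of the frame vectors. -/
def frameScale (o : Fin N) (r : ℝ) (a : Fin N) : ℝ := if a = o then (√r)⁻¹ else 1

lemma entryScale_frameScale (r : ℝ) (p : UpperIdx N ⊕ Fin 2) :
    entryScale (frameScale o r) p = (√r)⁻¹ ^ order o p := by
  rcases p with p | i
  · simp only [entryScale, Sum.elim_inl, frameScale, order, pow_add]
    congr 1 <;> split_ifs <;> simp
  · simp [entryScale, order]

/-- An entry of total order n is multiplied by r^(-n/2) and, if n > 0, vanishes at least to the
order x = r². So n = 4 gives the derivative at 0, n = 2 leaves a factor r, and for odd n the entry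
is identically zero. -/
lemma SmoothNear.tendsto_scaled_condEntry (hρ : SmoothNear ρ ε) (hε : 0 < ε) (ho : ∀ i, o ≤ i)
    (h1 : rhoDeriv ρ 1 0 ≠ 0) (h2 : rhoDeriv ρ 2 0 ≠ 0) (p q : UpperIdx N ⊕ Fin 2) :
    Tendsto (fun r : ℝ => entryScale (frameScale o r) p * entryScale (frameScale o r) q *
      condEntry ρ o p q (r ^ 2)) (𝓝[>] 0) (𝓝 (limitCov ρ o p q)) := by
  simp_rw [entryScale_frameScale, ← pow_add]
  have hd := hρ.differentiableWithinAt_condEntry (o := o) hε h1 h2 p q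
  have hr : Tendsto (fun r : ℝ => r) (𝓝[>] 0) (𝓝 0) := nhdsWithin_le_nhds
  have hsq : Tendsto (fun r : ℝ => r ^ 2) (𝓝[>] 0) (𝓝[>] 0) := by
    refine tendsto_nhdsWithin_iff.2 ⟨by simpa using hr.pow 2, ?_⟩
    filter_upwards [self_mem_nhdsWithin] with r hr using pow_pos (Set.mem_Ioi.1 hr) 2
  have hslope : ∀ {F' : ℝ}, HasDerivWithinAt (condEntry ρ o p q) F' (Set.Ici 0) 0 →
      condEntry ρ o p q 0 = 0 →
      Tendsto (fun r : ℝ => condEntry ρ o p q (r ^ 2) / r ^ 2) (𝓝[>] 0) (𝓝 F') := by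
    intro F' hF h0
    have h3 := hF.mono (Set.Ioi_subset_Ici_self : Set.Ioi (0 : ℝ) ⊆ Set.Ici 0)
    rw [hasDerivWithinAt_iff_tendsto_slope' (by simp)] at h3
    refine (h3.comp hsq).congr fun r => ?_
    simp [slope_def_field, h0]
  by_cases hn0 : order o p + order o q = 0
  · simp only [limitCov, Matrix.of_apply, hn0, if_true, pow_zero, one_mul]
    exact (hd.continuousWithinAt.tendsto.comp
      (hsq.mono_right (nhdsWithin_mono _ Set.Ioi_subset_Ici_self)))
  have h0 := condEntry_zero ho h2 hn0
  by_cases hn4 : order o p + order o q = 4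
  · obtain ⟨hp, rfl⟩ | ⟨hq, rfl⟩ : (order o p = 2 ∧ p = .inl (diagIdx o)) ∨ False := by
      rcases order_cases ho p with hp | hp | hp <;> rcases order_cases ho q with hq | hq | hq <;>
        first | exact .inl hp | omega
    obtain ⟨hq, rfl⟩ : (order o q = 2 ∧ q = .inl (diagIdx o)) := by
      rcases order_cases ho q with hq | hq | hq <;> first | exact hq | omega
    simp only [limitCov, Matrix.of_apply, hn4]
    refine (hslope (hρ.hasDerivWithinAt_condEntry_diag hε h1 h2) h0).congr' ?_
    filter_upwards [self_mem_nhdsWithin] with r hr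
    have : (√r)⁻¹ ^ 4 = (r ^ 2)⁻¹ := by
      rw [inv_pow, show 4 = 2 * 2 from rfl, pow_mul, Real.sq_sqrt (le_of_lt hr)]
    rw [this]
    field_simp
  · simp only [limitCov, Matrix.of_apply, hn0, hn4, if_false]
    by_cases hodd : Odd (order o p + order o q)
    · simp [condEntry_odd ho hodd]
    have hn2 : order o p + order o q = 2 := by
      rw [Nat.not_odd_iff_even] at hodd
      rcases order_cases ho p with hp | hp | hp <;> rcases order_cases ho q with hq | hq | hq <;>
        first | omega | (obtain ⟨k, hk⟩ := hodd; omega)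
    have h3 := hr.mul (hslope hd.hasDerivWithinAt h0)
    rw [zero_mul] at h3
    refine h3.congr' ?_
    filter_upwards [self_mem_nhdsWithin] with r hr
    have hr : 0 < r := hr
    rw [hn2, inv_pow, Real.sq_sqrt hr.le]
    field_simp

end Limit

/-! ### The limiting covariance, and the limit of the ratio. -/

section Main

variable {Ω : Type*} [MeasurableSpace Ω] {P : Measure Ω} [IsProbabilityMeasure P] {N : ℕ}
  {X : E N → Ω → ℝ} {ρ : ℝ → ℝ} {ε : ℝ} {o : Fin N}

/-- The limiting value and complementary block have the covariances conditional on X_oo(0) = 0: the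
variance of x is 1 - ρ'(0)²/(3ρ''(0)), and the covariance with X_aa is 2ρ'(0) - (2/3)ρ'(0) =
(4/3)ρ'(0), which is negative. Hence the constant c. -/
lemma IsQualified.isDegenerateCov_limitCov (hX : IsQualified P X ρ) (hρ : SmoothNear ρ ε)
    (hε : 0 < ε) : IsDegenerateCov (limitCov ρ o) o (-(4 * rhoDeriv ρ 1 0) / 3) := by
  have h1 := hX.rhoDeriv_one_neg hρ hε
  have h2 := hX.rhoDeriv_two_pos hρ hε
  have h3 := hX.sq_rhoDeriv_one_lt hρ hε
  have hval : ∀ a b : Fin 2, limitCov ρ o (Sum.inr a) (Sum.inr b) =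
      1 - rhoDeriv ρ 1 0 ^ 2 / (3 * rhoDeriv ρ 2 0) := fun a b => by
    have e : limitCov ρ o (Sum.inr a) (Sum.inr b) = condEntry ρ o (Sum.inr a) (Sum.inr b) 0 := by
      simp [limitCov, order]
    rw [e, condEntry_of_even (by simp [order]) (by simp [order]), diffVar_zero]
    simp [baseCov, evenCross, kd, rhoDeriv_zero, hX.unit_variance]
    field_simp
    ring
  refine ⟨by linarith, ?_, fun a b => by rw [hval, hval], ?_, ?_, ?_, ?_⟩
  · rw [hval, sub_pos, div_lt_one (by positivity)]
    exact h3
  · have := hX.third_variance_pos hρ hε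
    simp only [limitCov, Matrix.of_apply, order, diagIdx, Sum.elim_inl]
    norm_num
    norm_num at this
    linarith
  · intro j hj
    rcases j with ⟨⟨a, b⟩, hab⟩ | i
    · have : ¬ (a = o ∧ b = o) := fun h => hj (by obtain ⟨rfl, rfl⟩ := h; rfl)
      by_cases ha : a = o <;> by_cases hb : b = o <;> simp_all [limitCov, order, diagIdx]
    · simp [limitCov, order, diagIdx]
  · rintro ⟨⟨a, b⟩, hab⟩ hp hab'
    have : ¬ (a = o ∧ b = o) := fun h => hp (by obtain ⟨rfl, rfl⟩ := h; rfl)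
    by_cases ha : a = o <;> by_cases hb : b = o <;> simp_all [limitCov, order]
  · rintro ⟨⟨a, b⟩, hab⟩ ha hb
    simp only at ha hb
    have e : limitCov ρ o (Sum.inl ⟨(a, b), hab⟩) (Sum.inr 0) =
        condEntry ρ o (Sum.inl ⟨(a, b), hab⟩) (Sum.inr 0) 0 := by
      simp [limitCov, order, ha, hb]
    rw [e, condEntry_of_even (by simp [order, ha, hb]) (by simp [order]), diffVar_zero]
    simp [baseCov, evenCross, kd, ha]
    split_ifs
    · field_simp
      ring
    · simp

end Main

open scoped MatrixOrder in
lemma exists_eq_mul_transpose {ι : Type*} [Fintype ι] [DecidableEq ι] {V : Matrix ι ι ℝ}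
    (hV : V.PosSemidef) : ∃ B : Matrix ι ι ℝ, V = B * Bᵀ := by
  obtain ⟨B, hB⟩ := CStarAlgebra.nonneg_iff_eq_mul_star_self.1 hV.nonneg
  exact ⟨B, by rw [hB, Matrix.star_eq_conjTranspose, Matrix.conjTranspose_eq_transpose_of_trivial]⟩

lemma posSemidef_of_tendsto {ι α : Type*} [Fintype ι] {l : Filter α} [l.NeBot]
    {B : α → Matrix ι ι ℝ} {V : Matrix ι ι ℝ}
    (h : Tendsto (fun a => B a * (B a)ᵀ) l (𝓝 V)) : V.PosSemidef := by
  have hs : ∀ a, (B a * (B a)ᵀ).PosSemidef := fun a => by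
    have := Matrix.posSemidef_self_mul_conjTranspose (B a)
    rwa [Matrix.conjTranspose_eq_transpose_of_trivial] at this
  refine Matrix.PosSemidef.of_dotProduct_mulVec_nonneg ?_ fun x => ?_
  · have h1 : Tendsto (fun a => (B a * (B a)ᵀ)ᴴ) l (𝓝 Vᴴ) :=
      ((continuous_id.matrix_conjTranspose).tendsto V).comp h
    refine tendsto_nhds_unique (h1.congr fun a => (hs a).isHermitian.eq) h
  · have hc : Continuous fun M : Matrix ι ι ℝ => star x ⬝ᵥ (M *ᵥ x) := by fun_prop
    exact ge_of_tendsto ((hc.tendsto V).comp h) (.of_forall fun a => (hs a).dotProduct_mulVec_nonneg x)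

lemma gaussDensity_zero_pos {ι : Type*} [Fintype ι] [DecidableEq ι] {V : Matrix ι ι ℝ}
    (hV : V.PosDef) : 0 < gaussDensity V 0 := by
  have := hV.det_pos
  unfold gaussDensity
  positivity

lemma det_scaled_frame_ne_zero {N : ℕ} {R : Fin N → Fin N → ℝ} {o : Fin N} {t : E N}
    (hR : IsFrame R o t) {s : Fin N → ℝ} (hs : ∀ a, s a ≠ 0) :
    (Matrix.of fun a i => s a * R a i).det ≠ 0 := by
  have h : (Matrix.of fun a i => s a * R a i) * (Matrix.of fun a i => s a * R a i)ᵀ =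
      Matrix.diagonal fun a => s a ^ 2 := by
    ext a b
    have h1 : ∑ i, s a * R a i * (s b * R b i) = s a * s b * (R a ⬝ᵥ R b) := by
      rw [dotProduct, Finset.mul_sum]
      exact Finset.sum_congr rfl fun i _ => by ring
    rw [Matrix.mul_apply, Matrix.diagonal_apply]
    simp only [Matrix.transpose_apply, Matrix.of_apply]
    rw [h1, hR.dot]
    by_cases hab : a = b
    · subst hab
      simp [kd]
      ring
    · simp [kd, hab]
  intro h0
  have h2 := congrArg Matrix.det h
  rw [Matrix.det_mul, h0, zero_mul, Matrix.det_diagonal] at h2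
  exact (Finset.prod_ne_zero_iff.2 fun a _ => pow_ne_zero 2 (hs a)) h2.symm

section Main

variable {Ω : Type*} [MeasurableSpace Ω] {P : Measure Ω} {N : ℕ} {X : E N → Ω → ℝ} {ρ : ℝ → ℝ}

/-- The factor of `critDensity` which does not depend on the index `k`. -/
def critFactor (P : Measure Ω) (X : E N → Ω → ℝ) (u : ℝ) (t : E N) : ℝ :=
  (P.real {ω | u < X 0 ω})⁻¹ * (gaussDensity (covMat P (grad X 0) (grad X 0)) 0)⁻¹ *
    gaussDensity (covMat P (gradVec X t) (gradVec X t)) 0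

/-- Replaces the density, which has no limit as Σ(t) degenerates, by an integral against a fixed
Gaussian measure. -/
lemma critDensity_eq {t : E N} {B : Matrix (UpperIdx N ⊕ Fin 2) (UpperIdx N ⊕ Fin 2) ℝ}
    (hB : condCov P X t = B * Bᵀ) (hdet : B.det ≠ 0) (u : ℝ) (k : ℕ) :
    critDensity P X u k t =
      critFactor P X u t * ∫ z, kacRice k u (B *ᵥ z) ∂stdG (UpperIdx N ⊕ Fin 2) := by
  rw [critDensity, critFactor, ← integral_mul_gaussDensity B hdet, hB]
  congr 1
  have hm : MeasurableSet {y : UpperIdx N ⊕ Fin 2 → ℝ |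
      (fun p => y (Sum.inl p)) ∈ D N k ∧ u < y (Sum.inr 0) ∧ u < y (Sum.inr 1)} := by
    have h1 : Measurable fun (y : UpperIdx N ⊕ Fin 2 → ℝ) p => y (Sum.inl p) := by fun_prop
    exact (h1 (measurableSet_D k)).inter (measurableSet_above u)
  rw [← integral_indicator hm]
  congr 1
  ext y
  have h2 := indicator_D_abs_det k (fun p => y (Sum.inl p))
  by_cases hD : (fun p => y (Sum.inl p)) ∈ D N k <;>
  by_cases hu : u < y (Sum.inr 0) ∧ u < y (Sum.inr 1)
  · rw [Set.indicator_of_mem hD] at h2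
    rw [Set.indicator_of_mem (Set.mem_ofPred_eq ▸ ⟨hD, hu⟩), kacRice, if_pos hu, ← h2]
  · rw [Set.indicator_of_notMem fun h => hu h.2, kacRice, if_neg hu, zero_mul]
  · rw [Set.indicator_of_notMem hD] at h2
    rw [Set.indicator_of_notMem fun h => hD h.1, kacRice, if_pos hu, ← h2, zero_mul]
  · rw [Set.indicator_of_notMem fun h => hu h.2, kacRice, if_neg hu, zero_mul]

variable [IsProbabilityMeasure P]

lemma IsQualified.critFactor_ne_zero (hX : IsQualified P X ρ) (u : ℝ) {t : E N} (ht : t ≠ 0) :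
    critFactor P X u t ≠ 0 := by
  have hG := (posDef_condCov (hX.nondegenerate t ht)).1
  have hG0 : (covMat P (grad X 0) (grad X 0)).PosDef := hG.submatrix (e := Sum.inr) Sum.inr_injective
  have hlaw := hX.isGaussianSpace (X 0) (val_mem 0)
  have hP : P.real {ω | u < X 0 ω} ≠ 0 := by
    have hmap := hlaw.law.map_eq_gaussianReal
    have hvar : Var[X 0; P] = 1 := by
      rw [← covariance_self hlaw.law.aemeasurable, hX.isotropic]
      simp [hX.unit_variance]
    rw [hvar, hlaw.mean] at hmap
    have : Measure.IsOpenPosMeasure (gaussianReal 0 (Real.toNNReal 1)) :=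
      (gaussianReal_absolutelyContinuous' 0 (by simp)).isOpenPosMeasure
    have h1 : (gaussianReal 0 (Real.toNNReal 1)) (Set.Ioi u) ≠ 0 :=
      (isOpen_Ioi.measure_pos _ Set.nonempty_Ioi).ne'
    rw [← hmap, Measure.map_apply_of_aemeasurable hlaw.law.aemeasurable measurableSet_Ioi] at h1
    exact (measureReal_ne_zero_iff (measure_ne_top _ _)).2 h1
  exact mul_ne_zero (mul_ne_zero (inv_ne_zero hP) (inv_ne_zero (gaussDensity_zero_pos hG0).ne'))
    (gaussDensity_zero_pos hG).ne'

/-- The constant gathers the prefactor of the density and the squared determinant of the frame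
change. It does not depend on k, so it cancels in the ratio. -/
lemma IsQualified.exists_factor (hX : IsQualified P X ρ) (o : Fin N) {t : E N} (ht : t ≠ 0) :
    ∃ (R : Fin N → Fin N → ℝ) (A : Matrix (UpperIdx N ⊕ Fin 2) (UpperIdx N ⊕ Fin 2) ℝ),
      IsFrame R o t ∧
      A * Aᵀ = frameMatrix R (frameScale o ‖t‖) * condCov P X t *
        (frameMatrix R (frameScale o ‖t‖))ᵀ ∧
      ∀ u, ∃ c ≠ 0, ∀ k, critDensity P X u k t =
        c * ∫ z, kacRice k u (A *ᵥ z) ∂stdG (UpperIdx N ⊕ Fin 2) := by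
  obtain ⟨R, hR⟩ := exists_isFrame o ht
  have hpos := (posDef_condCov (hX.nondegenerate t ht)).2
  obtain ⟨B, hB⟩ := exists_eq_mul_transpose hpos.posSemidef
  have hdet : B.det ≠ 0 := fun h => hpos.det_pos.ne' (by rw [hB, Matrix.det_mul, h, zero_mul])
  have hS := det_scaled_frame_ne_zero hR (s := frameScale o ‖t‖) fun a => by
    have := norm_pos_iff.2 ht
    unfold frameScale
    split_ifs <;> positivity
  refine ⟨R, frameMatrix R (frameScale o ‖t‖) * B, hR, ?_, fun u =>
    ⟨critFactor P X u t / (Matrix.of fun a i => frameScale o ‖t‖ a * R a i).det ^ 2,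
      div_ne_zero (hX.critFactor_ne_zero u ht) (pow_ne_zero 2 hS), fun k => ?_⟩⟩
  · rw [hB, Matrix.transpose_mul]
    simp only [Matrix.mul_assoc]
  · simp_rw [← Matrix.mulVec_mulVec, frameMatrix_mulVec, kacRice_congrMap hS]
    rw [critDensity_eq hB hdet, integral_const_mul, ← mul_assoc,
      div_mul_cancel₀ _ (pow_ne_zero 2 hS)]

theorem IsQualified.tendsto_ratio (hX : IsQualified P X ρ) :
    ∃ ℓ : ℝ → ℝ,
      (∀ u, Tendsto (fun t : E N => critDensity P X u N t /
        (critDensity P X u (N - 1) t + critDensity P X u N t)) (𝓝[≠] 0) (𝓝 (ℓ u))) ∧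
      Tendsto ℓ atTop (𝓝 (1 / 2)) := by
  have hN := hX.two_le
  let o : Fin N := ⟨0, by omega⟩
  have ho : ∀ i, o ≤ i := fun i => Fin.mk_le_of_le_val (Nat.zero_le _)
  obtain ⟨ε, hε, hρ⟩ := hX.exists_smoothNear
  have h1 := hX.rhoDeriv_one_neg hρ hε
  have h2 := hX.rhoDeriv_two_pos hρ hε
  have hne : (𝓝[≠] (0 : E N)).NeBot := by
    have : Nontrivial (E N) := ⟨EuclideanSpace.single o 1, 0, by simp⟩
    infer_instance
  -- The frames and square roots are chosen with no continuity in t; only A Aᵀ has to converge, and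
  -- its limit does not involve the direction.
  choose! R A hR hA hc using fun (t : E N) (ht : t ≠ 0) => hX.exists_factor o ht
  have hnorm : Tendsto (fun t : E N => ‖t‖) (𝓝[≠] 0) (𝓝[>] 0) := tendsto_norm_nhdsNE_zero
  have hsq : Tendsto (fun t : E N => ‖t‖ ^ 2) (𝓝[≠] 0) (𝓝[≥] 0) := by
    refine tendsto_nhdsWithin_iff.2 ⟨?_, .of_forall fun t => Set.mem_Ici.2 (sq_nonneg _)⟩
    simpa using (hnorm.mono_right nhdsWithin_le_nhds).pow 2
  have hlim : Tendsto (fun t => A t * (A t)ᵀ) (𝓝[≠] 0) (𝓝 (limitCov ρ o)) := by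
    refine tendsto_pi_nhds.2 fun p => tendsto_pi_nhds.2 fun q => ?_
    refine ((hρ.tendsto_scaled_condEntry hε ho h1.ne h2.ne' p q).comp hnorm).congr' ?_
    have hs : ∀ᶠ t : E N in 𝓝[≠] 0, ∀ c, sumVar ρ o c (‖t‖ ^ 2) ≠ 0 :=
      eventually_all.2 fun c =>
        ((hρ.differentiableWithinAt_sumVar hε c).continuousWithinAt.tendsto.comp hsq).eventually_ne
          (by rw [sumVar_zero]; simpa using h1.ne)
    have hd : ∀ᶠ t : E N in 𝓝[≠] 0, ∀ c, diffVar ρ o c (‖t‖ ^ 2) ≠ 0 :=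
      eventually_all.2 fun c =>
        ((hρ.differentiableWithinAt_diffVar hε c).continuousWithinAt.tendsto.comp hsq).eventually_ne
          (by
            rw [diffVar_zero]
            have := kd_nonneg c o
            positivity)
    have hε' : ∀ᶠ t : E N in 𝓝[≠] 0, ‖t‖ ^ 2 < ε :=
      (hsq.mono_right nhdsWithin_le_nhds).eventually_lt_const hε
    filter_upwards [hs, hd, hε', self_mem_nhdsWithin] with t hs hd hε' ht
    rw [hA t ht, hX.frameMatrix_conj_condCov hρ (hR t ht) hε hε' ht hs hd]
    rfl
  -- The limit is singular, since X(t) and X(0) merge, but as a limit of covariance matrices it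
  -- still has a square root.
  obtain ⟨B, hB⟩ := exists_eq_mul_transpose (posSemidef_of_tendsto hlim)
  have hV := hX.isDegenerateCov_limitCov (o := o) hρ hε
  rw [hB] at hlim hV
  have hint : ∀ k u, Tendsto (fun t => ∫ z, kacRice k u (A t *ᵥ z) ∂stdG (UpperIdx N ⊕ Fin 2))
      (𝓝[≠] 0) (𝓝 (∫ z, kacRice k u (B *ᵥ z) ∂stdG (UpperIdx N ⊕ Fin 2))) := fun k u => by
    -- The integrand jumps only where a value equals u, which has probability zero because the
    -- limiting value has positive variance.
    have hb : B (Sum.inr 0) ⬝ᵥ B (Sum.inr 0) ≠ 0 := hV.val_pos.ne'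
    refine tendsto_integral_mulVec_of_tendsto_mul_transpose hlim (measurable_kacRice k u)
      (abs_kacRice_le k u) (p := fun y => y (Sum.inr 0) ≠ u ∧ y (Sum.inr 1) ≠ u) ?_
      (fun y hy => continuousAt_kacRice k u hy.1 hy.2) ?_
    · exact (measurableSet_eq_fun (measurable_pi_apply _) measurable_const).compl.inter
        (measurableSet_eq_fun (measurable_pi_apply _) measurable_const).compl
    · filter_upwards [ae_dotProduct_ne hb u] with z hz
      rw [hV.mulVec_inr, hV.mulVec_inr]
      exact ⟨hz, hz⟩
  refine ⟨_, fun u => ?_, hV.tendsto_ratio⟩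
  have hpos : (∫ z, kacRice (N - 1) u (B *ᵥ z) ∂stdG (UpperIdx N ⊕ Fin 2)) +
      ∫ z, kacRice N u (B *ᵥ z) ∂stdG (UpperIdx N ⊕ Fin 2) ≠ 0 :=
    (add_pos_of_nonneg_of_pos (integral_nonneg fun _ => kacRice_nonneg _ _ _)
      (hV.integral_kacRice_pos u)).ne'
  refine ((hint N u).div ((hint (N - 1) u).add (hint N u)) hpos).congr' ?_
  filter_upwards [self_mem_nhdsWithin] with t ht
  obtain ⟨c, hc0, hck⟩ := hc t ht u
  rw [hck, hck, ← mul_add, mul_div_mul_left _ _ hc0]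
  rfl

end Main

end GaussField

end

theorem mainTheorem3 {Ω : Type*} [MeasurableSpace Ω] (P : Measure Ω) [IsProbabilityMeasure P]
    {N : ℕ} (X : GaussField.E N → Ω → ℝ) (ρ : ℝ → ℝ)
    (hX : GaussField.IsQualifiedUnderPerturbation P X ρ)
    (δ : ℝ) (hδ : 0 < δ)
    (hρ : ∀ x ∈ Set.Ioc 0 (δ ^ 2),
      GaussField.rhoDeriv ρ 1 x < 0 ∧
      GaussField.rhoDeriv ρ 1 x ^ 2 + 2 * GaussField.rhoDeriv ρ 1 x * GaussField.rhoDeriv ρ 2 x * x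
          + 4 * GaussField.rhoDeriv ρ 2 x ^ 2 * x ^ 2
        < GaussField.rhoDeriv ρ 1 0 ^ 2) :
    ∃ ℓ : ℝ → ℝ,
      (∀ u > 0, Tendsto
        (fun t : GaussField.E N =>
          GaussField.critDensity P X u N t /
            (GaussField.critDensity P X u (N - 1) t + GaussField.critDensity P X u N t))
        (𝓝[≠] 0) (𝓝 (ℓ u))) ∧
      Tendsto ℓ atTop (𝓝 (1 / 2)) := by
  obtain ⟨ℓ, h1, h2⟩ := hX.1.tendsto_ratio
  exact ⟨ℓ, fun u _ => h1 u, h2⟩
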